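/- Let $R$ be a reduced excellent commutative ring of Krull dimension one and let $K$ be its total ring of fractions. A \emph{central $R$-order} is an $R$-algebra $A$ such that $R \to A$ is injective with image the center $Z(A)$, $A$ is finitely generated and torsion free as an $R$-module (nonzerodivisors of $R$ act injectively), and the rational envelope $K \otimes_R A$ is a semisimple ring (it is then automatically a central $K$-algebra). For a maximal ideal $\mathfrak m$ of $R$ let $\widehat R_{\mathfrak m}$ be the completion of the local ring $R_{\mathfrak m}$ and put $A_{\mathfrak m} = R_{\mathfrak m} \otimes_R A$ and $\widehat A_{\mathfrak m} = \widehat R_{\mathfrak m} \otimes_R A$. Let $\mathfrak S_A$ be the set of all maximal ideals $\mathfrak m$ of $R$ such that $A_{\mathfrak m}$ is not a maximal $R_{\mathfrak m}$-order in $\operatorname{Quot}(R_{\mathfrak m}) \otimes_{R_{\mathfrak m}} A_{\mathfrak m}$ (that is, is properly contained in another $R_{\mathfrak m}$-subalgebra which is finitely generated as an $R_{\mathfrak m}$-module), where $\operatorname{Quot}(R_{\mathfrak m})$ is the total ring of fractions of $R_{\mathfrak m}$. Two algebras $C$ and $D$ over a commutative ring $S$ are \emph{centrally Morita equivalent} (over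 $S$) if there is an equivalence between their categories of left modules that carries multiplication by $s$ to multiplication by $s$ for every $s \in S$. Let $A$ and $B$ be central $R$-orders with rational envelopes $\Lambda = K \otimes_R A$ and $\Gamma = K \otimes_R B$. Then $A$ and $B$ are centrally Morita equivalent over $R$ if and only if the following three conditions hold: \begin{itemize} \item $\Lambda$ and $\Gamma$ are centrally Morita equivalent over $K$; \item $\mathfrak S_A = \mathfrak S_B$; \item for every $\mathfrak m \in \mathfrak S_A$, the $\widehat R_{\mathfrak m}$-algebras $\widehat A_{\mathfrak m}$ and $\widehat B_{\mathfrak m}$ are centrally Morita equivalent over $\widehat R_{\mathfrak m}$. \end{itemize} -/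

import Mathlib

open scoped TensorProduct

universe u v w

/-! ### Excellent rings -/

/-- A commutative ring is catenary if for all primes `p ≤ q` the lengths of strictly increasing
chains of primes from `p` to `q` are bounded and all saturated chains have the same length. -/
def IsCatenaryRing (S : Type u) [CommRing S] : Prop :=
  ∀ p q : PrimeSpectrum S, p ≤ q → ∃ n : ℕ,
    (∀ s : LTSeries (PrimeSpectrum S), s.head = p → s.last = q → s.length ≤ n) ∧
    (∀ s : RelSeries {x : PrimeSpectrum S × PrimeSpectrum S | x.1 ⋖ x.2},
      s.head = p → s.last = q → s.length = n)

/-- Every finitely generated `R`-algebra is catenary. -/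
def IsUniversallyCatenary (R : Type u) [CommRing R] : Prop :=
  ∀ (S : Type u) [CommRing S] [Algebra R S] [Algebra.FiniteType R S], IsCatenaryRing S

/-- A `k`-algebra is geometrically regular if it stays regular after every finite extension of the
base field `k`. -/
def IsGeometricallyRegular (k : Type u) [Field k] (S : Type v) [CommRing S] [Algebra k S] : Prop :=
  ∀ (L : Type u) [Field L] [Algebra k L] [FiniteDimensional k L], IsRegularRing (L ⊗[k] S)

/-- The completion of the local ring `R_p` at its maximal ideal. -/
abbrev LocalCompletion {R : Type u} [CommRing R] (p : Ideal R) [p.IsPrime] : Type u :=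
  AdicCompletion (IsLocalRing.maximalIdeal (Localization.AtPrime p)) (Localization.AtPrime p)

/-- All formal fibres (the fibres of `R_p → R̂_p` for the primes `p` of `R`) are geometrically
regular. -/
def HasGeometricallyRegularFormalFibres (R : Type u) [CommRing R] : Prop :=
  ∀ (p : Ideal R) [p.IsPrime] (q : Ideal (Localization.AtPrime p)) [q.IsPrime],
    IsGeometricallyRegular q.ResidueField (q.Fiber (LocalCompletion p))

/-- The regular locus of every finitely generated `R`-algebra is open. -/
def IsJ2Ring (R : Type u) [CommRing R] : Prop :=
  ∀ (S : Type u) [CommRing S] [Algebra R S] [Algebra.FiniteType R S],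
    IsOpen {p : PrimeSpectrum S | IsRegularLocalRing (Localization.AtPrime p.asIdeal)}

/-- Excellent rings: noetherian, universally catenary, with geometrically regular formal fibres
(so a G-ring), and J-2. -/
structure IsExcellentRing (R : Type u) [CommRing R] : Prop where
  noetherian : IsNoetherianRing R
  universallyCatenary : IsUniversallyCatenary R
  formalFibres : HasGeometricallyRegularFormalFibres R
  j2 : IsJ2Ring R

/-! ### Orders -/

/-- The rational envelope `K ⊗_R A` of an `R`-algebra `A`, where `K` is the total ring of fractions
of `R`. -/
abbrev RationalEnvelope (R : Type u) [CommRing R] (A : Type v) [Ring A] [Algebra R A] :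
    Type (max u v) :=
  FractionRing R ⊗[R] A

/-- An `R`-order: a finite `R`-algebra containing `R`, torsion free as an `R`-module, with
semisimple rational envelope. It is central if its center is `R`. -/
structure IsCentralOrder (R : Type u) [CommRing R] (A : Type v) [Ring A] [Algebra R A] :
    Prop where
  finite : Module.Finite R A
  injective : Function.Injective (algebraMap R A)
  torsionFree : Module.IsTorsionFree R A
  semisimple : IsSemisimpleRing (RationalEnvelope R A)
  central : Algebra.IsCentral R A

/-- An `R`-order in the `K`-algebra `Λ`: an `R`-subalgebra that is a finitely generated `R`-module
and spans `Λ` over `K`. -/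
def IsOrderIn (R : Type u) [CommRing R] (K : Type v) [CommRing K] {Λ : Type w} [Ring Λ]
    [Algebra R Λ] [Algebra K Λ] (A : Subalgebra R Λ) : Prop :=
  Module.Finite R A ∧ Submodule.span K (A : Set Λ) = ⊤

/-- The image of `A` in its rational envelope is maximal (with respect to inclusion) among the
`R`-orders in that envelope. -/
def IsMaximalOrder (R : Type u) [CommRing R] (A : Type v) [Ring A] [Algebra R A] : Prop :=
  Maximal (IsOrderIn R (FractionRing R))
    (Algebra.TensorProduct.includeRight : A →ₐ[R] RationalEnvelope R A).range

/-- The non-regular locus: the maximal ideals `m` of `R` for which the localization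
`A_m = R_m ⊗_R A` is not a maximal `R_m`-order. -/
def nonRegularLocus (R : Type u) [CommRing R] (A : Type v) [Ring A] [Algebra R A] :
    Set (MaximalSpectrum R) :=
  {m | ¬ IsMaximalOrder (Localization.AtPrime m.asIdeal) (Localization.AtPrime m.asIdeal ⊗[R] A)}

/-- The completion `Â_m = R̂_m ⊗_R A`, an algebra over `R̂_m`. -/
abbrev CompletionAt {R : Type u} [CommRing R] (A : Type v) [Ring A] [Algebra R A]
    (m : MaximalSpectrum R) : Type (max u v) :=
  LocalCompletion m.asIdeal ⊗[R] A

/-- `A` and `B` are centrally Morita equivalent over `R`: there is an equivalence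
`Φ : A-Mod ≌ B-Mod` which is `R`-linear, that is, which carries multiplication by `r` on `M` to
multiplication by `r` on `Φ(M)` for all `r` in `R`. When `R` is the center of both `A` and `B`, this
says that the automorphism of `R` induced by `Φ` on the centers of the two categories is the
identity. -/
abbrev CentrallyMoritaEquivalent (R : Type u) [CommRing R] (A : Type v) [Ring A] [Algebra R A]
    (B : Type w) [Ring B] [Algebra R B] : Prop :=
  IsMoritaEquivalent R A B

/-!
Morita equivalence is expressed by linking algebras (`Linking`): an algebra `Ω` with complementary
full idempotents `e` and `f` whose corners `e Ω e` and `f Ω f` are `A` and `B`. Two algebras are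
Morita equivalent if and only if they have a common linking algebra
(`IsMoritaEquivalent.exists_linking` and `Linking.isMoritaEquivalent`). Linking algebras can be
tensored with any commutative base, and maximality of orders passes between `A`, `Ω` and `B`
(`nonRegularLocus_eq_of_linking`). So a Morita equivalence over `R` implies the three local
conditions.

For the converse let `Ω` be a linking algebra of the rational envelopes. It contains `A` and `B` in
its corners (`RationalLinking`), and a lattice is a full finitely generated `A`-`B`-submodule `L` of
`e Ω f` (`RationalLinking.IsLattice`). It has a dual `dual L` in `f Ω e`. If `L * dual L` contains
`e` and `dual L * L` contains `f` at every maximal ideal, then the matrices with entries in `A`,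
`L`, `dual L` and `B` form a linking algebra of `A` and `B` over `R`
(`RationalLinking.IsLattice.isMoritaEquivalent`). Any lattice is invertible in this sense at all but
finitely many maximal ideals, and since `R` has dimension at most one a lattice may be changed at
one maximal ideal without changing it at the others. So it is enough to find an invertible lattice
for one maximal ideal `m` at a time (`RationalLinking.exists_isLattice_forall_isInvertibleAt`).

If `A` and `B` are both maximal at `m`, every lattice is invertible at `m`
(`RationalLinking.IsLattice.isInvertibleAt_of_isMaximalAt`): this is the classical theorem that the
two-sided ideals of a maximal order are invertible.

Otherwise there is a linking algebra `O` of the completions at `m`. It has to be compared with `Ω`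
over the Artinian ring `S` that arises from the completion of `R` by inverting the regular elements
of `R`. A semisimple
algebra that is finite over its center is Azumaya, so over `S` a Morita equivalence of the rational
envelopes that is the identity on the centers is unique up to twisting with an invertible module
over `S`; such modules are trivial as `S` is Artinian. So `Ω` and `O` become isomorphic over `S`
(`Linking.exists_algHom`, `Linking.exists_algHom_completion`). Now the elements of `O` that express
the fullness of `e` and `f` are approximated by elements of `Ω`, up to an error in `m O`. The
approximations generate a lattice which is invertible at `m` by the lemma of Nakayama
(`RationalLinking.Comparison.exists_isLattice_isInvertibleAt`).
-/

/-! ### Linking algebras -/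

/-- A linking algebra for two `S`-algebras `A` and `B`: an `S`-algebra `Ω` with complementary full
idempotents `e` and `f`, together with identifications of `A` with `e Ω e` and of `B` with `f Ω f`.
The identification of `A` with the corner is encoded by the (non-unital) embedding `i : A → Ω`, for
which `e = i 1`, and by the compression `p : Ω → A` with `i (p x) = e x e`; likewise for `B`. All
axioms are equations between elements, so that the structure is stable under base change. -/
structure Linking (S : Type u) [CommRing S] (A B Ω : Type u) [Ring A] [Algebra S A]
    [Ring B] [Algebra S B] [Ring Ω] [Algebra S Ω] where
  /-- The embedding of `A` as the corner `e Ω e`. -/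
  i : A →ₗ[S] Ω
  /-- The compression `x ↦ e x e`, as a map to `A`. -/
  p : Ω →ₗ[S] A
  /-- The embedding of `B` as the corner `f Ω f`. -/
  j : B →ₗ[S] Ω
  /-- The compression `x ↦ f x f`, as a map to `B`. -/
  q : Ω →ₗ[S] B
  i_mul : ∀ a a', i (a * a') = i a * i a'
  j_mul : ∀ b b', j (b * b') = j b * j b'
  p_i : ∀ a, p (i a) = a
  q_j : ∀ b, q (j b) = b
  i_p : ∀ x, i (p x) = i 1 * x * i 1
  j_q : ∀ x, j (q x) = j 1 * x * j 1
  add_one : i 1 + j 1 = 1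
  full_left : ∃ (n : ℕ) (x y : Fin n → Ω), i 1 = ∑ k, x k * j 1 * y k
  full_right : ∃ (n : ℕ) (x y : Fin n → Ω), j 1 = ∑ k, x k * i 1 * y k

namespace Linking

variable {S : Type u} [CommRing S] {A B Ω : Type u} [Ring A] [Algebra S A]
    [Ring B] [Algebra S B] [Ring Ω] [Algebra S Ω]

/-- The linking algebra with the roles of the two corners exchanged. -/
def symm (l : Linking S A B Ω) : Linking S B A Ω where
  i := l.j
  p := l.q
  j := l.i
  q := l.p
  i_mul := l.j_mul
  j_mul := l.i_mul
  p_i := l.q_j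
  q_j := l.p_i
  i_p := l.j_q
  j_q := l.i_p
  add_one := by rw [add_comm, l.add_one]
  full_left := l.full_right
  full_right := l.full_left

variable (l : Linking S A B Ω)

lemma i_injective : Function.Injective l.i := Function.LeftInverse.injective l.p_i

lemma j_injective : Function.Injective l.j := Function.LeftInverse.injective l.q_j

lemma e_mul_e : l.i 1 * l.i 1 = l.i 1 := by rw [← l.i_mul, one_mul]

lemma f_mul_f : l.j 1 * l.j 1 = l.j 1 := by rw [← l.j_mul, one_mul]

lemma e_mul_i (a : A) : l.i 1 * l.i a = l.i a := by rw [← l.i_mul, one_mul]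

lemma i_mul_e (a : A) : l.i a * l.i 1 = l.i a := by rw [← l.i_mul, mul_one]

lemma f_mul_j (b : B) : l.j 1 * l.j b = l.j b := by rw [← l.j_mul, one_mul]

lemma j_mul_f (b : B) : l.j b * l.j 1 = l.j b := by rw [← l.j_mul, mul_one]

lemma f_eq : l.j 1 = 1 - l.i 1 := eq_sub_of_add_eq' l.add_one

lemma e_mul_f : l.i 1 * l.j 1 = 0 := by rw [f_eq, mul_sub, mul_one, e_mul_e, sub_self]

lemma f_mul_e : l.j 1 * l.i 1 = 0 := l.symm.e_mul_f

lemma p_mul_i (a : A) (x : Ω) : l.p (l.i a * x) = a * l.p x := by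
  apply l.i_injective
  rw [l.i_p, l.i_mul, l.i_p, ← mul_assoc, e_mul_i]
  simp only [← mul_assoc, i_mul_e]

lemma p_i_mul (a : A) (x : Ω) : l.p (x * l.i a) = l.p x * a := by
  apply l.i_injective
  rw [l.i_p, l.i_mul, l.i_p, mul_assoc, mul_assoc, i_mul_e]
  simp only [mul_assoc, e_mul_i]

/-- Transport of a linking algebra along isomorphisms of the two corners. -/
def congr {A' B' : Type u} [Ring A'] [Algebra S A'] [Ring B'] [Algebra S B']
    (l : Linking S A B Ω) (α : A' ≃ₐ[S] A) (β : B' ≃ₐ[S] B) : Linking S A' B' Ω where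
  i := l.i ∘ₗ α.toLinearMap
  p := α.symm.toLinearMap ∘ₗ l.p
  j := l.j ∘ₗ β.toLinearMap
  q := β.symm.toLinearMap ∘ₗ l.q
  i_mul a a' := by simp [l.i_mul]
  j_mul a a' := by simp [l.j_mul]
  p_i a := by simp [l.p_i]
  q_j a := by simp [l.q_j]
  i_p a := by simp [l.i_p]
  j_q a := by simp [l.j_q]
  add_one := by simpa using l.add_one
  full_left := by simpa using l.full_left
  full_right := by simpa using l.full_right

section BaseChange

variable (T : Type u) [CommRing T] [Algebra S T]

lemma baseChange_mul_aux {C D : Type u} [Ring C] [Algebra S C] [Ring D] [Algebra S D]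
    (g : C →ₗ[S] D) (hg : ∀ a a', g (a * a') = g a * g a') (x y : T ⊗[S] C) :
    g.baseChange T (x * y) = g.baseChange T x * g.baseChange T y := by
  induction x with
  | zero => simp
  | add x₁ x₂ h₁ h₂ => simp only [add_mul, map_add, h₁, h₂]
  | tmul t c =>
    induction y with
    | zero => simp
    | add y₁ y₂ h₁ h₂ => simp only [mul_add, map_add, h₁, h₂]
    | tmul t' c' => simp [hg]

/-- The base change of a linking algebra along `S → T`. -/
noncomputable def baseChange : Linking T (T ⊗[S] A) (T ⊗[S] B) (T ⊗[S] Ω) where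
  i := l.i.baseChange T
  p := l.p.baseChange T
  j := l.j.baseChange T
  q := l.q.baseChange T
  i_mul := baseChange_mul_aux T l.i l.i_mul
  j_mul := baseChange_mul_aux T l.j l.j_mul
  p_i a := by
    have : l.p ∘ₗ l.i = LinearMap.id := LinearMap.ext l.p_i
    rw [← LinearMap.comp_apply, ← LinearMap.baseChange_comp, this, LinearMap.baseChange_id,
      LinearMap.id_apply]
  q_j a := by
    have : l.q ∘ₗ l.j = LinearMap.id := LinearMap.ext l.q_j
    rw [← LinearMap.comp_apply, ← LinearMap.baseChange_comp, this, LinearMap.baseChange_id,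
      LinearMap.id_apply]
  i_p x := by
    induction x with
    | zero => simp
    | add x y hx hy => rw [map_add, map_add, hx, hy, mul_add, add_mul]
    | tmul t x => simp [l.i_p, Algebra.TensorProduct.one_def]
  j_q x := by
    induction x with
    | zero => simp
    | add x y hx hy => rw [map_add, map_add, hx, hy, mul_add, add_mul]
    | tmul t x => simp [l.j_q, Algebra.TensorProduct.one_def]
  add_one := by
    simp [Algebra.TensorProduct.one_def, ← TensorProduct.tmul_add, l.add_one]
  full_left := by
    obtain ⟨n, x, y, h⟩ := l.full_left
    refine ⟨n, fun k => 1 ⊗ₜ x k, fun k => 1 ⊗ₜ y k, ?_⟩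
    simp [Algebra.TensorProduct.one_def, h, TensorProduct.tmul_sum]
  full_right := by
    obtain ⟨n, x, y, h⟩ := l.full_right
    refine ⟨n, fun k => 1 ⊗ₜ x k, fun k => 1 ⊗ₜ y k, ?_⟩
    simp [Algebra.TensorProduct.one_def, h, TensorProduct.tmul_sum]

@[simp] lemma baseChange_i_tmul (t : T) (a : A) : (l.baseChange T).i (t ⊗ₜ a) = t ⊗ₜ l.i a := by
  simp [baseChange]

end BaseChange

end Linking

/-! ### From linking algebras to Morita equivalences -/

namespace Linking

open CategoryTheory

open scoped ModuleCat.Algebra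

variable {S : Type u} [CommRing S] {A B Ω : Type u} [Ring A] [Algebra S A]
    [Ring B] [Algebra S B] [Ring Ω] [Algebra S Ω] (l : Linking S A B Ω)

/-- The corner `e M` of an `Ω`-module `M`. -/
def corner (M : Type u) [AddCommGroup M] [Module Ω M] : AddSubgroup M where
  carrier := {m | l.i 1 • m = m}
  add_mem' {x y} hx hy := by
    simp only [Set.mem_ofPred_eq] at *
    rw [smul_add, hx, hy]
  zero_mem' := by simp
  neg_mem' {x} hx := by
    simp only [Set.mem_ofPred_eq] at *
    rw [smul_neg, hx]

lemma mem_corner {M : Type u} [AddCommGroup M] [Module Ω M] {m : M} :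
    m ∈ l.corner M ↔ l.i 1 • m = m := Iff.rfl

lemma smul_mem_corner {M : Type u} [AddCommGroup M] [Module Ω M] (a : A) (m : M) :
    l.i a • m ∈ l.corner M := by
  rw [mem_corner, ← mul_smul, e_mul_i]

instance cornerModule (M : Type u) [AddCommGroup M] [Module Ω M] : Module A (l.corner M) where
  smul a m := ⟨l.i a • (m : M), l.smul_mem_corner a (m : M)⟩
  one_smul m := Subtype.ext m.2
  mul_smul a b m := Subtype.ext (by
    change l.i (a * b) • (m : M) = l.i a • l.i b • (m : M)
    rw [l.i_mul, mul_smul])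
  smul_zero a := Subtype.ext (smul_zero _)
  smul_add a m n := Subtype.ext (smul_add _ _ _)
  add_smul a b m := Subtype.ext (by
    change l.i (a + b) • (m : M) = l.i a • (m : M) + l.i b • (m : M)
    rw [map_add, add_smul])
  zero_smul m := Subtype.ext (by
    change l.i 0 • (m : M) = 0
    rw [map_zero, zero_smul])

@[simp] lemma coe_smul_corner {M : Type u} [AddCommGroup M] [Module Ω M] (a : A)
    (m : l.corner M) : ((a • m : l.corner M) : M) = l.i a • (m : M) := rfl

/-- The map induced on corners by an `Ω`-linear map. -/
def cornerMap {M N : Type u} [AddCommGroup M] [Module Ω M] [AddCommGroup N] [Module Ω N]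
    (g : M →ₗ[Ω] N) : l.corner M →ₗ[A] l.corner N where
  toFun m := ⟨g m, by rw [mem_corner, ← map_smul, m.2]⟩
  map_add' m n := Subtype.ext (map_add g _ _)
  map_smul' a m := Subtype.ext (map_smul g _ _)

/-- The corner functor `M ↦ e M`. -/
def cornerFunctor : ModuleCat.{u} Ω ⥤ ModuleCat.{u} A where
  obj M := ModuleCat.of A (l.corner M)
  map g := ModuleCat.ofHom (l.cornerMap g.hom)

lemma algebraMap_smul_corner {M : Type u} [AddCommGroup M] [Module Ω M] (s : S)
    (m : l.corner M) :
    ((algebraMap S A s • m : l.corner M) : M) = algebraMap S Ω s • (m : M) := by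
  rw [coe_smul_corner, Algebra.algebraMap_eq_smul_one, map_smul, Algebra.smul_def, mul_smul, m.2]

instance : l.cornerFunctor.Linear S where
  map_smul g s := by
    ext m
    exact Subtype.ext (l.algebraMap_smul_corner s (l.cornerMap g.hom m)).symm

/-- Because `Ω = Ω e Ω`, an `A`-linear map between corners extends to an `Ω`-linear map. -/
lemma cornerMap_bijective (M N : Type u) [AddCommGroup M] [Module Ω M] [AddCommGroup N]
    [Module Ω N] : Function.Bijective (l.cornerMap : (M →ₗ[Ω] N) → _) := by
  obtain ⟨n, x, y, hxy⟩ := l.full_right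
  -- `1 = ∑ x' k * e * y' k`
  obtain ⟨n, x, y, hxy⟩ : ∃ (n : ℕ) (x y : Fin n → Ω), 1 = ∑ k, x k * l.i 1 * y k := by
    refine ⟨n + 1, Fin.cons 1 x, Fin.cons 1 y, ?_⟩
    rw [Fin.sum_univ_succ]
    simp [← hxy, l.add_one]
  have key : ∀ (M : Type u) [AddCommGroup M] [Module Ω M] (m : M),
      m = ∑ k, x k • l.i 1 • y k • m := by
    intro M _ _ m
    conv_lhs => rw [← one_smul Ω m, hxy, Finset.sum_smul]
    simp only [mul_smul]
  have mem : ∀ (M : Type u) [AddCommGroup M] [Module Ω M] (m : M), l.i 1 • m ∈ l.corner M :=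
    fun M _ _ m => l.smul_mem_corner 1 m
  constructor
  · intro g h hgh
    ext m
    rw [key M m, map_sum, map_sum]
    refine Finset.sum_congr rfl fun k _ => ?_
    rw [map_smul, map_smul (f := h)]
    congr 1
    exact congrArg Subtype.val (LinearMap.congr_fun hgh ⟨_, mem M (y k • m)⟩)
  · intro g
    have hg : ∀ (ω : Ω) (m : l.corner M), (g ⟨l.i 1 • ω • (m : M), mem M _⟩ : N) =
        (l.i 1 * ω * l.i 1) • (g m : N) := by
      intro ω m
      have : (⟨l.i 1 • ω • (m : M), mem M _⟩ : l.corner M) = l.p ω • m := by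
        apply Subtype.ext
        rw [coe_smul_corner, l.i_p, mul_smul, mul_smul, m.2]
      rw [this, map_smul, coe_smul_corner, l.i_p]
    let G : M →+ N :=
      { toFun := fun m => ∑ k, x k • (g ⟨l.i 1 • y k • m, mem M _⟩ : N)
        map_zero' := by
          refine Finset.sum_eq_zero fun k _ => ?_
          have : (⟨l.i 1 • y k • (0 : M), mem M _⟩ : l.corner M) = 0 := Subtype.ext (by simp)
          rw [this, map_zero]
          simp
        map_add' := fun m m' => by
          rw [← Finset.sum_add_distrib]
          refine Finset.sum_congr rfl fun k _ => ?_
          have : (⟨l.i 1 • y k • (m + m'), mem M _⟩ : l.corner M) =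
            ⟨l.i 1 • y k • m, mem M _⟩ + ⟨l.i 1 • y k • m', mem M _⟩ := Subtype.ext (by simp)
          rw [this, map_add, ← smul_add]
          rfl }
    have hG : ∀ (ω : Ω) (m : l.corner M), G (ω • (m : M)) = ω • (g m : N) := by
      intro ω m
      change ∑ k, x k • (g ⟨l.i 1 • y k • ω • (m : M), mem M _⟩ : N) = _
      have : ∀ k, (⟨l.i 1 • y k • ω • (m : M), mem M _⟩ : l.corner M) =
          ⟨l.i 1 • (y k * ω) • (m : M), mem M _⟩ := fun k => by simp only [mul_smul]
      simp only [this, hg]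
      have h2 : (l.i 1 • (g m : N)) = g m := (g m).2
      conv_rhs => rw [key N (ω • (g m : N))]
      refine Finset.sum_congr rfl fun k _ => ?_
      simp only [mul_smul, h2]
    refine ⟨{ G with map_smul' := fun ω m => ?_ }, ?_⟩
    · change G (ω • m) = ω • G m
      conv_lhs => rw [key M m]
      conv_rhs => rw [key M m]
      rw [Finset.smul_sum, map_sum, map_sum, Finset.smul_sum]
      refine Finset.sum_congr rfl fun k _ => ?_
      rw [← mul_smul]
      rw [hG (ω * x k) ⟨_, mem M (y k • m)⟩, hG (x k) ⟨_, mem M (y k • m)⟩, mul_smul]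
    · ext m
      change G (m : M) = g m
      simpa using hG 1 m

instance : l.cornerFunctor.Faithful where
  map_injective {M N} g h hgh := by
    apply ModuleCat.hom_ext
    exact (l.cornerMap_bijective M N).1 (congrArg ModuleCat.Hom.hom hgh)

instance : l.cornerFunctor.Full where
  map_surjective {M N} g := by
    obtain ⟨h, hh⟩ := (l.cornerMap_bijective M N).2 g.hom
    exact ⟨ModuleCat.ofHom h, ModuleCat.hom_ext hh⟩

/-- The `Ω`-module `Hom_A(e Ω, N)` coinduced from an `A`-module `N`. -/
def coinduced (N : Type u) [AddCommGroup N] [Module A N] : AddSubgroup (Ω →+ N) where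
  carrier := {h | ∀ a x, h (l.i a * x) = a • h x}
  add_mem' {g h} hg hh a x := by
    simp only [Set.mem_ofPred_eq] at hg hh
    simp [hg, hh]
  zero_mem' a x := by simp
  neg_mem' {g} hg a x := by
    simp only [Set.mem_ofPred_eq] at hg
    simp [hg]

instance (N : Type u) [AddCommGroup N] [Module A N] : Module Ω (l.coinduced N) where
  smul ω h := ⟨h.1.comp (AddMonoidHom.mulRight ω), fun a x => by
    simp [mul_assoc, h.2 a]⟩
  one_smul h := Subtype.ext (AddMonoidHom.ext fun x => congrArg h.1 (mul_one x))
  mul_smul ω ω' h := Subtype.ext (AddMonoidHom.ext fun x =>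
    congrArg h.1 (mul_assoc x ω ω').symm)
  smul_zero ω := Subtype.ext (AddMonoidHom.ext fun x => rfl)
  smul_add ω g h := Subtype.ext (AddMonoidHom.ext fun x => rfl)
  add_smul ω ω' h := Subtype.ext (AddMonoidHom.ext fun x => by
    change h.1 (x * (ω + ω')) = h.1 (x * ω) + h.1 (x * ω')
    rw [mul_add, map_add])
  zero_smul h := Subtype.ext (AddMonoidHom.ext fun x => by
    change h.1 (x * 0) = 0
    rw [mul_zero, map_zero])

/-- The corner of the coinduced module of `N` is `N`. -/
def coinducedCorner (N : Type u) [AddCommGroup N] [Module A N] :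
    l.corner (l.coinduced N) ≃ₗ[A] N where
  toFun h := h.1.1 1
  map_add' g h := rfl
  map_smul' a h := by
    change h.1.1 (1 * l.i a) = a • h.1.1 1
    have h2 := h.1.2 a 1
    rwa [mul_one, ← one_mul (l.i a)] at h2
  invFun n := ⟨⟨⟨⟨fun x => l.p x • n, by simp⟩, fun x y => by simp [add_smul]⟩,
      fun a x => by
        change l.p (l.i a * x) • n = a • l.p x • n
        rw [l.p_mul_i, mul_smul]⟩,
      Subtype.ext (AddMonoidHom.ext fun x => by
        change l.p (x * l.i 1) • n = l.p x • n
        rw [l.p_i_mul, mul_one])⟩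
  left_inv h := by
    apply Subtype.ext
    apply Subtype.ext
    ext x
    change l.p x • h.1.1 1 = h.1.1 x
    have h1 : ∀ x, h.1.1 (x * l.i 1) = h.1.1 x := fun x => by
      conv_rhs => rw [← h.2]
      rfl
    have h2 : ∀ x, h.1.1 (l.i 1 * x) = h.1.1 x := fun x => by rw [h.1.2, one_smul]
    rw [← h.1.2, mul_one, l.i_p, h1, h2]
  right_inv n := by
    change l.p 1 • n = n
    have : l.p 1 = 1 := by
      apply l.i_injective
      rw [l.i_p, mul_one, e_mul_e]
    rw [this, one_smul]

instance : l.cornerFunctor.EssSurj where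
  mem_essImage N := ⟨ModuleCat.of Ω (l.coinduced N), ⟨(l.coinducedCorner N).toModuleIso⟩⟩

lemma isMoritaEquivalent_corner (l : Linking S A B Ω) : IsMoritaEquivalent S Ω A := by
  have : l.cornerFunctor.IsEquivalence := {}
  exact ⟨⟨{ eqv := l.cornerFunctor.asEquivalence
            linear := inferInstanceAs (l.cornerFunctor.Linear S) }⟩⟩

/-- Two algebras with a common linking algebra are Morita equivalent. -/
theorem isMoritaEquivalent (l : Linking S A B Ω) : IsMoritaEquivalent S A B :=
  l.isMoritaEquivalent_corner.symm.trans S l.symm.isMoritaEquivalent_corner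

end Linking

/-! ### From Morita equivalences to linking algebras -/

section

open CategoryTheory

lemma ModuleCat.isSeparator_self (C : Type u) [Ring C] : IsSeparator (ModuleCat.of C C) := by
  refine (isSeparator_def _).2 fun X Y f g H => ?_
  ext x
  have := congrArg (fun φ => φ.hom (1 : C))
    (H (ModuleCat.ofHom (LinearMap.toSpanSingleton C X x)))
  simpa using this

/-- Under an equivalence of module categories the ring itself goes to a generator `F C`; because
`D` is free, this means that the identity of `D` is a finite sum of maps factoring through
`F C`. -/
lemma ModuleCat.exists_id_eq_sum_of_equivalence {C D : Type u} [Ring C] [Ring D]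
    (F : ModuleCat.{u} C ≌ ModuleCat.{u} D) :
    ∃ (n : ℕ) (x : Fin n → (ModuleCat.of D D ⟶ F.functor.obj (ModuleCat.of C C)))
      (y : Fin n → (F.functor.obj (ModuleCat.of C C) ⟶ ModuleCat.of D D)),
      𝟙 (ModuleCat.of D D) = ∑ k, x k ≫ y k := by
  set X := F.functor.obj (ModuleCat.of C C)
  have hX : IsSeparator X := (ModuleCat.isSeparator_self C).of_equivalence F
  let s : Set D := {d | ∃ (y : X ⟶ ModuleCat.of D D) (z : X), y.hom z = d}
  let I : Submodule D D := Submodule.span D s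
  have hπ : ModuleCat.ofHom I.mkQ = 0 := by
    refine (isSeparator_def _).1 hX _ _ fun h => ?_
    ext z
    have : h.hom z ∈ I := Submodule.subset_span ⟨h, z, rfl⟩
    simpa using this
  have h1 : (1 : D) ∈ I := by
    rw [← Submodule.Quotient.mk_eq_zero]
    exact LinearMap.congr_fun (congrArg ModuleCat.Hom.hom hπ) (1 : D)
  obtain ⟨n, c, g, hg⟩ := Submodule.mem_span_set'.1 h1
  choose y z hyz using fun k => (g k).2
  refine ⟨n, fun k => ModuleCat.ofHom (LinearMap.toSpanSingleton D X (c k • z k)), y, ?_⟩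
  ext
  rw [ModuleCat.hom_sum, LinearMap.sum_apply]
  simp only [ModuleCat.hom_id, LinearMap.id_apply, ModuleCat.hom_comp, LinearMap.comp_apply,
    ModuleCat.hom_ofHom, LinearMap.toSpanSingleton_apply, one_smul, map_smul]
  conv_lhs => rw [← hg]
  exact Finset.sum_congr rfl fun k _ => by rw [hyz]

namespace MoritaEquivalence

open scoped ModuleCat.Algebra

variable {S : Type u} [CommRing S] {A B : Type u} [Ring A] [Algebra S A]
    [Ring B] [Algebra S B] (E : MoritaEquivalence S A B)

/-- The progenerator: the `A`-module that corresponds to `B`. -/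
abbrev progenerator : ModuleCat.{u} A := E.eqv.inverse.obj (ModuleCat.of B B)

/-- The opposite of the endomorphism ring of `A ⊕ P`, for the progenerator `P`. -/
abbrev LinkingAlgebra : Type u := (Module.End A (A × E.progenerator))ᵐᵒᵖ

/-- The identification of `B` with the opposite endomorphism ring of the progenerator. -/
noncomputable def progeneratorEnd : B ≃ₗ[S] Module.End A E.progenerator where
  toFun b := (E.eqv.inverse.map (ModuleCat.ofHom (LinearMap.toSpanSingleton B B b))).hom
  map_add' b b' := by
    have : LinearMap.toSpanSingleton B B (b + b') =
      LinearMap.toSpanSingleton B B b + LinearMap.toSpanSingleton B B b' := by ext; simp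
    rw [this, ModuleCat.ofHom_add, Functor.map_add, ModuleCat.hom_add]
  map_smul' s b := by
    have hlin : E.eqv.inverse.Linear S := E.symm.linear
    have h := CategoryTheory.Functor.map_smul E.eqv.inverse s
      (ModuleCat.ofHom (LinearMap.toSpanSingleton B B b))
    refine congrArg ModuleCat.Hom.hom (Eq.trans (congrArg E.eqv.inverse.map ?_) h)
    ext
    change (1 : B) * (s • b) = algebraMap S B s * (1 * b)
    rw [one_mul, one_mul, Algebra.smul_def]
  invFun g := (E.eqv.inverse.preimage (ModuleCat.ofHom g)).hom (1 : B)
  left_inv b := by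
    simp
  right_inv g := by
    have : ModuleCat.ofHom (LinearMap.toSpanSingleton B B
        ((E.eqv.inverse.preimage (ModuleCat.ofHom g)).hom (1 : B))) =
        E.eqv.inverse.preimage (ModuleCat.ofHom g) := by
      ext
      simp
    change (E.eqv.inverse.map (ModuleCat.ofHom (LinearMap.toSpanSingleton B B _))).hom = g
    rw [this]
    simp

lemma progeneratorEnd_mul (b b' : B) :
    E.progeneratorEnd (b * b') = E.progeneratorEnd b' ∘ₗ E.progeneratorEnd b := by
  have : ModuleCat.ofHom (LinearMap.toSpanSingleton B B (b * b')) =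
      ModuleCat.ofHom (LinearMap.toSpanSingleton B B b) ≫
        ModuleCat.ofHom (LinearMap.toSpanSingleton B B b') := by
    ext
    simp
  change (E.eqv.inverse.map (ModuleCat.ofHom (LinearMap.toSpanSingleton B B (b * b')))).hom = _
  rw [this, CategoryTheory.Functor.map_comp, ModuleCat.hom_comp]
  rfl

lemma progeneratorEnd_one : E.progeneratorEnd 1 = LinearMap.id := by
  have : ModuleCat.ofHom (LinearMap.toSpanSingleton B B 1) = 𝟙 _ := by
    ext
    simp
  change (E.eqv.inverse.map (ModuleCat.ofHom (LinearMap.toSpanSingleton B B 1))).hom = _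
  rw [this, CategoryTheory.Functor.map_id, ModuleCat.hom_id]

/-- The identity of the progenerator is a finite sum of maps factoring through `A`. -/
lemma exists_id_progenerator_eq_sum : ∃ (n : ℕ) (x : Fin n → (E.progenerator →ₗ[A] A))
    (y : Fin n → (A →ₗ[A] E.progenerator)), LinearMap.id = ∑ k, y k ∘ₗ x k := by
  obtain ⟨n, x, y, h⟩ := ModuleCat.exists_id_eq_sum_of_equivalence E.eqv
  let η := E.eqv.unitIso.app (ModuleCat.of A A)
  refine ⟨n, fun k => (E.eqv.inverse.map (x k) ≫ η.inv).hom,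
    fun k => (η.hom ≫ E.eqv.inverse.map (y k)).hom, ?_⟩
  have h2 := congrArg E.eqv.inverse.map h
  rw [CategoryTheory.Functor.map_id, Functor.map_sum] at h2
  have h3 := congrArg ModuleCat.Hom.hom h2
  rw [ModuleCat.hom_id, ModuleCat.hom_sum] at h3
  rw [h3]
  refine Finset.sum_congr rfl fun k _ => ?_
  rw [← ModuleCat.hom_comp]
  simp

/-- The identity of `A` is a finite sum of maps factoring through the progenerator. -/
lemma exists_id_eq_sum : ∃ (n : ℕ) (x : Fin n → (A →ₗ[A] E.progenerator))
    (y : Fin n → (E.progenerator →ₗ[A] A)), LinearMap.id = ∑ k, y k ∘ₗ x k := by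
  obtain ⟨n, x, y, h⟩ := ModuleCat.exists_id_eq_sum_of_equivalence E.eqv.symm
  refine ⟨n, fun k => (x k).hom, fun k => (y k).hom, ?_⟩
  have h3 := congrArg ModuleCat.Hom.hom h
  rwa [ModuleCat.hom_id, ModuleCat.hom_sum] at h3

open MulOpposite in
/-- The linking algebra of a Morita equivalence. -/
noncomputable def linking : Linking S A B E.LinkingAlgebra where
  i := 
    { toFun := fun a => op (LinearMap.inl A A _ ∘ₗ LinearMap.toSpanSingleton A A a ∘ₗ
        LinearMap.fst A A _)
      map_add' := fun a a' => by
        rw [← MulOpposite.op_add]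
        congr 1
        ext <;> simp
      map_smul' := fun s a => by
        rw [RingHom.id_apply, ← MulOpposite.op_smul]
        congr 1
        ext <;> simp }
  p :=
    { toFun := fun g => (g.unop (1, 0)).1
      map_add' := fun g h => rfl
      map_smul' := fun s g => rfl }
  j := 
    { toFun := fun b => op (LinearMap.inr A A _ ∘ₗ E.progeneratorEnd b ∘ₗ LinearMap.snd A A _)
      map_add' := fun b b' => by
        rw [← MulOpposite.op_add]
        congr 1
        ext <;> simp
      map_smul' := fun s b => by
        rw [RingHom.id_apply, ← MulOpposite.op_smul]
        congr 1
        ext <;> simp }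
  q :=
    { toFun := fun g => E.progeneratorEnd.symm
        (LinearMap.snd A A _ ∘ₗ g.unop ∘ₗ LinearMap.inr A A _)
      map_add' := fun g h => by
        rw [← map_add]
        rfl
      map_smul' := fun s g => by
        rw [← map_smul]
        rfl }
  i_mul a a' := by
    change op _ = op _ * op _
    rw [← MulOpposite.op_mul]
    congr 1
    ext <;> simp
  j_mul b b' := by
    change op _ = op _ * op _
    rw [← MulOpposite.op_mul]
    congr 1
    ext <;> simp [progeneratorEnd_mul]
  p_i a := by simp
  q_j b := by
    change E.progeneratorEnd.symm _ = b
    rw [LinearEquiv.symm_apply_eq]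
    ext x
    simp
  i_p x := by
    change op _ = op _ * x * op _
    apply unop_injective
    simp only [unop_mul, unop_op]
    ext <;> simp [Prod.mk_zero_zero]
  j_q x := by
    change op _ = op _ * x * op _
    apply unop_injective
    simp only [unop_mul, unop_op]
    ext <;> simp [progeneratorEnd_one, Prod.mk_zero_zero]
  add_one := by
    change op _ + op _ = 1
    rw [← MulOpposite.op_add, ← MulOpposite.op_one]
    congr 1
    ext <;> simp [progeneratorEnd_one]
  full_left := by
    obtain ⟨n, x, y, h⟩ := E.exists_id_eq_sum
    refine ⟨n, fun k => op (LinearMap.inr A A _ ∘ₗ x k ∘ₗ LinearMap.fst A A _),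
      fun k => op (LinearMap.inl A A _ ∘ₗ y k ∘ₗ LinearMap.snd A A _), ?_⟩
    change op _ = ∑ k, op _ * op _ * op _
    apply unop_injective
    rw [Finset.unop_sum]
    simp only [unop_mul, unop_op, progeneratorEnd_one]
    have h1 : (1 : A) = ∑ k, y k (x k 1) := by
      simpa using congrArg (fun φ => φ (1 : A)) h
    ext
    · simp [Prod.fst_sum, ← h1]
    · simp [Prod.snd_sum]
    · simp
    · simp
  full_right := by
    obtain ⟨n, x, y, h⟩ := E.exists_id_progenerator_eq_sum
    refine ⟨n, fun k => op (LinearMap.inl A A _ ∘ₗ x k ∘ₗ LinearMap.snd A A _),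
      fun k => op (LinearMap.inr A A _ ∘ₗ y k ∘ₗ LinearMap.fst A A _), ?_⟩
    change op _ = ∑ k, op _ * op _ * op _
    apply unop_injective
    rw [Finset.unop_sum]
    simp only [unop_mul, unop_op, progeneratorEnd_one]
    have h1 : ∀ z, z = ∑ k, y k (x k z) := fun z => by
      simpa using congrArg (fun φ => φ z) h
    ext z
    · simp
    · simp
    · simp [Prod.fst_sum]
    · simp [Prod.snd_sum, ← h1]

end MoritaEquivalence

open scoped ModuleCat.Algebra in
/-- Morita equivalent algebras have a common linking algebra. -/
theorem IsMoritaEquivalent.exists_linking {S : Type u} [CommRing S] {A B : Type u} [Ring A]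
    [Algebra S A] [Ring B] [Algebra S B] (h : IsMoritaEquivalent S A B) :
    ∃ (Ω : Type u) (_ : Ring Ω) (_ : Algebra S Ω), Nonempty (Linking S A B Ω) := by
  obtain ⟨⟨E⟩⟩ := h
  exact ⟨E.LinkingAlgebra, inferInstance, inferInstance, ⟨E.linking⟩⟩

end

/-! ### Maximal orders and Morita equivalence -/

namespace Linking

variable {S : Type u} [CommRing S] {A B Ω : Type u} [Ring A] [Algebra S A]
    [Ring B] [Algebra S B] [Ring Ω] [Algebra S Ω] (l : Linking S A B Ω)

include l in
lemma exists_one_eq_sum : ∃ (n : ℕ) (x y : Fin n → Ω), 1 = ∑ k, x k * l.i 1 * y k := by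
  obtain ⟨n, x, y, hxy⟩ := l.full_right
  refine ⟨n + 1, Fin.cons 1 x, Fin.cons 1 y, ?_⟩
  rw [Fin.sum_univ_succ]
  simp [← hxy, l.add_one]

/-- Since `Ω = Ω e Ω`, every element of `Ω` is determined by finitely many elements of the corner
`A`. -/
lemma eq_sum_of_one_eq_sum {n : ℕ} {x y : Fin n → Ω} (h : 1 = ∑ k, x k * l.i 1 * y k) (z : Ω) :
    z = ∑ k, ∑ k', x k * l.i (l.p (y k * z * x k')) * y k' := by
  conv_lhs => rw [← one_mul z, ← mul_one (1 * z), h, Finset.sum_mul, Finset.sum_mul_sum]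
  refine Finset.sum_congr rfl fun k _ => Finset.sum_congr rfl fun k' _ => ?_
  rw [l.i_p]
  simp only [mul_assoc]

include l in
lemma finite [Module.Finite S A] : Module.Finite S Ω := by
  obtain ⟨n, x, y, h⟩ := l.exists_one_eq_sum
  let φ : (Fin n → Fin n → A) →ₗ[S] Ω := ∑ k, ∑ k',
    LinearMap.mulLeft S (x k) ∘ₗ LinearMap.mulRight S (y k') ∘ₗ l.i ∘ₗ
      LinearMap.proj k' ∘ₗ LinearMap.proj k
  refine Module.Finite.of_surjective φ fun z => ⟨fun k k' => l.p (y k * z * x k'), ?_⟩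
  conv_rhs => rw [l.eq_sum_of_one_eq_sum h z]
  simp [φ, LinearMap.sum_apply, mul_assoc]

end Linking

lemma Submodule.sandwich_mul_sandwich_le {R E : Type*} [CommRing R] [Ring E] [Algebra R E]
    {T M : Submodule R E} (hT : T * T ≤ T) (hM : M * T * M ≤ M) :
    (T * M * T) * (T * M * T) ≤ T * M * T := calc
  (T * M * T) * (T * M * T) = T * M * (T * T) * M * T := by simp only [mul_assoc]
  _ ≤ T * M * T * M * T := by gcongr
  _ = T * (M * T * M) * T := by simp only [mul_assoc]
  _ ≤ T * M * T := by gcongr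

lemma Submodule.mul_sandwich_le {R E : Type*} [CommRing R] [Ring E] [Algebra R E]
    {T : Submodule R E} (M : Submodule R E) (hT : T * T ≤ T) :
    T * (T * M * T) ≤ T * M * T := by
  rw [← mul_assoc, ← mul_assoc]
  gcongr

section

variable {R : Type u} [CommRing R] {A : Type u} [Ring A] [Algebra R A]

/-- Maximality tested on orders containing the image of `A`: these automatically span the rational
envelope. -/
lemma isMaximalOrder_iff [Module.Finite R A] : IsMaximalOrder R A ↔
    ∀ O : Subalgebra R (RationalEnvelope R A), Module.Finite R O →
      (Algebra.TensorProduct.includeRight : A →ₐ[R] RationalEnvelope R A).range ≤ O →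
      O ≤ (Algebra.TensorProduct.includeRight : A →ₐ[R] RationalEnvelope R A).range := by
  have hspan : Submodule.span (FractionRing R)
      ((Algebra.TensorProduct.includeRight : A →ₐ[R] RationalEnvelope R A).range :
        Set (RationalEnvelope R A)) = ⊤ := by
    rw [eq_top_iff]
    rintro x -
    induction x using TensorProduct.induction_on with
    | zero => exact zero_mem _
    | add x y hx hy => exact add_mem hx hy
    | tmul k a =>
      have : k ⊗ₜ[R] a = k • ((1 : FractionRing R) ⊗ₜ[R] a) := by
        rw [TensorProduct.smul_tmul', smul_eq_mul, mul_one]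
      rw [this]
      exact Submodule.smul_mem _ _ (Submodule.subset_span ⟨a, rfl⟩)
  constructor
  · intro h O hO hle
    refine h.2 ⟨hO, ?_⟩ hle
    rw [eq_top_iff, ← hspan]
    exact Submodule.span_mono hle
  · intro h
    refine ⟨⟨?_, hspan⟩, fun O hO hle => h O hO.1 hle⟩
    exact Module.Finite.of_surjective
      (Algebra.TensorProduct.includeRight : A →ₐ[R] RationalEnvelope R A).rangeRestrict.toLinearMap
      (AlgHom.rangeRestrict_surjective _)

namespace Linking

variable {B Ω : Type u} [Ring B] [Algebra R B] [Ring Ω] [Algebra R Ω] (l : Linking R A B Ω)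

include l in
/-- If the corner `A` is maximal, so is `Ω`: an order `O` above `Ω` is determined by its corner
`e O e`, because `Ω = Ω e Ω`. -/
lemma isMaximalOrder_of_left [Module.Finite R A] (hA : IsMaximalOrder R A) :
    IsMaximalOrder R Ω := by
  have : Module.Finite R Ω := l.finite
  rw [isMaximalOrder_iff] at hA ⊢
  intro O hO hle
  let l' := l.baseChange (FractionRing R)
  have hi : ∀ a, l'.i (1 ⊗ₜ a) = 1 ⊗ₜ l.i a := fun a => l.baseChange_i_tmul _ _ _
  have hmem : ∀ x : Ω, (1 : FractionRing R) ⊗ₜ[R] x ∈ O := fun x => hle ⟨x, rfl⟩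
  -- the order `e O e` of the corner
  have hi1 : l'.i 1 ∈ O := (hi 1).symm ▸ hmem (l.i 1)
  let N : Submodule R (RationalEnvelope R A) :=
    O.toSubmodule.map (l'.p.restrictScalars R)
  have hN : ∀ a, a ∈ N ↔ l'.i a ∈ O := by
    intro a
    constructor
    · rintro ⟨o, ho, rfl⟩
      change l'.i (l'.p o) ∈ O
      rw [l'.i_p]
      exact mul_mem (mul_mem hi1 ho) hi1
    · intro h
      exact ⟨_, h, l'.p_i a⟩
  have h1 : (1 : RationalEnvelope R A) ∈ N := by
    rw [hN]
    exact hi1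
  let A' : Subalgebra R (RationalEnvelope R A) := N.toSubalgebra h1 (fun a b ha hb => by
    rw [hN] at *
    rw [l'.i_mul]
    exact mul_mem ha hb)
  have hA'fin : Module.Finite R A' := by
    have : N.FG := Submodule.FG.map _ (Module.Finite.iff_fg.1 hO)
    exact Module.Finite.iff_fg.2 this
  have hA' := hA A' hA'fin (by
    rintro _ ⟨a, rfl⟩
    change (1 : FractionRing R) ⊗ₜ a ∈ N
    rw [hN, hi]
    exact hmem _)
  obtain ⟨n, x, y, h⟩ := l.exists_one_eq_sum
  have h' : 1 = ∑ k, ((1 : FractionRing R) ⊗ₜ[R] x k) * l'.i 1 *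
      ((1 : FractionRing R) ⊗ₜ[R] y k) := by
    simp only [Algebra.TensorProduct.one_def, hi]
    simp [h, TensorProduct.tmul_sum]
  intro o ho
  rw [l'.eq_sum_of_one_eq_sum h' o]
  refine sum_mem fun k _ => sum_mem fun k' _ => mul_mem (mul_mem ⟨_, rfl⟩ ?_) ⟨_, rfl⟩
  have : l'.p ((1 ⊗ₜ[R] y k) * o * (1 ⊗ₜ[R] x k')) ∈ A' :=
    ⟨_, O.mul_mem (O.mul_mem (hmem _) ho) (hmem _), rfl⟩
  obtain ⟨a, ha⟩ := hA' this
  rw [← ha]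
  exact ⟨l.i a, (hi a).symm⟩

include l in
/-- If `Ω` is maximal, so is the corner `A`: an order `O` above `A` gives the order `Ω O Ω` above
`Ω`. -/
lemma isMaximalOrder_left [Module.Finite R A] (hΩ : IsMaximalOrder R Ω) :
    IsMaximalOrder R A := by
  have : Module.Finite R Ω := l.finite
  rw [isMaximalOrder_iff] at hΩ ⊢
  intro O hO hle
  let l' := l.baseChange (FractionRing R)
  have hi : ∀ a, l'.i (1 ⊗ₜ a) = 1 ⊗ₜ l.i a := fun a => l.baseChange_i_tmul _ _ _
  have hp : ∀ a, l'.p (1 ⊗ₜ a) = 1 ⊗ₜ l.p a := fun a => by simp [l', baseChange]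
  let T : Submodule R (RationalEnvelope R Ω) :=
    (Algebra.TensorProduct.includeRight : Ω →ₐ[R] RationalEnvelope R Ω).range.toSubmodule
  have hT : ∀ x, x ∈ T ↔ ∃ z : Ω, 1 ⊗ₜ z = x := fun x => Iff.rfl
  have hTT : T * T ≤ T := Submodule.mul_le.2 fun x hx y hy => mul_mem
    (S := Subalgebra R (RationalEnvelope R Ω)) hx hy
  let M : Submodule R (RationalEnvelope R Ω) := O.toSubmodule.map (l'.i.restrictScalars R)
  have hM1 : l'.i 1 ∈ M := ⟨1, one_mem O, rfl⟩
  have hMTM : M * T * M ≤ M := by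
    rw [Submodule.mul_le]
    intro x hx z hz
    induction hx using Submodule.mul_induction_on' with
    | mem_mul_mem x hx y hy =>
      obtain ⟨a, ha, rfl⟩ := hx
      obtain ⟨y, rfl⟩ := hy
      obtain ⟨b, hb, rfl⟩ := hz
      refine ⟨a * (1 ⊗ₜ l.p y) * b, O.mul_mem (O.mul_mem ha (hle ⟨_, rfl⟩)) hb, ?_⟩
      change l'.i (a * (1 ⊗ₜ l.p y) * b) = l'.i a * (1 ⊗ₜ y) * l'.i b
      rw [l'.i_mul, l'.i_mul, ← hp, l'.i_p, ← mul_assoc, ← mul_assoc, i_mul_e, mul_assoc _ (l'.i 1),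
        e_mul_i]
    | add x _ y _ hx hy =>
      rw [add_mul]
      exact add_mem hx hy
  obtain ⟨n, x, y, h⟩ := l.exists_one_eq_sum
  have h' : 1 = ∑ k, ((1 : FractionRing R) ⊗ₜ[R] x k) * l'.i 1 *
      ((1 : FractionRing R) ⊗ₜ[R] y k) := by
    simp only [Algebra.TensorProduct.one_def, hi]
    simp [h, TensorProduct.tmul_sum]
  have h1 : (1 : RationalEnvelope R Ω) ∈ T * M * T := by
    rw [h']
    exact sum_mem fun k _ => Submodule.mul_mem_mul (Submodule.mul_mem_mul ⟨_, rfl⟩ hM1) ⟨_, rfl⟩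
  have hmul := Submodule.sandwich_mul_sandwich_le hTT hMTM
  let O' : Subalgebra R (RationalEnvelope R Ω) := (T * M * T).toSubalgebra h1
    (fun a b ha hb => hmul (Submodule.mul_mem_mul ha hb))
  have hTfg : T.FG := by
    have : Module.Finite R
      (Algebra.TensorProduct.includeRight : Ω →ₐ[R] RationalEnvelope R Ω).range :=
      Module.Finite.of_surjective
        (Algebra.TensorProduct.includeRight :
          Ω →ₐ[R] RationalEnvelope R Ω).rangeRestrict.toLinearMap
        (AlgHom.rangeRestrict_surjective _)
    exact Module.Finite.iff_fg.1 this
  have hMfg : M.FG := Submodule.FG.map _ (Module.Finite.iff_fg.1 hO)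
  have hO' := hΩ O' (Module.Finite.iff_fg.2 ((hTfg.mul hMfg).mul hTfg)) (by
    intro z hz
    have : z * 1 ∈ T * (T * M * T) := Submodule.mul_mem_mul hz h1
    rw [mul_one] at this
    exact Submodule.mul_sandwich_le M hTT this)
  intro a ha
  have h2 : l'.i a ∈ O' := by
    have h3 : l'.i 1 * l'.i a * l'.i 1 ∈ T * M * T :=
      Submodule.mul_mem_mul (Submodule.mul_mem_mul ⟨l.i 1, (hi 1).symm⟩ ⟨a, ha, rfl⟩)
        ⟨l.i 1, (hi 1).symm⟩
    rwa [e_mul_i, i_mul_e] at h3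
  obtain ⟨z, hz⟩ := hO' h2
  refine ⟨l.p z, ?_⟩
  rw [← l'.p_i a, ← hz]
  exact (hp z).symm

include l in
/-- Being a maximal order is invariant under central Morita equivalence. -/
theorem isMaximalOrder_congr [Module.Finite R A] [Module.Finite R B] :
    IsMaximalOrder R A ↔ IsMaximalOrder R B :=
  ⟨fun h => l.symm.isMaximalOrder_left (l.isMaximalOrder_of_left h),
    fun h => l.isMaximalOrder_left (l.symm.isMaximalOrder_of_left h)⟩

end Linking

lemma nonRegularLocus_eq_of_linking {B Ω : Type u} [Ring B] [Algebra R B] [Ring Ω] [Algebra R Ω]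
    [Module.Finite R A] [Module.Finite R B] (l : Linking R A B Ω) :
    nonRegularLocus R A = nonRegularLocus R B := by
  ext m
  exact not_congr (l.baseChange (Localization.AtPrime m.asIdeal)).isMaximalOrder_congr

/-- Central Morita equivalence is preserved under base change, since linking algebras are. -/
theorem CentrallyMoritaEquivalent.baseChange {B : Type u} [Ring B] [Algebra R B]
    (h : CentrallyMoritaEquivalent R A B) (T : Type u) [CommRing T] [Algebra R T] :
    CentrallyMoritaEquivalent T (T ⊗[R] A) (T ⊗[R] B) := by
  obtain ⟨Ω, _, _, ⟨l⟩⟩ := h.exists_linking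
  exact (l.baseChange T).isMoritaEquivalent

end

/-! ### Semisimple algebras over their center are Azumaya -/

section Azumaya

open MulOpposite

/-- A two-sided ideal of a semisimple ring is generated by a central idempotent. -/
lemma IsSemisimpleRing.exists_central_idempotent {Γ : Type*} [Ring Γ] [IsSemisimpleRing Γ]
    (I : Ideal Γ) (hI : ∀ x ∈ I, ∀ y, x * y ∈ I) :
    ∃ ε ∈ I, (∀ x, x * ε = ε * x) ∧ ∀ x ∈ I, x * ε = x := by
  obtain ⟨ε, hε, hIε⟩ := IsSemisimpleRing.ideal_eq_span_idempotent I
  let J : Ideal Γᵐᵒᵖ :=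
    { carrier := {x | unop x ∈ I}
      add_mem' := fun {x y} hx hy => I.add_mem hx hy
      zero_mem' := I.zero_mem
      smul_mem' := fun c x hx => hI _ hx _ }
  obtain ⟨δ, hδ, hJδ⟩ := IsSemisimpleRing.ideal_eq_span_idempotent J
  have hεI : ε ∈ I := hIε ▸ Ideal.mem_span_singleton_self ε
  have hδJ : δ ∈ J := hJδ ▸ Ideal.mem_span_singleton_self δ
  have h1 : ∀ x ∈ I, x * ε = x := by
    intro x hx
    rw [hIε, Ideal.mem_span_singleton'] at hx
    obtain ⟨a, rfl⟩ := hx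
    rw [mul_assoc, hε]
  have h2 : ∀ x ∈ I, unop δ * x = x := by
    intro x hx
    have : op x ∈ J := hx
    rw [hJδ, Ideal.mem_span_singleton'] at this
    obtain ⟨a, ha⟩ := this
    have h3 := congrArg unop ha
    rw [unop_mul, unop_op] at h3
    rw [← h3, ← mul_assoc]
    congr 1
    exact congrArg unop hδ
  have h3 : unop δ = ε := by rw [← h1 _ hδJ, h2 _ hεI]
  rw [h3] at h2
  refine ⟨ε, hεI, fun x => ?_, h1⟩
  rw [← h2 _ (I.mul_mem_left x hεI), ← mul_assoc, h1 _ (hI _ hεI x)]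

variable (K : Type u) [CommRing K] (Γ : Type u) [Ring Γ] [Algebra K Γ]

attribute [local instance] instModuleTensorProductMop

/-- A semisimple ring is semisimple as a bimodule over itself. -/
lemma isSemisimpleModule_bimodule [IsSemisimpleRing Γ] :
    IsSemisimpleModule (Γ ⊗[K] Γᵐᵒᵖ) Γ := by
  have smul_def : ∀ (t : Γ ⊗[K] Γᵐᵒᵖ) (x : Γ), t • x = AlgHom.mulLeftRight K Γ t x :=
    fun _ _ => rfl
  refine (isSemisimpleModule_iff _ _).2 ⟨fun X => ?_⟩
  have hl : ∀ a, ∀ x ∈ X, a * x ∈ X := fun a x hx => by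
    simpa [smul_def] using X.smul_mem (a ⊗ₜ[K] (1 : Γᵐᵒᵖ)) hx
  have hr : ∀ x ∈ X, ∀ a, x * a ∈ X := fun x hx a => by
    simpa [smul_def] using X.smul_mem ((1 : Γ) ⊗ₜ[K] op a) hx
  let I : Ideal Γ :=
    { carrier := X
      add_mem' := X.add_mem
      zero_mem' := X.zero_mem
      smul_mem' := fun a x hx => hl a x hx }
  obtain ⟨ε, hεI, hc, h1⟩ := IsSemisimpleRing.exists_central_idempotent I hr
  have hsmul : ∀ (t : Γ ⊗[K] Γᵐᵒᵖ) (x : Γ), x * ε = 0 →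
      AlgHom.mulLeftRight K Γ t x * ε = 0 := by
    intro t x hx
    induction t using TensorProduct.induction_on with
    | zero => rw [map_zero, LinearMap.zero_apply, zero_mul]
    | add t t' ht ht' => rw [map_add, LinearMap.add_apply, add_mul, ht, ht', add_zero]
    | tmul a b =>
      rw [AlgHom.mulLeftRight_apply, mul_assoc, hc, ← mul_assoc, mul_assoc a, hx]
      simp
  let Y : Submodule (Γ ⊗[K] Γᵐᵒᵖ) Γ :=
    { carrier := {x | x * ε = 0}
      add_mem' := fun {x y} hx hy => by
        have hx' : x * ε = 0 := hx
        have hy' : y * ε = 0 := hy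
        change (x + y) * ε = 0
        rw [add_mul, hx', hy', add_zero]
      zero_mem' := zero_mul ε
      smul_mem' := fun t x hx => hsmul t x hx }
  refine ⟨Y, ?_, ?_⟩
  · rw [Submodule.disjoint_def]
    intro x hx hy
    rw [← h1 x hx]
    exact hy
  · rw [codisjoint_iff, eq_top_iff]
    rintro x -
    have h2 : x = x * ε + (x - x * ε) := by abel
    rw [h2]
    refine Submodule.add_mem_sup (hl x ε hεI) ?_
    change (x - x * ε) * ε = 0
    rw [sub_mul, mul_assoc, h1 ε hεI, sub_self]

variable [Module.Finite K Γ] [IsSemisimpleRing Γ] [Algebra.IsCentral K Γ]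

/-- The bimodule endomorphisms of `Γ` are the scalars, so this is the density theorem. -/
lemma mulLeftRight_surjective : Function.Surjective (AlgHom.mulLeftRight K Γ) := by
  intro g
  have := isSemisimpleModule_bimodule K Γ
  obtain ⟨s, hs⟩ := Module.Finite.fg_top (R := K) (M := Γ)
  let g' : Module.End (Module.End (Γ ⊗[K] Γᵐᵒᵖ) Γ) Γ :=
    { toFun := g
      map_add' := map_add g
      map_smul' := fun φ x => by
        have hl : ∀ a x, φ (a * x) = a * φ x := fun a x => by
          have := map_smul φ (a ⊗ₜ[K] (1 : Γᵐᵒᵖ)) x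
          change φ (AlgHom.mulLeftRight K Γ (a ⊗ₜ[K] (1 : Γᵐᵒᵖ)) x) =
            AlgHom.mulLeftRight K Γ (a ⊗ₜ[K] (1 : Γᵐᵒᵖ)) (φ x) at this
          simpa using this
        have hr : ∀ x a, φ (x * a) = φ x * a := fun x a => by
          have := map_smul φ ((1 : Γ) ⊗ₜ[K] op a) x
          change φ (AlgHom.mulLeftRight K Γ ((1 : Γ) ⊗ₜ[K] op a) x) =
            AlgHom.mulLeftRight K Γ ((1 : Γ) ⊗ₜ[K] op a) (φ x) at this
          simpa using this
        have hc : φ 1 ∈ Subalgebra.center K Γ := by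
          rw [Subalgebra.mem_center_iff]
          intro b
          rw [← hl, ← hr, mul_one, one_mul]
        obtain ⟨k, hk⟩ := Algebra.mem_bot.1 (Algebra.IsCentral.out hc)
        have hφ : ∀ y, φ y = k • y := fun y => by
          rw [← one_mul y, hr, ← hk, Algebra.smul_def, one_mul]
        change g (φ x) = φ (g x)
        rw [hφ, hφ, map_smul] }
  obtain ⟨t, ht⟩ := jacobson_density (R := Γ ⊗[K] Γᵐᵒᵖ) g' s
  refine ⟨t, ?_⟩
  apply LinearMap.ext_on (s := (s : Set Γ)) hs
  intro x hx
  exact (ht x hx).symm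

variable [IsSemisimpleRing K]

/-- A finite algebra with center `K` that is semisimple over a semisimple ring `K` is Azumaya. -/
lemma mulLeftRight_injective : Function.Injective (AlgHom.mulLeftRight K Γ) := by
  have hproj : Module.Projective K Γ := Module.projective_of_isSemisimpleRing K Γ
  obtain ⟨n, f, g, -, -, hfg⟩ := Module.Finite.exists_comp_eq_id_of_projective K Γ
  rw [injective_iff_map_eq_zero]
  intro t ht
  -- the coordinate functions, extended to `K`-linear endomorphisms, act on the left factor of `t`
  have key : ∀ k : Fin n, (LinearMap.rTensor Γᵐᵒᵖ
      (Algebra.linearMap K Γ ∘ₗ LinearMap.proj k ∘ₗ g)) t = 0 := by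
    intro k
    obtain ⟨w, hw⟩ := mulLeftRight_surjective K Γ (Algebra.linearMap K Γ ∘ₗ LinearMap.proj k ∘ₗ g)
    -- first in the form of an identity for the action on `Γ`
    have h1 : ∀ (w : Γ ⊗[K] Γᵐᵒᵖ) (t : Γ ⊗[K] Γᵐᵒᵖ), AlgHom.mulLeftRight K Γ t = 0 →
        AlgHom.mulLeftRight K Γ ((LinearMap.rTensor Γᵐᵒᵖ (AlgHom.mulLeftRight K Γ w)) t) = 0 := by
      intro w t ht
      induction w using TensorProduct.induction_on with
      | zero => simp
      | add w w' h h' => rw [map_add, LinearMap.rTensor_add, LinearMap.add_apply, map_add, h, h',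
          add_zero]
      | tmul a b =>
        have : (LinearMap.rTensor Γᵐᵒᵖ (AlgHom.mulLeftRight K Γ (a ⊗ₜ b))) t =
            (a ⊗ₜ 1) * t * (unop b ⊗ₜ 1) := by
          clear ht
          induction t using TensorProduct.induction_on with
          | zero => simp
          | add t t' h h' => rw [map_add, h, h', mul_add, add_mul]
          | tmul c d => simp
        rw [this, map_mul, map_mul, ht, mul_zero, zero_mul]
    have h2 := h1 w t ht
    rw [hw] at h2
    have h3 : ∀ t : Γ ⊗[K] Γᵐᵒᵖ, (LinearMap.rTensor Γᵐᵒᵖ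
        (Algebra.linearMap K Γ ∘ₗ LinearMap.proj k ∘ₗ g)) t = 1 ⊗ₜ op (AlgHom.mulLeftRight K Γ
          ((LinearMap.rTensor Γᵐᵒᵖ (Algebra.linearMap K Γ ∘ₗ LinearMap.proj k ∘ₗ g)) t) 1) := by
      intro t
      induction t using TensorProduct.induction_on with
      | zero => simp
      | add t t' h h' =>
        rw [map_add, map_add, LinearMap.add_apply, MulOpposite.op_add, TensorProduct.tmul_add,
          ← h, ← h']
      | tmul c d =>
        simp only [LinearMap.rTensor_tmul, LinearMap.comp_apply, Algebra.linearMap_apply,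
          Algebra.algebraMap_eq_smul_one, AlgHom.mulLeftRight_apply]
        rw [TensorProduct.smul_tmul]
        simp
    rw [h3, h2]
    simp
  have hsum : ∀ t : Γ ⊗[K] Γᵐᵒᵖ, t = ∑ k, (f (Pi.single k 1) ⊗ₜ 1) *
      (LinearMap.rTensor Γᵐᵒᵖ (Algebra.linearMap K Γ ∘ₗ LinearMap.proj k ∘ₗ g)) t := by
    intro t
    induction t using TensorProduct.induction_on with
    | zero => simp
    | add t t' h h' =>
      simp only [map_add, mul_add, Finset.sum_add_distrib]
      rw [← h, ← h']
    | tmul c d =>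
      have hc : c = ∑ k, g c k • f (Pi.single k 1) := by
        conv_lhs => rw [← LinearMap.id_apply (R := K) c, ← hfg, LinearMap.comp_apply,
          pi_eq_sum_univ' (g c)]
        simp [map_sum]
      conv_lhs => rw [hc, TensorProduct.sum_tmul]
      refine Finset.sum_congr rfl fun k _ => ?_
      simp [Algebra.algebraMap_eq_smul_one]
  rw [hsum t]
  simp [key]

/-- Over an Azumaya algebra every bimodule is generated by its invariants. The bimodule structure
is given by a pair of commuting representations. -/
lemma exists_eq_sum_invariants {X : Type u} [AddCommGroup X] [Module K X]
    (α : Γ →ₐ[K] Module.End K X) (β : Γᵐᵒᵖ →ₐ[K] Module.End K X)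
    (h : ∀ x y, Commute (α x) (β y)) (ξ : X) :
    ∃ (n : ℕ) (y : Fin n → Γ) (η : Fin n → X), (∀ k γ, α γ (η k) = β (op γ) (η k)) ∧
      ξ = ∑ k, α (y k) (η k) := by
  have hproj : Module.Projective K Γ := Module.projective_of_isSemisimpleRing K Γ
  obtain ⟨n, f, g, -, -, hfg⟩ := Module.Finite.exists_comp_eq_id_of_projective K Γ
  choose t ht using fun k : Fin n =>
    mulLeftRight_surjective K Γ (Algebra.linearMap K Γ ∘ₗ LinearMap.proj k ∘ₗ g)
  have h1 : ∀ k γ, (γ ⊗ₜ 1) * t k = (1 ⊗ₜ op γ) * t k := by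
    intro k γ
    apply mulLeftRight_injective K Γ
    rw [map_mul, map_mul, ht]
    ext x
    simp [Algebra.commutes]
  have h2 : ∑ k, (f (Pi.single k 1) ⊗ₜ 1) * t k = 1 := by
    apply mulLeftRight_injective K Γ
    rw [map_sum, map_one]
    ext c
    conv_rhs => rw [Module.End.one_apply, ← LinearMap.id_apply (R := K) c, ← hfg,
      LinearMap.comp_apply, pi_eq_sum_univ' (g c)]
    simp only [map_mul, ht, LinearMap.sum_apply, Module.End.mul_apply, LinearMap.comp_apply,
      AlgHom.mulLeftRight_apply, map_sum, map_smul]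
    refine Finset.sum_congr rfl fun k _ => ?_
    simp [Algebra.algebraMap_eq_smul_one]
  let τ := Algebra.TensorProduct.lift α β h
  refine ⟨n, fun k => f (Pi.single k 1), fun k => τ (t k) ξ, fun k γ => ?_, ?_⟩
  · have h3 := congrArg (fun t => τ t ξ) (h1 k γ)
    simpa [map_mul, τ] using h3
  · have h3 := congrArg (fun t => τ t ξ) h2
    simpa [map_mul, τ, LinearMap.sum_apply] using h3.symm

/-- The center is compatible with base change. -/
lemma exists_eq_algebraMap_of_central (hinj : Function.Injective (algebraMap K Γ))
    (S : Type u) [CommRing S] [Algebra K S] :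
    Function.Injective (algebraMap S (S ⊗[K] Γ)) ∧
      ∀ z : S ⊗[K] Γ, (∀ x, x * z = z * x) → ∃ s, z = algebraMap S (S ⊗[K] Γ) s := by
  -- a `K`-linear retraction of `K → Γ`
  obtain ⟨ρ, hρ⟩ : ∃ ρ : Γ →ₗ[K] K, ρ ∘ₗ Algebra.linearMap K Γ = LinearMap.id := by
    have : Module.Injective K K := Module.injective_of_isSemisimpleRing K K
    obtain ⟨ρ, hρ⟩ := Module.Injective.out (Algebra.linearMap K Γ) hinj LinearMap.id
    exact ⟨ρ, LinearMap.ext hρ⟩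
  have hρ' : ∀ k, ρ (algebraMap K Γ k) = k := fun k => LinearMap.congr_fun hρ k
  constructor
  · have h1 : ∀ s, (TensorProduct.rid K S) ((LinearMap.lTensor S ρ)
        (algebraMap S (S ⊗[K] Γ) s)) = s := by
      intro s
      have : ρ 1 = 1 := by simpa using hρ' 1
      simp [Algebra.TensorProduct.algebraMap_apply, this]
    exact Function.LeftInverse.injective
      (g := fun z => TensorProduct.rid K S (LinearMap.lTensor S ρ z)) h1
  · intro z hz
    obtain ⟨t, ht⟩ := mulLeftRight_surjective K Γ (Algebra.linearMap K Γ ∘ₗ ρ)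
    let ψ : (Γ ⊗[K] Γᵐᵒᵖ) →ₗ[K] (S ⊗[K] Γ) →ₗ[K] (S ⊗[K] Γ) :=
      LinearMap.lTensorHom S ∘ₗ (AlgHom.mulLeftRight K Γ).toLinearMap
    have h1 : ∀ (t : Γ ⊗[K] Γᵐᵒᵖ), ψ t z = (1 ⊗ₜ AlgHom.mulLeftRight K Γ t 1) * z := by
      intro t
      induction t using TensorProduct.induction_on with
      | zero => simp
      | add t t' h h' => simp only [map_add, LinearMap.add_apply, h, h', TensorProduct.tmul_add,
          add_mul]
      | tmul a b =>
        have h2 : ∀ z : S ⊗[K] Γ, ψ (a ⊗ₜ b) z = (1 ⊗ₜ a) * (z * (1 ⊗ₜ unop b)) := by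
          intro z
          induction z using TensorProduct.induction_on with
          | zero => simp
          | add z z' h h' => simp only [map_add, h, h', add_mul, mul_add]
          | tmul s c => simp [ψ, mul_assoc]
        rw [h2, ← hz, ← mul_assoc]
        simp
    have h2 : ∀ z : S ⊗[K] Γ, ∃ s, ψ t z = algebraMap S (S ⊗[K] Γ) s := by
      intro z
      induction z using TensorProduct.induction_on with
      | zero => exact ⟨0, by simp⟩
      | add z z' h h' =>
        obtain ⟨s, hs⟩ := h
        obtain ⟨s', hs'⟩ := h'
        exact ⟨s + s', by rw [map_add, hs, hs', map_add]⟩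
      | tmul s c =>
        refine ⟨ρ c • s, ?_⟩
        change LinearMap.lTensor S (AlgHom.mulLeftRight K Γ t) (s ⊗ₜ c) = _
        rw [ht, LinearMap.lTensor_tmul, LinearMap.comp_apply, Algebra.linearMap_apply,
          Algebra.algebraMap_eq_smul_one, Algebra.TensorProduct.algebraMap_apply,
          ← TensorProduct.smul_tmul]
        rfl
    obtain ⟨s, hs⟩ := h2 z
    refine ⟨s, ?_⟩
    rw [← hs, h1, ht]
    have : ρ 1 = 1 := by simpa using hρ' 1
    simp [this, ← Algebra.TensorProduct.one_def]

end Azumaya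

/-! ### Comparison of two linking algebras -/

/-- An `S`-algebra `Γ` has this property if every `Γ`-bimodule (over `S`) is generated by its
invariants. Azumaya algebras have it. The bimodule structure is given by a pair of commuting
representations. -/
def GeneratedByInvariants (S : Type u) [CommRing S] (Γ : Type u) [Ring Γ] [Algebra S Γ] : Prop :=
  ∀ (X : Type u) [AddCommGroup X] [Module S X] (α : Γ →ₐ[S] Module.End S X)
    (β : Γᵐᵒᵖ →ₐ[S] Module.End S X), (∀ x y, Commute (α x) (β y)) → ∀ ξ : X,
    ∃ (n : ℕ) (y : Fin n → Γ) (η : Fin n → X),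
      (∀ k γ, α γ (η k) = β (MulOpposite.op γ) (η k)) ∧ ξ = ∑ k, α (y k) (η k)

namespace Linking

variable {S : Type u} [CommRing S] {Λ Γ Ω₁ Ω₂ Ω₃ : Type u} [Ring Λ] [Algebra S Λ]
    [Ring Γ] [Algebra S Γ] [Ring Ω₁] [Algebra S Ω₁] [Ring Ω₂] [Algebra S Ω₂]
    [Ring Ω₃] [Algebra S Ω₃]

/-- The idempotent `e` is a sum of products of elements of `e Ω f` and `f Ω e`. -/
lemma exists_sum_mul_eq_e (l : Linking S Λ Γ Ω₁) : ∃ (n : ℕ) (a b : Fin n → Ω₁),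
    (∀ k, l.i 1 * a k = a k) ∧ (∀ k, a k * l.j 1 = a k) ∧ (∀ k, l.j 1 * b k = b k) ∧
      (∀ k, b k * l.i 1 = b k) ∧ ∑ k, a k * b k = l.i 1 := by
  obtain ⟨n, a, b, hab⟩ := l.full_left
  refine ⟨n, fun k => l.i 1 * a k * l.j 1, fun k => l.j 1 * b k * l.i 1, fun k => ?_, fun k => ?_,
    fun k => ?_, fun k => ?_, ?_⟩
  · rw [← mul_assoc, ← mul_assoc, e_mul_e]
  · rw [mul_assoc, f_mul_f]
  · rw [← mul_assoc, ← mul_assoc, f_mul_f]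
  · rw [mul_assoc, e_mul_e]
  · have h : ∀ k, l.i 1 * a k * l.j 1 * (l.j 1 * b k * l.i 1) =
        l.i 1 * (a k * l.j 1 * b k) * l.i 1 := fun k => by
      rw [mul_assoc _ (l.j 1), ← mul_assoc (l.j 1), ← mul_assoc (l.j 1), f_mul_f]
      simp only [mul_assoc]
    simp only [h]
    rw [← Finset.sum_mul, ← Finset.mul_sum, ← hab, e_mul_e, e_mul_e]

/-- A homomorphism of `Λ`-`Γ`-bimodules from `e Ω₁ f` to `e Ω₂ f`, extended by zero to `Ω₁`. -/
structure IsBimoduleHom (l₁ : Linking S Λ Γ Ω₁) (l₂ : Linking S Λ Γ Ω₂) (h : Ω₁ →ₗ[S] Ω₂) :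
    Prop where
  corner : ∀ x, h (l₁.i 1 * x * l₁.j 1) = h x
  left : ∀ a x, h (l₁.i a * x) = l₂.i a * h x
  right : ∀ b x, h (x * l₁.j b) = h x * l₂.j b

namespace IsBimoduleHom

variable {l₁ : Linking S Λ Γ Ω₁} {l₂ : Linking S Λ Γ Ω₂} {l₃ : Linking S Λ Γ Ω₃}

lemma apply_e_mul {h : Ω₁ →ₗ[S] Ω₂} (hh : IsBimoduleHom l₁ l₂ h) (x : Ω₁) :
    h (l₁.i 1 * x) = h x := by
  rw [← hh.corner, ← mul_assoc, e_mul_e, hh.corner]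

lemma apply_mul_f {h : Ω₁ →ₗ[S] Ω₂} (hh : IsBimoduleHom l₁ l₂ h) (x : Ω₁) :
    h (x * l₁.j 1) = h x := by
  rw [← hh.corner, mul_assoc, mul_assoc, f_mul_f, ← mul_assoc, hh.corner]

lemma e_mul_apply {h : Ω₁ →ₗ[S] Ω₂} (hh : IsBimoduleHom l₁ l₂ h) (x : Ω₁) :
    l₂.i 1 * h x = h x := by
  rw [← hh.left, hh.apply_e_mul]

lemma apply_mul_f' {h : Ω₁ →ₗ[S] Ω₂} (hh : IsBimoduleHom l₁ l₂ h) (x : Ω₁) :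
    h x * l₂.j 1 = h x := by
  rw [← hh.right, hh.apply_mul_f]

lemma comp {g : Ω₂ →ₗ[S] Ω₃} {h : Ω₁ →ₗ[S] Ω₂} (hg : IsBimoduleHom l₂ l₃ g)
    (hh : IsBimoduleHom l₁ l₂ h) : IsBimoduleHom l₁ l₃ (g ∘ₗ h) where
  corner x := by rw [LinearMap.comp_apply, hh.corner, LinearMap.comp_apply]
  left a x := by simp only [LinearMap.comp_apply, hh.left, hg.left]
  right a x := by simp only [LinearMap.comp_apply, hh.right, hg.right]

lemma smul {h : Ω₁ →ₗ[S] Ω₂} (hh : IsBimoduleHom l₁ l₂ h) (s : S) :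
    IsBimoduleHom l₁ l₂ (s • h) where
  corner x := by simp only [LinearMap.smul_apply, hh.corner]
  left a x := by simp only [LinearMap.smul_apply, hh.left, mul_smul_comm]
  right a x := by simp only [LinearMap.smul_apply, hh.right, smul_mul_assoc]

lemma sum {ι : Type*} {s : Finset ι} {h : ι → Ω₁ →ₗ[S] Ω₂}
    (hh : ∀ k ∈ s, IsBimoduleHom l₁ l₂ (h k)) : IsBimoduleHom l₁ l₂ (∑ k ∈ s, h k) where
  corner x := by
    simp only [LinearMap.sum_apply]
    exact Finset.sum_congr rfl fun k hk => (hh k hk).corner x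
  left a x := by
    simp only [LinearMap.sum_apply, Finset.mul_sum]
    exact Finset.sum_congr rfl fun k hk => (hh k hk).left a x
  right a x := by
    simp only [LinearMap.sum_apply, Finset.sum_mul]
    exact Finset.sum_congr rfl fun k hk => (hh k hk).right a x

/-- If the center of `Λ` is `S`, the bimodule endomorphisms of `e Ω f` are the scalars. -/
lemma exists_eq_smul (hc : ∀ z : Λ, (∀ x, x * z = z * x) → ∃ s, z = algebraMap S Λ s)
    {θ : Ω₁ →ₗ[S] Ω₁} (hθ : IsBimoduleHom l₁ l₁ θ) :
    ∃ s : S, ∀ x, θ x = s • (l₁.i 1 * x * l₁.j 1) := by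
  obtain ⟨n, a, b, hea, haf, hfb, hbe, hab⟩ := l₁.exists_sum_mul_eq_e
  let z : Ω₁ := ∑ k, θ (a k) * b k
  have hpz : l₁.i (l₁.p z) = z := by
    rw [l₁.i_p]
    simp only [z, Finset.mul_sum, Finset.sum_mul]
    refine Finset.sum_congr rfl fun k _ => ?_
    rw [← mul_assoc, hθ.e_mul_apply, mul_assoc, hbe]
  have hz : ∀ x, θ x = z * (x * l₁.j 1) := by
    intro x
    have h1 : ∀ k, θ (a k * (b k * x * l₁.j 1)) = θ (a k) * (b k * x * l₁.j 1) := by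
      intro k
      have h2 : b k * x * l₁.j 1 = l₁.j (l₁.q (b k * x)) := by
        rw [l₁.j_q, ← mul_assoc (l₁.j 1), hfb]
      rw [h2, hθ.right]
    rw [← hθ.corner, ← hab]
    simp only [Finset.sum_mul, map_sum, z]
    refine Finset.sum_congr rfl fun k _ => ?_
    rw [mul_assoc (a k), mul_assoc (a k), h1]
    simp only [mul_assoc]
  have hcomm : ∀ μ : Λ, μ * l₁.p z = l₁.p z * μ := by
    intro μ
    apply l₁.i_injective
    rw [← l₁.i_mul_e, ← l₁.i_mul_e (l₁.p z * μ), l₁.i_mul, l₁.i_mul, hpz, ← hab]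
    simp only [Finset.mul_sum]
    refine Finset.sum_congr rfl fun k _ => ?_
    have h4 : l₁.i μ * (z * (a k * l₁.j 1)) = z * (l₁.i μ * (a k * l₁.j 1)) := by
      rw [← hz, ← hθ.left, hz, mul_assoc (l₁.i μ)]
    rw [haf] at h4
    simp only [← mul_assoc] at h4 ⊢
    rw [h4]
  obtain ⟨s, hs⟩ := hc _ hcomm
  refine ⟨s, fun x => ?_⟩
  rw [hz, ← hpz, hs, Algebra.algebraMap_eq_smul_one, map_smul, smul_mul_assoc, mul_assoc]

end IsBimoduleHom

variable (l₁ : Linking S Λ Γ Ω₁) (l₂ : Linking S Λ Γ Ω₂)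

/-- The left `Λ`-linear maps from `e Ω₁ f` to `e Ω₂ f`, extended by zero to `Ω₁`. -/
def leftHom : Submodule S (Ω₁ →ₗ[S] Ω₂) where
  carrier := {h | (∀ x, h (l₁.i 1 * x * l₁.j 1) = h x) ∧
    (∀ a x, h (l₁.i a * x) = l₂.i a * h x) ∧ ∀ x, h x * l₂.j 1 = h x}
  add_mem' {g h} hg hh := ⟨fun x => by simp only [LinearMap.add_apply, hg.1, hh.1],
    fun a x => by simp only [LinearMap.add_apply, hg.2.1, hh.2.1, mul_add],
    fun x => by simp only [LinearMap.add_apply, hg.2.2, hh.2.2, add_mul]⟩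
  zero_mem' := ⟨fun x => by simp, fun a x => by simp, fun x => by simp⟩
  smul_mem' s h hh := ⟨fun x => by simp only [LinearMap.smul_apply, hh.1],
    fun a x => by simp only [LinearMap.smul_apply, hh.2.1, mul_smul_comm],
    fun x => by simp only [LinearMap.smul_apply, hh.2.2, smul_mul_assoc]⟩

/-- The left action of `Γ` on the left `Λ`-linear maps, through the source. -/
def leftHomSource : Γ →ₐ[S] Module.End S (leftHom l₁ l₂) where
  toFun b := LinearMap.restrict
    (LinearMap.lcomp S Ω₂ (LinearMap.mulRight S (l₁.j b))) (p := leftHom l₁ l₂) (q := leftHom l₁ l₂)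
    (fun h hh => ⟨fun x => by
        change h (l₁.i 1 * x * l₁.j 1 * l₁.j b) = h (x * l₁.j b)
        rw [← hh.1 (x * l₁.j b), mul_assoc _ (l₁.j 1), f_mul_j, mul_assoc _ (x * _),
          mul_assoc x, j_mul_f, mul_assoc],
      fun a x => by
        change h (l₁.i a * x * l₁.j b) = l₂.i a * h (x * l₁.j b)
        rw [mul_assoc, hh.2.1],
      fun x => hh.2.2 _⟩)
  map_one' := by
    ext h x
    change h.1 (x * l₁.j 1) = h.1 x
    rw [← h.2.1 (x * l₁.j 1), mul_assoc, mul_assoc, f_mul_f, ← mul_assoc, h.2.1]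
  map_mul' b b' := by
    ext h x
    change h.1 (x * l₁.j (b * b')) = h.1 (x * l₁.j b * l₁.j b')
    rw [l₁.j_mul, mul_assoc]
  map_zero' := by
    ext h x
    change h.1 (x * l₁.j 0) = 0
    simp
  map_add' b b' := by
    ext h x
    change h.1 (x * l₁.j (b + b')) = h.1 (x * l₁.j b) + h.1 (x * l₁.j b')
    rw [map_add, mul_add, map_add]
  commutes' s := by
    ext h x
    change h.1 (x * l₁.j (algebraMap S Γ s)) = s • h.1 x
    rw [Algebra.algebraMap_eq_smul_one, map_smul, mul_smul_comm, map_smul]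
    congr 1
    rw [← h.2.1 (x * l₁.j 1), mul_assoc, mul_assoc, f_mul_f, ← mul_assoc, h.2.1]

/-- The right action of `Γ` on the left `Λ`-linear maps, through the target. -/
def leftHomTarget : Γᵐᵒᵖ →ₐ[S] Module.End S (leftHom l₁ l₂) where
  toFun b := LinearMap.restrict
    (LinearMap.llcomp S Ω₁ Ω₂ Ω₂ (LinearMap.mulRight S (l₂.j b.unop)))
    (p := leftHom l₁ l₂) (q := leftHom l₁ l₂)
    (fun h hh => ⟨fun x => by
        change h _ * _ = h x * _
        rw [hh.1],
      fun a x => by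
        change h _ * _ = l₂.i a * (h x * _)
        rw [hh.2.1, mul_assoc],
      fun x => by
        change h x * l₂.j b.unop * _ = h x * l₂.j b.unop
        rw [mul_assoc, j_mul_f]⟩)
  map_one' := by
    ext h x
    exact h.2.2.2 x
  map_mul' b b' := by
    ext h x
    change h.1 x * l₂.j (b'.unop * b.unop) = h.1 x * l₂.j b'.unop * l₂.j b.unop
    rw [l₂.j_mul, mul_assoc]
  map_zero' := by
    ext h x
    change h.1 x * l₂.j 0 = 0
    simp
  map_add' b b' := by
    ext h x
    change h.1 x * l₂.j (b.unop + b'.unop) = h.1 x * l₂.j b.unop + h.1 x * l₂.j b'.unop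
    rw [map_add, mul_add]
  commutes' s := by
    ext h x
    change h.1 x * l₂.j (algebraMap S Γ s) = s • h.1 x
    rw [Algebra.algebraMap_eq_smul_one, map_smul, mul_smul_comm, h.2.2.2]

/-- If bimodules over `Γ` are generated by their invariants, then every left `Λ`-linear map is a
combination of bimodule homomorphisms, with coefficients in `Γ`. -/
lemma exists_eq_sum_isBimoduleHom (hΓ : GeneratedByInvariants S Γ) {h : Ω₁ →ₗ[S] Ω₂}
    (hh : h ∈ leftHom l₁ l₂) : ∃ (n : ℕ) (y : Fin n → Γ) (η : Fin n → (Ω₁ →ₗ[S] Ω₂)),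
      (∀ k, IsBimoduleHom l₁ l₂ (η k)) ∧ ∀ x, h x = ∑ k, η k (x * l₁.j (y k)) := by
  obtain ⟨n, y, η, hη, hξ⟩ := hΓ (leftHom l₁ l₂) (leftHomSource l₁ l₂) (leftHomTarget l₁ l₂)
    (fun b b' => by ext; rfl) ⟨h, hh⟩
  refine ⟨n, y, fun k => (η k).1, fun k => ⟨(η k).2.1, (η k).2.2.1, fun b x => ?_⟩, fun x => ?_⟩
  · exact LinearMap.congr_fun (congrArg Subtype.val (hη k b)) x
  · have := LinearMap.congr_fun (congrArg Subtype.val hξ) x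
    rw [Submodule.coe_sum, LinearMap.sum_apply] at this
    exact this

variable {l₁ l₂} in
/-- The scalars by which the composites of bimodule homomorphisms `e Ω₁ f → e Ω₂ f → e Ω₁ f` act
generate the unit ideal. -/
lemma span_comp_eq_top [Module.Finite S Λ] (hinj : Function.Injective (algebraMap S Λ))
    (hc : ∀ z : Λ, (∀ x, x * z = z * x) → ∃ s, z = algebraMap S Λ s)
    (hΓ : GeneratedByInvariants S Γ) :
    Ideal.span {s : S | ∃ (g : Ω₁ →ₗ[S] Ω₂) (h : Ω₂ →ₗ[S] Ω₁), IsBimoduleHom l₁ l₂ g ∧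
      IsBimoduleHom l₂ l₁ h ∧ ∀ x, h (g x) = s • (l₁.i 1 * x * l₁.j 1)} = ⊤ := by
  set 𝔞 := Ideal.span {s : S | ∃ (g : Ω₁ →ₗ[S] Ω₂) (h : Ω₂ →ₗ[S] Ω₁), IsBimoduleHom l₁ l₂ g ∧
      IsBimoduleHom l₂ l₁ h ∧ ∀ x, h (g x) = s • (l₁.i 1 * x * l₁.j 1)}
  -- composites of left linear maps take values in `𝔞 Ω₁`
  have key : ∀ g ∈ leftHom l₁ l₂, ∀ h ∈ leftHom l₂ l₁, ∀ x,
      h (g x) ∈ 𝔞 • (⊤ : Submodule S Ω₁) := by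
    intro g hg h hh x
    obtain ⟨n, y, η, hη, hgη⟩ := exists_eq_sum_isBimoduleHom l₁ l₂ hΓ hg
    obtain ⟨n', y', η', hη', hhη⟩ := exists_eq_sum_isBimoduleHom l₂ l₁ hΓ hh
    rw [hgη, map_sum]
    refine sum_mem fun k _ => ?_
    rw [hhη]
    refine sum_mem fun k' _ => ?_
    rw [← (hη k).right]
    obtain ⟨s, hs⟩ := ((hη' k').comp (hη k)).exists_eq_smul hc
    have h1 := hs (x * l₁.j (y k) * l₁.j (y' k'))
    rw [LinearMap.comp_apply] at h1
    rw [h1]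
    exact Submodule.smul_mem_smul (Ideal.subset_span ⟨_, _, hη k, hη' k', hs⟩) trivial
  have hcorner : ∀ x, l₁.i 1 * x * l₁.j 1 ∈ 𝔞 • (⊤ : Submodule S Ω₁) := by
    intro x
    obtain ⟨n, a, b, hab⟩ := l₁.full_right
    obtain ⟨n', c, d, hcd⟩ := l₂.full_left
    let g : Fin n → Fin n' → (Ω₁ →ₗ[S] Ω₂) := fun k k' =>
      LinearMap.mulRight S (c k' * l₂.j 1) ∘ₗ l₂.i ∘ₗ l₁.p ∘ₗ LinearMap.mulRight S (l₁.j 1 * a k)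
    let h : Fin n → Fin n' → (Ω₂ →ₗ[S] Ω₁) := fun k k' =>
      LinearMap.mulRight S (b k * l₁.j 1) ∘ₗ l₁.i ∘ₗ l₂.p ∘ₗ LinearMap.mulRight S (l₂.j 1 * d k')
    have hg : ∀ k k', g k k' ∈ leftHom l₁ l₂ := fun k k' => by
      refine ⟨fun x => ?_, fun a' x => ?_, fun x => ?_⟩
      · simp only [g, LinearMap.comp_apply, LinearMap.mulRight_apply]
        rw [mul_assoc, ← mul_assoc (l₁.j 1), f_mul_f, mul_assoc, p_mul_i, one_mul]
      · simp only [g, LinearMap.comp_apply, LinearMap.mulRight_apply]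
        rw [mul_assoc, p_mul_i, l₂.i_mul, mul_assoc]
      · simp only [g, LinearMap.comp_apply, LinearMap.mulRight_apply]
        rw [mul_assoc, mul_assoc, f_mul_f]
    have hh : ∀ k k', h k k' ∈ leftHom l₂ l₁ := fun k k' => by
      refine ⟨fun x => ?_, fun a' x => ?_, fun x => ?_⟩
      · simp only [h, LinearMap.comp_apply, LinearMap.mulRight_apply]
        rw [mul_assoc, ← mul_assoc (l₂.j 1), f_mul_f, mul_assoc, p_mul_i, one_mul]
      · simp only [h, LinearMap.comp_apply, LinearMap.mulRight_apply]
        rw [mul_assoc, p_mul_i, l₁.i_mul, mul_assoc]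
      · simp only [h, LinearMap.comp_apply, LinearMap.mulRight_apply]
        rw [mul_assoc, mul_assoc, f_mul_f]
    have hsum : ∑ k, ∑ k', h k k' (g k k' x) = l₁.i 1 * x * l₁.j 1 := by
      have h1 : ∀ k, ∑ k', h k k' (g k k' x) =
          l₁.i 1 * x * (l₁.j 1 * (a k * l₁.i 1 * b k) * l₁.j 1) := by
        intro k
        simp only [h, g, LinearMap.comp_apply, LinearMap.mulRight_apply]
        rw [← Finset.sum_mul, ← map_sum, ← map_sum]
        have h2 : ∑ k', l₂.i (l₁.p (x * (l₁.j 1 * a k))) * (c k' * l₂.j 1) * (l₂.j 1 * d k') =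
            l₂.i (l₁.p (x * (l₁.j 1 * a k))) * l₂.i 1 := by
          conv_rhs => rw [hcd, Finset.mul_sum]
          refine Finset.sum_congr rfl fun k' _ => ?_
          rw [← mul_assoc _ (l₂.j 1) (d k'), mul_assoc _ (c k' * _), mul_assoc (c k'), f_mul_f,
            mul_assoc]
        rw [h2, p_mul_i, l₂.p_i, mul_one, l₁.i_p]
        simp only [mul_assoc]
      simp only [h1]
      rw [← Finset.mul_sum, ← Finset.sum_mul, ← Finset.mul_sum, ← hab, f_mul_f, f_mul_f]
    rw [← hsum]
    exact sum_mem fun k _ => sum_mem fun k' _ => key _ (hg k k') _ (hh k k') x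
  have hone : (1 : Λ) ∈ 𝔞 • (⊤ : Submodule S Λ) := by
    have h1 : l₁.i 1 ∈ 𝔞 • (⊤ : Submodule S Ω₁) := by
      obtain ⟨n, a, b, hea, haf, hfb, hbe, hab⟩ := l₁.exists_sum_mul_eq_e
      rw [← hab]
      refine sum_mem fun k _ => ?_
      have h2 : (𝔞 • (⊤ : Submodule S Ω₁)).map (LinearMap.mulRight S (b k)) ≤ 𝔞 • ⊤ := by
        rw [Submodule.map_smul'']
        exact Submodule.smul_mono le_rfl le_top
      have h3 := h2 (Submodule.mem_map_of_mem (hcorner (a k)))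
      rwa [LinearMap.mulRight_apply, hea, haf] at h3
    have h2 : (𝔞 • (⊤ : Submodule S Ω₁)).map l₁.p ≤ 𝔞 • ⊤ := by
      rw [Submodule.map_smul'']
      exact Submodule.smul_mono le_rfl le_top
    simpa only [l₁.p_i] using h2 (Submodule.mem_map_of_mem h1)
  have htop : (⊤ : Submodule S Λ) ≤ 𝔞 • ⊤ := by
    intro x _
    have h2 : (𝔞 • (⊤ : Submodule S Λ)).map (LinearMap.mulLeft S x) ≤ 𝔞 • ⊤ := by
      rw [Submodule.map_smul'']
      exact Submodule.smul_mono le_rfl le_top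
    simpa only [LinearMap.mulLeft_apply, mul_one] using h2 (Submodule.mem_map_of_mem hone)
  obtain ⟨r, hr, hr'⟩ := Submodule.exists_sub_one_mem_and_smul_eq_zero_of_fg_of_le_smul 𝔞
    (⊤ : Submodule S Λ) Module.Finite.fg_top htop
  have hr0 : r = 0 := by
    apply hinj
    rw [Algebra.algebraMap_eq_smul_one, hr' 1 trivial, map_zero]
  rw [Ideal.eq_top_iff_one]
  simpa [hr0] using hr

/-- Over an Artinian (hence semilocal) center the bimodules `e Ω₁ f` and `e Ω₂ f` are
isomorphic. -/
lemma exists_bimodule_iso [IsArtinianRing S] [Module.Finite S Λ]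
    (hinj : Function.Injective (algebraMap S Λ))
    (hc : ∀ z : Λ, (∀ x, x * z = z * x) → ∃ s, z = algebraMap S Λ s)
    (hΓ : GeneratedByInvariants S Γ) :
    ∃ (g : Ω₁ →ₗ[S] Ω₂) (h : Ω₂ →ₗ[S] Ω₁), IsBimoduleHom l₁ l₂ g ∧ IsBimoduleHom l₂ l₁ h ∧
      (∀ x, h (g x) = l₁.i 1 * x * l₁.j 1) ∧ ∀ x, g (h x) = l₂.i 1 * x * l₂.j 1 := by
  classical
  have htop := span_comp_eq_top (l₁ := l₁) (l₂ := l₂) hinj hc hΓ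
  have hfin : Finite (MaximalSpectrum S) := inferInstance
  have := Fintype.ofFinite (MaximalSpectrum S)
  -- for every maximal ideal there is a composite which is a unit at this ideal
  have h1 : ∀ 𝔫 : MaximalSpectrum S, ∃ (s : S) (g : Ω₁ →ₗ[S] Ω₂) (h : Ω₂ →ₗ[S] Ω₁),
      s ∉ 𝔫.asIdeal ∧ IsBimoduleHom l₁ l₂ g ∧
      IsBimoduleHom l₂ l₁ h ∧ ∀ x, h (g x) = s • (l₁.i 1 * x * l₁.j 1) := by
    intro 𝔫
    by_contra! hcon
    refine 𝔫.isMaximal.ne_top (top_le_iff.1 (htop ▸ Ideal.span_le.2 ?_))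
    rintro s ⟨g, h, hg, hh, hs⟩
    by_contra hs'
    obtain ⟨x, hx⟩ := hcon s g h hs' hg hh
    exact hx (hs x)
  choose s g h hs hg hh hgh using h1
  have h2 : ∀ 𝔫 : MaximalSpectrum S, ∃ δ : S, δ ∉ 𝔫.asIdeal ∧ ∀ 𝔫', 𝔫' ≠ 𝔫 → δ ∈ 𝔫'.asIdeal := by
    intro 𝔫
    have h3 : ¬ (Finset.univ.erase 𝔫).inf MaximalSpectrum.asIdeal ≤ 𝔫.asIdeal := by
      rw [𝔫.isMaximal.isPrime.inf_le']
      rintro ⟨𝔫', h𝔫', hle⟩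
      exact Finset.ne_of_mem_erase h𝔫'
        (MaximalSpectrum.ext (𝔫'.isMaximal.eq_of_le 𝔫.isMaximal.ne_top hle))
    obtain ⟨δ, hδ, hδ'⟩ := Set.not_subset.1 h3
    refine ⟨δ, hδ', fun 𝔫' hne => ?_⟩
    exact (Finset.inf_le (f := MaximalSpectrum.asIdeal)
      (Finset.mem_erase.2 ⟨hne, Finset.mem_univ 𝔫'⟩)) hδ
  choose δ hδ hδ' using h2
  let G := ∑ 𝔫, δ 𝔫 • g 𝔫
  let H := ∑ 𝔫, δ 𝔫 • h 𝔫
  have hG : IsBimoduleHom l₁ l₂ G := .sum fun 𝔫 _ => (hg 𝔫).smul _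
  have hH : IsBimoduleHom l₂ l₁ H := .sum fun 𝔫 _ => (hh 𝔫).smul _
  choose σ hσ using fun 𝔫 𝔫' => ((hh 𝔫).comp (hg 𝔫')).exists_eq_smul hc
  have hfaith : ∀ t : S, (∀ x, t • (l₁.i 1 * x * l₁.j 1) = 0) → t = 0 := by
    intro t ht
    have h3 : t • l₁.i 1 = 0 := by
      obtain ⟨n, a, b, hea, haf, hfb, hbe, hab⟩ := l₁.exists_sum_mul_eq_e
      rw [← hab, Finset.smul_sum]
      refine Finset.sum_eq_zero fun k _ => ?_
      have h4 := ht (a k)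
      rw [hea, haf] at h4
      rw [← smul_mul_assoc, h4, zero_mul]
    apply hinj
    apply l₁.i_injective
    rw [Algebra.algebraMap_eq_smul_one, map_smul, h3, map_zero, map_zero]
  have hσs : ∀ 𝔫, σ 𝔫 𝔫 = s 𝔫 := by
    intro 𝔫
    rw [← sub_eq_zero]
    apply hfaith
    intro x
    rw [sub_smul, ← hσ, ← hgh, LinearMap.comp_apply, sub_self]
  let r := ∑ 𝔫, ∑ 𝔫', (δ 𝔫' * δ 𝔫) * σ 𝔫 𝔫'
  have hr : ∀ x, H (G x) = r • (l₁.i 1 * x * l₁.j 1) := by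
    intro x
    simp only [H, G, r, LinearMap.sum_apply, map_sum, Finset.sum_smul, LinearMap.smul_apply,
      map_smul, mul_smul, Finset.smul_sum]
    conv_rhs => rw [Finset.sum_comm]
    refine Finset.sum_congr rfl fun 𝔫 _ => ?_
    refine Finset.sum_congr rfl fun 𝔫' _ => ?_
    rw [← hσ, LinearMap.comp_apply]

  have hrunit : IsUnit r := by
    by_contra hr
    obtain ⟨n, hn, hrn⟩ := exists_max_ideal_of_mem_nonunits hr
    let 𝔫 : MaximalSpectrum S := ⟨n, hn⟩
    have h4 : δ 𝔫 * δ 𝔫 * s 𝔫 ∈ 𝔫.asIdeal := by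
      have h5 : r = δ 𝔫 * δ 𝔫 * s 𝔫 + (∑ 𝔫' ∈ Finset.univ.erase 𝔫, (δ 𝔫' * δ 𝔫) * σ 𝔫 𝔫' +
          ∑ 𝔪 ∈ Finset.univ.erase 𝔫, ∑ 𝔫', (δ 𝔫' * δ 𝔪) * σ 𝔪 𝔫') := by
        rw [← hσs, ← add_assoc, Finset.add_sum_erase _ (fun 𝔫' => δ 𝔫' * δ 𝔫 * σ 𝔫 𝔫')
          (Finset.mem_univ _), Finset.add_sum_erase _ (fun 𝔪 => ∑ 𝔫', δ 𝔫' * δ 𝔪 * σ 𝔪 𝔫')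
          (Finset.mem_univ _)]
      have h6 : ∀ 𝔪 ∈ Finset.univ.erase 𝔫, δ 𝔪 ∈ 𝔫.asIdeal := fun 𝔪 h𝔪 =>
        hδ' 𝔪 𝔫 (Finset.ne_of_mem_erase h𝔪).symm
      rw [h5] at hrn
      refine (Ideal.add_mem_iff_left 𝔫.asIdeal (add_mem (sum_mem fun 𝔪 h𝔪 => ?_)
        (sum_mem fun 𝔪 h𝔪 => sum_mem fun 𝔫' _ => ?_))).1 hrn
      · exact Ideal.mul_mem_right _ _ (Ideal.mul_mem_right _ _ (h6 𝔪 h𝔪))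
      · exact Ideal.mul_mem_right _ _ (Ideal.mul_mem_left _ _ (h6 𝔪 h𝔪))
    rcases hn.isPrime.mem_or_mem h4 with h5 | h5
    · rcases hn.isPrime.mem_or_mem h5 with h6 | h6
      · exact hδ 𝔫 h6
      · exact hδ 𝔫 h6
    · exact hs 𝔫 h5
  obtain ⟨t, ht⟩ := (hG.comp hH).exists_eq_smul hc
  have htr : t = r := by
    rw [← sub_eq_zero, ← hrunit.mul_left_eq_zero]
    apply hfaith
    intro x
    have h3 : G (H (G x)) = t • G x := by
      rw [← LinearMap.comp_apply, ht, hG.e_mul_apply, hG.apply_mul_f']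
    have h4 : G (H (G x)) = r • G x := by
      rw [hr, map_smul, hG.corner]
    have h5 : (t - r) • G x = 0 := by rw [sub_smul, ← h3, ← h4, sub_self]
    rw [mul_smul, ← hr, ← map_smul, h5, map_zero]
  obtain ⟨r', hr'⟩ := hrunit
  refine ⟨G, (↑r'⁻¹ : S) • H, hG, hH.smul _, fun x => ?_, fun x => ?_⟩
  · rw [LinearMap.smul_apply, hr, ← hr', smul_smul, Units.inv_mul, one_smul]
  · rw [LinearMap.smul_apply, map_smul, ← LinearMap.comp_apply, ht, htr, ← hr', smul_smul,
      Units.inv_mul, one_smul]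

/-- Comparison of linking algebras over an Artinian center: the corners `e Ω₁ f` and `f Ω₁ e` are
mapped to those of `Ω₂` compatibly with multiplication. -/
theorem exists_comparison [IsArtinianRing S] [Module.Finite S Λ]
    (hinj : Function.Injective (algebraMap S Λ))
    (hc : ∀ z : Λ, (∀ x, x * z = z * x) → ∃ s, z = algebraMap S Λ s)
    (hΓ : GeneratedByInvariants S Γ) :
    ∃ (g h : Ω₁ →ₗ[S] Ω₂), IsBimoduleHom l₁ l₂ g ∧ IsBimoduleHom l₁.symm l₂.symm h ∧
      (∀ v w, g v * h w = l₂.i (l₁.p (v * l₁.j 1 * w))) ∧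
      (∀ v w, h w * g v = l₂.j (l₁.q (w * l₁.i 1 * v))) := by
  obtain ⟨g, g', hg, hg', hg'g, hgg'⟩ := exists_bimodule_iso l₁ l₂ hinj hc hΓ
  obtain ⟨n, a, b, hfa, hae, heb, hbf, hab⟩ := l₂.symm.exists_sum_mul_eq_e
  change ∀ k, l₂.j 1 * a k = a k at hfa
  change ∀ k, a k * l₂.i 1 = a k at hae
  change ∀ k, l₂.i 1 * b k = b k at heb
  change ∀ k, b k * l₂.j 1 = b k at hbf
  change ∑ k, a k * b k = l₂.j 1 at hab
  let h : Ω₁ →ₗ[S] Ω₂ := ∑ k, LinearMap.mulLeft S (a k) ∘ₗ l₂.i ∘ₗ l₁.p ∘ₗ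
    LinearMap.mulLeft S (g' (b k))
  have hh : ∀ w, h w = ∑ k, a k * l₂.i (l₁.p (g' (b k) * w)) := fun w => by
    simp [h, LinearMap.sum_apply]
  have hright : ∀ a w, h (w * l₁.i a) = h w * l₂.i a := fun a w => by
    rw [hh, hh, Finset.sum_mul]
    refine Finset.sum_congr rfl fun k _ => ?_
    rw [← mul_assoc, p_i_mul, l₂.i_mul, ← mul_assoc]
  have hgh : ∀ v w, g v * h w = l₂.i (l₁.p (v * l₁.j 1 * w)) := by
    intro v w
    have h1 : ∀ k, g v * (a k * l₂.i (l₁.p (g' (b k) * w))) =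
        l₂.i (l₁.p (g' (g v * (a k * b k)) * w)) := by
      intro k
      have h2 : g v * a k = l₂.i (l₂.p (g v * a k)) := by
        rw [l₂.i_p, mul_assoc, mul_assoc, hae, ← mul_assoc, hg.e_mul_apply]
      rw [← mul_assoc, ← mul_assoc, h2, hg'.left, mul_assoc, p_mul_i, l₂.i_mul]
    rw [hh, Finset.mul_sum]
    simp only [h1]
    rw [← map_sum, ← map_sum, ← Finset.sum_mul, ← map_sum, ← Finset.mul_sum, hab,
      hg'.apply_mul_f, hg'g, mul_assoc, mul_assoc, p_mul_i, one_mul, mul_assoc]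
  have hleft : ∀ c w, h (l₁.j c * w) = l₂.j c * h w := by
    intro c w
    have h1 : ∀ k, b k * (l₂.j c * h w) = l₂.i (l₁.p (g' (b k) * (l₁.j c * w))) := by
      intro k
      have h2 : b k = g (g' (b k)) := by rw [hgg', heb, hbf]
      rw [← mul_assoc]
      conv_lhs => rw [h2, ← hg.right, hgh]
      rw [mul_assoc _ (l₁.j c), j_mul_f, mul_assoc]
    rw [hh (l₁.j c * w)]
    simp only [← h1]
    simp only [← mul_assoc]
    rw [← Finset.sum_mul, ← Finset.sum_mul, hab, f_mul_j]
  have hsymm : IsBimoduleHom l₁.symm l₂.symm h :=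
    { corner := fun x => by
        change h (l₁.j 1 * x * l₁.i 1) = h x
        rw [mul_assoc, hleft, hright, hh, Finset.sum_mul, Finset.mul_sum]
        refine Finset.sum_congr rfl fun k _ => ?_
        rw [mul_assoc (a k), i_mul_e, ← mul_assoc, hfa]
      left := hleft
      right := hright }
  refine ⟨g, h, hg, hsymm, hgh, fun v w => ?_⟩
  · have h1 : ∀ k, a k * l₂.i (l₁.p (g' (b k) * w)) * g v =
        a k * b k * l₂.j (l₁.q (w * l₁.i 1 * v)) := by
      intro k
      have h2 : l₂.i (l₁.p (g' (b k) * w)) * g v = b k * l₂.j (l₁.q (w * l₁.i 1 * v)) := by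
        have h3 : b k = g (g' (b k)) := by rw [hgg', heb, hbf]
        conv_rhs => rw [h3, ← hg.right, l₁.j_q, ← hg'.apply_mul_f' (b k)]
        rw [← hg.left, l₁.i_p, ← hg.apply_mul_f, ← mul_assoc (l₁.i 1), hg'.e_mul_apply]
        conv_lhs => rw [← hg'.apply_mul_f' (b k)]
        congr 1
        have h4 : ∀ t, l₁.j 1 * (l₁.j 1 * t) = l₁.j 1 * t := fun t => by rw [← mul_assoc, f_mul_f]
        simp only [mul_assoc, h4]
      rw [mul_assoc, h2]
      exact (mul_assoc _ _ _).symm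
    rw [hh, Finset.sum_mul]
    simp only [h1]
    rw [← Finset.sum_mul, hab, f_mul_j]

/-- Over an Artinian center any two linking algebras with the same corners are isomorphic. (Only
the existence of a surjective homomorphism is needed.) -/
theorem exists_algHom [IsArtinianRing S] [Module.Finite S Λ]
    (hinj : Function.Injective (algebraMap S Λ))
    (hc : ∀ z : Λ, (∀ x, x * z = z * x) → ∃ s, z = algebraMap S Λ s)
    (hΓ : GeneratedByInvariants S Γ) :
    ∃ φ : Ω₁ →ₐ[S] Ω₂, (∀ a, φ (l₁.i a) = l₂.i a) ∧ (∀ b, φ (l₁.j b) = l₂.j b) ∧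
      Function.Surjective φ := by
  obtain ⟨g, h, hg, hh, hgh, hhg⟩ := exists_comparison l₁ l₂ hinj hc hΓ
  have hhe : ∀ x, h (l₁.j 1 * x) = h x := fun x => hh.apply_e_mul x
  have hhf : ∀ x, h (x * l₁.i 1) = h x := fun x => hh.apply_mul_f x
  have hhe' : ∀ x, l₂.j 1 * h x = h x := fun x => hh.e_mul_apply x
  have hhf' : ∀ x, h x * l₂.i 1 = h x := fun x => hh.apply_mul_f' x
  have hhl : ∀ b x, h (l₁.j b * x) = l₂.j b * h x := fun b x => hh.left b x
  have hhr : ∀ a x, h (x * l₁.i a) = h x * l₂.i a := fun a x => hh.right a x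
  let φ : Ω₁ →ₗ[S] Ω₂ := l₂.i ∘ₗ l₁.p + g + h + l₂.j ∘ₗ l₁.q
  have hφ : ∀ x, φ x = l₂.i (l₁.p x) + g x + h x + l₂.j (l₁.q x) := fun x => rfl
  -- products of incompatible matrix entries vanish
  have hij : ∀ a b, l₂.i a * l₂.j b = 0 := fun a b => by
    rw [← l₂.i_mul_e, ← l₂.f_mul_j, mul_assoc, ← mul_assoc (l₂.i 1), e_mul_f, zero_mul, mul_zero]
  have hji : ∀ a b, l₂.j b * l₂.i a = 0 := fun a b => by
    rw [← l₂.j_mul_f, ← l₂.e_mul_i, mul_assoc, ← mul_assoc (l₂.j 1), f_mul_e, zero_mul, mul_zero]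
  have hih : ∀ a x, l₂.i a * h x = 0 := fun a x => by rw [← hhe', ← mul_assoc, hij, zero_mul]
  have hgi : ∀ a x, g x * l₂.i a = 0 := fun a x => by
    rw [← hg.apply_mul_f', mul_assoc, hji, mul_zero]
  have hgg : ∀ x y, g x * g y = 0 := fun x y => by
    rw [← hg.e_mul_apply y, ← mul_assoc, hgi, zero_mul]
  have hhh : ∀ x y, h x * h y = 0 := fun x y => by
    rw [← hhf' x, mul_assoc, hih, mul_zero]
  have hhj : ∀ b x, h x * l₂.j b = 0 := fun b x => by rw [← hhf' x, mul_assoc, hij, mul_zero]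
  have hjg : ∀ b x, l₂.j b * g x = 0 := fun b x => by
    rw [← hg.e_mul_apply, ← mul_assoc, hji, zero_mul]
  have split : ∀ x y : Ω₁, x * y = x * l₁.i 1 * y + x * l₁.j 1 * y := fun x y => by
    rw [← add_mul, ← mul_add, l₁.add_one, mul_one]
  have hi : ∀ x y, l₂.i (l₁.p (x * l₁.i 1 * y)) = l₂.i (l₁.p x) * l₂.i (l₁.p y) := fun x y => by
    rw [← l₂.i_mul]
    congr 1
    apply l₁.i_injective
    rw [l₁.i_mul, l₁.i_p, l₁.i_p, l₁.i_p]
    have h4 : ∀ t, l₁.i 1 * (l₁.i 1 * t) = l₁.i 1 * t := fun t => by rw [← mul_assoc, e_mul_e]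
    simp only [mul_assoc, h4]
  have hj : ∀ x y, l₂.j (l₁.q (x * l₁.j 1 * y)) = l₂.j (l₁.q x) * l₂.j (l₁.q y) := fun x y => by
    rw [← l₂.j_mul]
    congr 1
    apply l₁.j_injective
    rw [l₁.j_mul, l₁.j_q, l₁.j_q, l₁.j_q]
    have h4 : ∀ t, l₁.j 1 * (l₁.j 1 * t) = l₁.j 1 * t := fun t => by rw [← mul_assoc, f_mul_f]
    simp only [mul_assoc, h4]
  have hig : ∀ x y, g (x * l₁.i 1 * y) = l₂.i (l₁.p x) * g y := fun x y => by
    rw [← hg.left, l₁.i_p, ← hg.apply_e_mul]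
    simp only [mul_assoc]
  have hgj : ∀ x y, g (x * l₁.j 1 * y) = g x * l₂.j (l₁.q y) := fun x y => by
    rw [← hg.right, l₁.j_q, ← hg.apply_mul_f]
    simp only [mul_assoc]
  have hhi : ∀ x y, h (x * l₁.i 1 * y) = h x * l₂.i (l₁.p y) := fun x y => by
    rw [← hhr, l₁.i_p, ← hhf]
    simp only [mul_assoc]
  have hjh : ∀ x y, h (x * l₁.j 1 * y) = l₂.j (l₁.q x) * h y := fun x y => by
    rw [← hhl, l₁.j_q, ← hhe]
    simp only [mul_assoc]
  have hmul : ∀ x y, φ (x * y) = φ x * φ y := by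
    intro x y
    rw [split x y, map_add, hφ, hφ, hφ, hφ, hi, hj, ← hgh, ← hhg, hig, hgj, hhi, hjh]
    simp only [mul_add, add_mul, hij, hji, hih, hgi, hgg, hhh, hhj, hjg]
    abel
  have hφi : ∀ a, φ (l₁.i a) = l₂.i a := by
    intro a
    have h1 : g (l₁.i a) = 0 := by
      rw [← hg.apply_mul_f, ← l₁.i_mul_e, mul_assoc, e_mul_f, mul_zero, map_zero]
    have h2 : h (l₁.i a) = 0 := by
      rw [← hhe, ← l₁.e_mul_i, ← mul_assoc, f_mul_e, zero_mul, map_zero]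
    have h3 : l₁.q (l₁.i a) = 0 := by
      apply l₁.j_injective
      rw [l₁.j_q, ← l₁.e_mul_i, ← mul_assoc, f_mul_e, zero_mul, zero_mul, map_zero]
    rw [hφ, h1, h2, h3, l₁.p_i, map_zero, add_zero, add_zero, add_zero]
  have hφj : ∀ b, φ (l₁.j b) = l₂.j b := by
    intro b
    have h1 : g (l₁.j b) = 0 := by
      rw [← hg.apply_e_mul, ← l₁.f_mul_j, ← mul_assoc, e_mul_f, zero_mul, map_zero]
    have h2 : h (l₁.j b) = 0 := by
      rw [← hhf, ← l₁.j_mul_f, mul_assoc, f_mul_e, mul_zero, map_zero]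
    have h3 : l₁.p (l₁.j b) = 0 := by
      apply l₁.i_injective
      rw [l₁.i_p, ← l₁.f_mul_j, ← mul_assoc, e_mul_f, zero_mul, zero_mul, map_zero]
    rw [hφ, h1, h2, h3, l₁.q_j, map_zero, zero_add, zero_add, zero_add]
  have hone : φ 1 = 1 := by rw [← l₁.add_one, map_add, hφi, hφj, l₂.add_one]
  let ψ : Ω₁ →ₐ[S] Ω₂ := AlgHom.ofLinearMap φ hone hmul
  refine ⟨ψ, hφi, hφj, ?_⟩
  -- the range is a subalgebra which contains all four corners of `Ω₂`
  have hee : ∀ x, l₂.i 1 * x * l₂.i 1 ∈ ψ.range := fun x =>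
    ⟨l₁.i (l₂.p x), (hφi _).trans (l₂.i_p x)⟩
  have hff : ∀ x, l₂.j 1 * x * l₂.j 1 ∈ ψ.range := fun x =>
    ⟨l₁.j (l₂.q x), (hφj _).trans (l₂.j_q x)⟩
  have hef : ∀ x, l₂.i 1 * x * l₂.j 1 ∈ ψ.range := by
    intro x
    obtain ⟨n, a, b, hab⟩ := l₁.full_right
    have h1 : l₂.j 1 = ∑ k, ψ (a k) * l₂.i 1 * ψ (b k) := by
      rw [← hφj, hab, map_sum]
      exact Finset.sum_congr rfl fun k _ => by rw [hmul, hmul, hφi]; rfl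
    rw [h1, Finset.mul_sum]
    refine sum_mem fun k _ => ?_
    rw [← mul_assoc, ← mul_assoc, mul_assoc (l₂.i 1)]
    exact mul_mem (hee _) ⟨_, rfl⟩
  have hfe : ∀ x, l₂.j 1 * x * l₂.i 1 ∈ ψ.range := by
    intro x
    obtain ⟨n, a, b, hab⟩ := l₁.full_left
    have h1 : l₂.i 1 = ∑ k, ψ (a k) * l₂.j 1 * ψ (b k) := by
      rw [← hφi, hab, map_sum]
      exact Finset.sum_congr rfl fun k _ => by rw [hmul, hmul, hφj]; rfl
    rw [h1, Finset.mul_sum]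
    refine sum_mem fun k _ => ?_
    rw [← mul_assoc, ← mul_assoc, mul_assoc (l₂.j 1)]
    exact mul_mem (hff _) ⟨_, rfl⟩
  intro x
  have h1 : x = l₂.i 1 * x * l₂.i 1 + l₂.i 1 * x * l₂.j 1 + (l₂.j 1 * x * l₂.i 1 +
      l₂.j 1 * x * l₂.j 1) := by
    rw [← mul_add, ← mul_add, l₂.add_one, mul_one, mul_one, ← add_mul, l₂.add_one, one_mul]
  rw [h1]
  exact add_mem (add_mem (hee x) (hef x)) (add_mem (hfe x) (hff x))

end Linking

section

open MulOpposite

variable (K : Type u) [CommRing K] [IsSemisimpleRing K] (Γ : Type u) [Ring Γ] [Algebra K Γ]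
  [Module.Finite K Γ] [IsSemisimpleRing Γ] [Algebra.IsCentral K Γ]

/-- Bimodules over `S ⊗ Γ` are bimodules over `Γ`, and their invariants are the same. -/
theorem generatedByInvariants_baseChange (S : Type u) [CommRing S] [Algebra K S] :
    GeneratedByInvariants S (S ⊗[K] Γ) := by
  intro X _ _ α β h ξ
  let _ : Module K X := Module.compHom X (algebraMap K S)
  have : IsScalarTower K S X := ⟨fun k s x => by
    rw [Algebra.smul_def, mul_smul]; rfl⟩
  let α' : Γ →ₐ[K] Module.End K X :=
    { toFun := fun γ => (α (1 ⊗ₜ γ)).restrictScalars K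
      map_one' := by
        ext x
        simp [← Algebra.TensorProduct.one_def]
      map_mul' := fun γ δ => by
        ext x
        have : (1 : S) ⊗ₜ[K] (γ * δ) = (1 ⊗ₜ γ) * (1 ⊗ₜ δ) := by simp
        change α (1 ⊗ₜ (γ * δ)) x = α (1 ⊗ₜ γ) (α (1 ⊗ₜ δ) x)
        rw [this, map_mul, Module.End.mul_apply]
      map_zero' := by
        ext x
        change α (1 ⊗ₜ 0) x = 0
        rw [TensorProduct.tmul_zero, map_zero, LinearMap.zero_apply]
      map_add' := fun γ δ => by
        ext x
        simp [TensorProduct.tmul_add]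
      commutes' := fun k => by
        ext x
        have : (1 : S) ⊗ₜ[K] algebraMap K Γ k = algebraMap S _ (algebraMap K S k) := by
          rw [Algebra.TensorProduct.algebraMap_apply, Algebra.algebraMap_eq_smul_one,
            ← TensorProduct.smul_tmul, Algebra.algebraMap_eq_smul_one k]
          rfl
        change α (1 ⊗ₜ[K] algebraMap K Γ k) x = k • x
        rw [this, AlgHom.commutes]
        rfl }
  let β' : Γᵐᵒᵖ →ₐ[K] Module.End K X :=
    { toFun := fun γ => (β (op (1 ⊗ₜ unop γ))).restrictScalars K
      map_one' := by
        ext x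
        simp [← Algebra.TensorProduct.one_def]
      map_mul' := fun γ δ => by
        ext x
        have : (1 : S) ⊗ₜ[K] (unop δ * unop γ) = (1 ⊗ₜ unop δ) * (1 ⊗ₜ unop γ) := by simp
        change β (op (1 ⊗ₜ (unop δ * unop γ))) x = β (op (1 ⊗ₜ unop γ)) (β (op (1 ⊗ₜ unop δ)) x)
        rw [this, op_mul, map_mul, Module.End.mul_apply]
      map_zero' := by
        ext x
        change β (op (1 ⊗ₜ 0)) x = 0
        rw [TensorProduct.tmul_zero, op_zero, map_zero, LinearMap.zero_apply]
      map_add' := fun γ δ => by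
        ext x
        simp [TensorProduct.tmul_add]
      commutes' := fun k => by
        ext x
        have : (1 : S) ⊗ₜ[K] algebraMap K Γ k = algebraMap S _ (algebraMap K S k) := by
          rw [Algebra.TensorProduct.algebraMap_apply, Algebra.algebraMap_eq_smul_one,
            ← TensorProduct.smul_tmul, Algebra.algebraMap_eq_smul_one k]
          rfl
        change β (op (1 ⊗ₜ[K] algebraMap K Γ k)) x = k • x
        rw [this]
        change β (algebraMap S _ (algebraMap K S k)) x = _
        rw [AlgHom.commutes]
        rfl }
  obtain ⟨n, y, η, hη, hξ⟩ := exists_eq_sum_invariants K Γ α' β'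
    (fun x y => by
      ext z
      exact LinearMap.congr_fun (h (1 ⊗ₜ x) (op (1 ⊗ₜ unop y))) z) ξ
  refine ⟨n, fun k => 1 ⊗ₜ y k, η, fun k γ => ?_, hξ⟩
  induction γ using TensorProduct.induction_on with
  | zero => simp
  | add γ δ hγ hδ => rw [map_add, op_add, map_add, LinearMap.add_apply, LinearMap.add_apply, hγ, hδ]
  | tmul s γ =>
    have h1 : s ⊗ₜ[K] γ = s • ((1 : S) ⊗ₜ[K] γ) := by simp [TensorProduct.smul_tmul']
    rw [h1, map_smul, op_smul, map_smul, LinearMap.smul_apply, LinearMap.smul_apply]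
    exact congrArg (s • ·) (hη k γ)

end

/-! ### Reduced noetherian rings of dimension one -/

section OneDimensional

open nonZeroDivisors

/-- In a reduced noetherian ring the zero divisors lie in minimal primes. So if all regular elements
are units, every prime is minimal. -/
lemma isArtinianRing_of_nonZeroDivisors_le_isUnit (K : Type*) [CommRing K] [IsNoetherianRing K]
    [IsReduced K] (hK : ∀ x ∈ K⁰, IsUnit x) : IsArtinianRing K := by
  have hmin : ∀ P : Ideal K, P.IsPrime → P ∈ minimalPrimes K := by
    intro P hP
    have hfin := minimalPrimes.finite_of_isNoetherianRing K
    have h1 : (P : Set K) ⊆ ⋃ p ∈ (hfin.toFinset : Set (Ideal K)), (p : Set K) := by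
      intro x hx
      by_contra hx'
      simp only [Set.Finite.coe_toFinset, Set.mem_iUnion, not_exists] at hx'
      refine hP.ne_top (P.eq_top_of_isUnit_mem hx (hK x ?_))
      rw [mem_nonZeroDivisors_iff_right]
      intro y hxy
      have h2 : y ∈ sInf (minimalPrimes K) := by
        rw [Submodule.mem_sInf]
        intro p hp
        have := hp.1.1
        exact (this.mem_or_mem (hxy ▸ p.zero_mem : y * x ∈ p)).resolve_right (hx' p hp)
      have h3 : y ∈ nilradical K := by
        rw [nilradical, ← Ideal.sInf_minimalPrimes]
        exact h2
      rwa [nilradical_eq_zero, Ideal.zero_eq_bot, Ideal.mem_bot] at h3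
    rw [Ideal.subset_union_prime ⊥ ⊥ fun p hp _ _ => (hfin.mem_toFinset.1 hp).1.1] at h1
    obtain ⟨p, hp, hle⟩ := h1
    rw [hfin.mem_toFinset] at hp
    rwa [le_antisymm hle (hp.2 ⟨hP, bot_le⟩ hle)]
  rw [isArtinianRing_iff_krullDimLE_zero]
  rw [Ring.krullDimLE_zero_iff]
  intro P hP
  obtain ⟨M, hM, hle⟩ := P.exists_le_maximal hP.ne_top
  rwa [le_antisymm hle ((hmin M hM.isPrime).2 ⟨hP, bot_le⟩ hle)]

instance isSemisimpleRing_fractionRing (R : Type*) [CommRing R] [IsNoetherianRing R] [IsReduced R] :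
    IsSemisimpleRing (FractionRing R) := by
  have : IsNoetherianRing (FractionRing R) := IsLocalization.isNoetherianRing R⁰ _ inferInstance
  have : IsReduced (FractionRing R) := isReduced_localizationPreserves R⁰ _ inferInstance
  have := isArtinianRing_of_nonZeroDivisors_le_isUnit (FractionRing R) fun x hx => by
    obtain ⟨r, s, rfl⟩ := IsLocalization.exists_mk'_eq R⁰ x
    have hr : r ∈ R⁰ := by
      rw [mem_nonZeroDivisors_iff_right]
      intro y hy
      have h1 : algebraMap R (FractionRing R) y * IsLocalization.mk' _ r s = 0 := by
        rw [← IsLocalization.mk'_one (M := R⁰) (FractionRing R) y, ← IsLocalization.mk'_mul, hy,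
          IsLocalization.mk'_zero]
      have h2 := (mem_nonZeroDivisors_iff_right.1 hx) _ h1
      exact IsFractionRing.injective R (FractionRing R) (by rw [h2, map_zero])
    have h1 := IsLocalization.map_units (FractionRing R) (⟨r, hr⟩ : R⁰)
    have h2 := IsLocalization.mk'_spec (FractionRing R) r s
    rw [← h2] at h1
    exact isUnit_of_mul_isUnit_left h1
  exact IsArtinianRing.isSemisimpleRing_of_isReduced _

variable {R : Type*} [CommRing R] [IsNoetherianRing R]

lemma isArtinianRing_quotient_span_singleton (hdim : ringKrullDim R ≤ 1) {c : R} (hc : c ∈ R⁰) :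
    IsArtinianRing (R ⧸ Ideal.span {c}) := by
  rw [isArtinianRing_iff_krullDimLE_zero, Ring.KrullDimLE, Order.krullDimLE_iff]
  have h1 := (ringKrullDim_quotient_succ_le_of_nonZeroDivisor hc).trans hdim
  change ringKrullDim _ ≤ _
  generalize ringKrullDim (R ⧸ Ideal.span {c}) = x at h1 ⊢
  induction x with
  | bot => exact bot_le
  | coe n =>
    rw [← WithBot.coe_one, ← WithBot.coe_add, WithBot.coe_le_coe] at h1
    exact WithBot.coe_le_coe.2 ((ENat.add_le_add_iff_right ENat.one_ne_top).1 (by simpa using h1))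

lemma finite_setOf_mem_maximalSpectrum (hdim : ringKrullDim R ≤ 1) {c : R} (hc : c ∈ R⁰) :
    {m : MaximalSpectrum R | c ∈ m.asIdeal}.Finite := by
  have := isArtinianRing_quotient_span_singleton hdim hc
  refine Set.Finite.of_finite_image (f := fun m => m.asIdeal.map (Ideal.Quotient.mk (.span {c})))
    ((Set.finite_range (MaximalSpectrum.asIdeal (R := R ⧸ Ideal.span {c}))).subset ?_) ?_
  · rintro _ ⟨m, hm, rfl⟩
    have := m.isMaximal
    refine ⟨⟨_, Ideal.IsMaximal.map_of_surjective_of_ker_le Ideal.Quotient.mk_surjective ?_⟩, rfl⟩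
    rw [Ideal.mk_ker, Ideal.span_singleton_le_iff_mem]
    exact hm
  · intro m hm m' hm' h
    have h1 : ∀ m : MaximalSpectrum R, c ∈ m.asIdeal → (m.asIdeal.map
        (Ideal.Quotient.mk (.span {c}))).comap (Ideal.Quotient.mk (.span {c})) = m.asIdeal := by
      intro m hm
      rw [Ideal.comap_map_of_surjective' _ Ideal.Quotient.mk_surjective, Ideal.mk_ker,
        sup_eq_left, Ideal.span_singleton_le_iff_mem]
      exact hm
    apply MaximalSpectrum.ext
    rw [← h1 m hm, ← h1 m' hm']
    exact congrArg _ h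

/-- Locally at `m` a power of `m` is divisible by a given regular element, since `R ⧸ c` is
Artinian. -/
lemma exists_notMem_forall_pow_mul_mem (hdim : ringKrullDim R ≤ 1) (m : Ideal R) [hm : m.IsMaximal]
    {c : R} (hc : c ∈ R⁰) : ∃ t ∉ m, ∃ k : ℕ, ∀ x ∈ m ^ k, t * x ∈ Ideal.span {c} := by
  by_cases hcm : c ∈ m
  swap
  · exact ⟨c, hcm, 0, fun x _ => Ideal.mul_mem_right _ _ (Ideal.mem_span_singleton_self c)⟩
  have := isArtinianRing_quotient_span_singleton hdim hc
  let π := Ideal.Quotient.mk (Ideal.span {c})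
  obtain ⟨k, hk⟩ := IsArtinian.monotone_stabilizes (R := R ⧸ Ideal.span {c})
    (M := R ⧸ Ideal.span {c}) ⟨fun k => OrderDual.toDual ((m.map π) ^ k), fun a b hab =>
      Ideal.pow_le_pow_right hab⟩
  have h1 : (m.map π) ^ k = (m.map π) ^ (k + 1) := hk (k + 1) k.le_succ
  obtain ⟨r, hr, hr'⟩ := Submodule.exists_sub_one_mem_and_smul_eq_zero_of_fg_of_le_smul
    (m.map π) ((m.map π) ^ k) (IsNoetherian.noetherian _) (by
      rw [smul_eq_mul, ← pow_succ']
      exact h1.le)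
  obtain ⟨t, rfl⟩ := Ideal.Quotient.mk_surjective r
  refine ⟨t, fun ht => ?_, k, fun x hx => ?_⟩
  · have h2 : t - 1 ∈ (m.map π).comap π := by
      rw [Ideal.mem_comap, map_sub, map_one]
      exact hr
    rw [Ideal.comap_map_of_surjective' _ Ideal.Quotient.mk_surjective, Ideal.mk_ker,
      sup_eq_left.2 ((Ideal.span_singleton_le_iff_mem _).2 hcm)] at h2
    exact hm.ne_top ((Ideal.eq_top_iff_one _).2 (by simpa using sub_mem ht h2))
  · rw [← Ideal.Quotient.eq_zero_iff_mem, map_mul]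
    exact hr' _ (Ideal.map_pow π m k ▸ Ideal.mem_map_of_mem π hx)

end OneDimensional

/-! ### Completions of one-dimensional rings -/

section Completion

open IsLocalRing

variable {T : Type*} [CommRing T] [IsLocalRing T]

lemma eq_maximalIdeal_of_pow_le {c : T} {k : ℕ} (hk : maximalIdeal T ^ k ≤ Ideal.span {c})
    {P : Ideal T} [hP : P.IsPrime] (hc : c ∈ P) : P = maximalIdeal T :=
  le_antisymm (le_maximalIdeal hP.ne_top)
    (hP.le_of_pow_le (hk.trans ((Ideal.span_singleton_le_iff_mem _).2 hc)))

/-- A complete local ring whose maximal ideal is finitely generated and nilpotent modulo some `c` is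
noetherian: generators of a prime ideal `P ∌ c` modulo `c` generate `P`, by successive
approximation. -/
lemma isNoetherianRing_of_pow_le_span [IsAdicComplete (maximalIdeal T) T]
    (hfg : (maximalIdeal T).FG) {c : T} (hc : c ∈ maximalIdeal T) {k : ℕ}
    (hk : maximalIdeal T ^ k ≤ Ideal.span {c}) : IsNoetherianRing T := by
  let π := Ideal.Quotient.mk (Ideal.span {c})
  have hquot : IsNoetherianRing (T ⧸ Ideal.span {c}) := by
    refine IsNoetherianRing.of_prime fun P hP => ?_
    have h1 : P.comap π = maximalIdeal T := eq_maximalIdeal_of_pow_le hk (by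
      rw [Ideal.mem_comap, Ideal.Quotient.eq_zero_iff_mem.2 (Ideal.mem_span_singleton_self c)]
      exact P.zero_mem)
    rw [← Ideal.map_comap_of_surjective π Ideal.Quotient.mk_surjective P, h1]
    exact hfg.map π
  refine IsNoetherianRing.of_prime fun P hP => ?_
  by_cases hcP : c ∈ P
  · rwa [eq_maximalIdeal_of_pow_le hk hcP]
  obtain ⟨s, hs, hs'⟩ : ∃ s : Finset T, (s : Set T) ⊆ P ∧
      Ideal.span (π '' (s : Set T)) = P.map π := by
    have h1 : (P.map π).FG := IsNoetherian.noetherian _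
    have h2 : P.map π = Submodule.span _ (π '' P) := rfl
    rw [h2] at h1 ⊢
    classical
    obtain ⟨s, hs, hs'⟩ := (Submodule.fg_span_iff_fg_span_finset_subset _).1 h1
    obtain ⟨t, ht, ht'⟩ := Finset.subset_set_image_iff.1 hs
    exact ⟨t, ht, by rw [hs', ← ht', Finset.coe_image]⟩
  let L : (s → T) →ₗ[T] T := Fintype.linearCombination T (fun q : s => (q : T))
  have hL : ∀ y, L y = ∑ q, y q * (q : T) := fun y => by
    simp [L, Fintype.linearCombination_apply]
  have hrange : LinearMap.range L = Ideal.span (s : Set T) := by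
    rw [Fintype.range_linearCombination]
    simp
  have hQP : Ideal.span (s : Set T) ≤ P := Ideal.span_le.2 hs
  have step : ∀ x : P, ∃ (y : s → T) (x' : P), (x : T) = L y + c * x' := by
    rintro ⟨x, hx⟩
    have h1 : π x ∈ (Ideal.span (s : Set T)).map π := by
      rw [Ideal.map_span, hs']
      exact Ideal.mem_map_of_mem π hx
    obtain ⟨z, hz, hzx⟩ := (Ideal.mem_map_iff_of_surjective π Ideal.Quotient.mk_surjective).1 h1
    obtain ⟨t, ht⟩ := Ideal.mem_span_singleton'.1 (Ideal.Quotient.eq.1 hzx.symm)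
    rw [← hrange] at hz
    obtain ⟨y, rfl⟩ := hz
    have h2 : t * c ∈ P := by
      rw [ht]
      exact sub_mem hx (hQP (hrange ▸ LinearMap.mem_range_self L y))
    exact ⟨y, ⟨t, (hP.mem_or_mem h2).resolve_right hcP⟩, by
      change x = L y + c * t
      rw [mul_comm, ht, add_sub_cancel]⟩
  choose y x' hx' using step
  refine ⟨s, le_antisymm hQP fun x hx => ?_⟩
  let ξ : ℕ → P := fun n => x'^[n] ⟨x, hx⟩
  have hξ : ∀ n, (ξ n : T) = L (y (ξ n)) + c * ξ (n + 1) := fun n => by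
    rw [hx' (ξ n)]
    simp only [ξ, Function.iterate_succ_apply']
  let Y : ℕ → s → T := fun N => ∑ n ∈ Finset.range N, c ^ n • y (ξ n)
  have hY : ∀ N, x = L (Y N) + c ^ N * ξ N := by
    intro N
    induction N with
    | zero => simp [Y, ξ]
    | succ N ih =>
      have : Y (N + 1) = Y N + c ^ N • y (ξ N) := Finset.sum_range_succ _ _
      rw [this, map_add, map_smul, smul_eq_mul]
      conv_lhs => rw [ih, hξ N]
      ring
  have hcpow : ∀ N, c ^ N ∈ maximalIdeal T ^ N := fun N => Ideal.pow_mem_pow hc N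
  have hcauchy : ∀ q, ∃ z, ∀ N, Y N q ≡ z [SMOD (maximalIdeal T ^ N • ⊤ : Submodule T T)] := by
    intro q
    refine IsPrecomplete.prec inferInstance fun {m n} hmn => ?_
    rw [SModEq.sub_mem]
    have h1 : Y m q - Y n q = -∑ k ∈ Finset.Ico m n, c ^ k * y (ξ k) q := by
      rw [Finset.sum_Ico_eq_sub _ hmn]
      simp [Y, Finset.sum_apply]
    rw [h1, smul_eq_mul, Ideal.mul_top]
    refine neg_mem (sum_mem fun k hk => Ideal.mul_mem_right _ _ ?_)
    exact Ideal.pow_le_pow_right (Finset.mem_Ico.1 hk).1 (hcpow k)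
  choose z hz using hcauchy
  have hzero : x - L z = 0 := by
    refine IsHausdorff.haus (I := maximalIdeal T) inferInstance _ fun N => ?_
    rw [SModEq.zero, smul_eq_mul, Ideal.mul_top]
    have h1 : x - L z = L (Y N - z) + c ^ N * ξ N := by
      rw [map_sub]
      conv_lhs => rw [hY N]
      ring
    rw [h1, hL]
    refine add_mem (sum_mem fun q _ => Ideal.mul_mem_right _ _ ?_)
      (Ideal.mul_mem_right _ _ (hcpow N))
    have h2 := hz q N
    rwa [SModEq.sub_mem, smul_eq_mul, Ideal.mul_top] at h2
  rw [sub_eq_zero.1 hzero]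
  change L z ∈ Ideal.span (s : Set T)
  rw [← hrange]
  exact LinearMap.mem_range_self L z

/-- By Krull's principal ideal theorem, inverting a parameter of a one-dimensional local ring gives
an Artinian ring. -/
lemma isArtinianRing_of_isLocalization [IsNoetherianRing T] {c : T} {k : ℕ}
    (hc : c ∈ maximalIdeal T) (hk : maximalIdeal T ^ k ≤ Ideal.span {c}) (N : Submonoid T)
    (hcN : c ∈ N) (S : Type*) [CommRing S] [Algebra T S] [IsLocalization N S] :
    IsArtinianRing S := by
  have hS : IsNoetherianRing S := IsLocalization.isNoetherianRing N S inferInstance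
  have hheight : (maximalIdeal T).height ≤ 1 := by
    refine Ideal.height_le_one_of_isPrincipal_of_mem_minimalPrimes (Ideal.span {c}) _
      ⟨⟨inferInstance, (Ideal.span_singleton_le_iff_mem _).2 hc⟩, fun P hP hle => ?_⟩
    have := hP.1
    rw [eq_maximalIdeal_of_pow_le hk ((Ideal.span_singleton_le_iff_mem _).1 hP.2)]
  have hmin : ∀ P : Ideal S, P.IsPrime → P.comap (algebraMap T S) ∈ minimalPrimes T := by
    intro P hP
    have hlt : P.comap (algebraMap T S) < maximalIdeal T := by
      refine lt_of_le_of_ne (le_maximalIdeal (hP.comap _).ne_top) fun h => ?_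
      rw [← h] at hc
      exact hP.ne_top (P.eq_top_of_isUnit_mem (Ideal.mem_comap.1 hc)
        (IsLocalization.map_units S (⟨c, hcN⟩ : N)))
    have := hP.comap (algebraMap T S)
    have h1 := (Ideal.height_strict_mono_of_isPrime_of_isPrime hlt).trans_le hheight
    rw [Order.lt_one_iff] at h1
    exact Ideal.height_eq_zero_iff.1 h1
  rw [isArtinianRing_iff_krullDimLE_zero, Ring.krullDimLE_zero_iff]
  intro P hP
  obtain ⟨M, hM, hle⟩ := P.exists_le_maximal hP.ne_top
  have h1 : P.under T = M.under T :=
    le_antisymm (Ideal.comap_mono hle)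
      ((hmin M hM.isPrime).2 ⟨hP.comap _, bot_le⟩ (Ideal.comap_mono hle))
  rwa [← IsLocalization.map_under N S P, h1, IsLocalization.map_under N S M]

end Completion

section LocalCompletion

variable {R : Type u} [CommRing R] [IsNoetherianRing R] (m : Ideal R) [m.IsMaximal]

omit [IsNoetherianRing R] in
lemma isUnit_algebraMap_localCompletion {s : R} (hs : s ∉ m) :
    IsUnit (algebraMap R (LocalCompletion m) s) := by
  have h := IsLocalization.map_units (Localization.AtPrime m) (⟨s, hs⟩ : m.primeCompl)
  exact h.map (algebraMap (Localization.AtPrime m) (LocalCompletion m))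

instance : IsScalarTower R (Localization.AtPrime m) (LocalCompletion m) :=
  IsScalarTower.of_algebraMap_eq fun _ => rfl

omit [IsNoetherianRing R] in
lemma map_maximalIdeal_pow_localCompletion (k : ℕ) :
    (IsLocalRing.maximalIdeal (Localization.AtPrime m) ^ k).map
      (algebraMap (Localization.AtPrime m) (LocalCompletion m)) =
      (m ^ k).map (algebraMap R (LocalCompletion m)) := by
  have h : IsLocalRing.maximalIdeal (Localization.AtPrime m) ^ k =
      (m ^ k).map (algebraMap R (Localization.AtPrime m)) := by
    rw [Ideal.map_pow, Localization.AtPrime.map_eq_maximalIdeal]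
  refine (congrArg (Ideal.map (algebraMap (Localization.AtPrime m) (LocalCompletion m))) h).trans ?_
  rw [Ideal.map_map, ← IsScalarTower.algebraMap_eq]

lemma maximalIdeal_localCompletion :
    IsLocalRing.maximalIdeal (LocalCompletion m) = m.map (algebraMap R (LocalCompletion m)) := by
  have h := map_maximalIdeal_pow_localCompletion m 1
  rw [pow_one, pow_one] at h
  exact AdicCompletion.maximalIdeal_eq_map.trans h

/-- The projection of the completion to `R ⧸ m ^ k`. -/
lemma exists_ker_eq_map (k : ℕ) : ∃ φ : LocalCompletion m →ₐ[R] R ⧸ m ^ k,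
    RingHom.ker φ = (m ^ k).map (algebraMap R (LocalCompletion m)) := by
  let I := IsLocalRing.maximalIdeal (Localization.AtPrime m)
  let ε := IsLocalization.AtPrime.equivQuotMaximalIdealPow m (Localization.AtPrime m) k
  refine ⟨ε.symm.toAlgHom.comp ((AdicCompletion.evalₐ I k).restrictScalars R), ?_⟩
  have hfg : I.FG := IsNoetherian.noetherian _
  ext x
  have h1 : x ∈ (m ^ k).map (algebraMap R (LocalCompletion m)) ↔
      AdicCompletion.eval I (Localization.AtPrime m) k x = 0 := by
    rw [← map_maximalIdeal_pow_localCompletion, ← LinearMap.mem_ker,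
      ← AdicCompletion.pow_smul_top_eq_ker_eval hfg, Ideal.smul_top_eq_map]
    rfl
  rw [h1, RingHom.mem_ker]
  change ε.symm (AdicCompletion.evalₐ I k x) = 0 ↔ _
  rw [map_eq_zero_iff _ ε.symm.injective]
  constructor
  · intro h
    rw [← AdicCompletion.factor_evalₐ_eq_eval I x (by simp), h, map_zero]
  · intro h
    rw [← AdicCompletion.factor_eval_eq_evalₐ I x (by simp), h, map_zero]

/-- The image of `R` is dense in the completion. -/
lemma exists_sub_algebraMap_mem (k : ℕ) (x : LocalCompletion m) :
    ∃ r : R, x - algebraMap R _ r ∈ (m ^ k).map (algebraMap R (LocalCompletion m)) := by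
  obtain ⟨φ, hφ⟩ := exists_ker_eq_map m k
  obtain ⟨r, hr⟩ := Ideal.Quotient.mk_surjective (φ x)
  refine ⟨r, ?_⟩
  rw [← hφ, RingHom.mem_ker, map_sub, AlgHom.commutes, Ideal.Quotient.algebraMap_eq, hr, sub_self]

open nonZeroDivisors in
/-- The completion at `m` becomes Artinian if the regular elements of `R` are inverted, provided that
one of them lies in `m`. -/
lemma isArtinianRing_localization_localCompletion (hdim : ringKrullDim R ≤ 1) {c : R}
    (hc : c ∈ R⁰) (hcm : c ∈ m) :
    IsArtinianRing (Localization (Algebra.algebraMapSubmonoid (LocalCompletion m) R⁰)) := by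
  obtain ⟨t, ht, k, hk⟩ := exists_notMem_forall_pow_mul_mem hdim m hc
  have h1 : IsLocalRing.maximalIdeal (LocalCompletion m) ^ k ≤
      Ideal.span {algebraMap R (LocalCompletion m) c} := by
    rw [maximalIdeal_localCompletion, ← Ideal.map_pow, Ideal.map_le_iff_le_comap]
    intro x hx
    rw [Ideal.mem_comap, ← Ideal.unit_mul_mem_iff_mem _ (isUnit_algebraMap_localCompletion m ht),
      ← map_mul, ← Set.image_singleton, ← Ideal.map_span]
    exact Ideal.mem_map_of_mem _ (hk x hx)
  have h2 : algebraMap R (LocalCompletion m) c ∈ IsLocalRing.maximalIdeal (LocalCompletion m) := by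
    rw [maximalIdeal_localCompletion]
    exact Ideal.mem_map_of_mem _ hcm
  have hfg : (IsLocalRing.maximalIdeal (LocalCompletion m)).FG := by
    rw [maximalIdeal_localCompletion]
    exact Ideal.FG.map (IsNoetherian.noetherian m) _
  have := isNoetherianRing_of_pow_le_span hfg h2 h1
  exact isArtinianRing_of_isLocalization h2 h1
    (Algebra.algebraMapSubmonoid (LocalCompletion m) R⁰) ⟨c, hc, rfl⟩ _

end LocalCompletion

/-! ### Saturations -/

namespace Submodule

variable {R E : Type*} [CommRing R]

section Module

variable [AddCommGroup E] [Module R E]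

/-- The elements of the ambient module which some element of `M` multiplies into `X`. This is the
preimage of the localization of `X` at `M`. -/
def saturate (M : Submonoid R) (X : Submodule R E) : Submodule R E where
  carrier := {x | ∃ s ∈ M, s • x ∈ X}
  zero_mem' := ⟨1, M.one_mem, by simp⟩
  add_mem' := by
    rintro x y ⟨s, hs, hx⟩ ⟨t, ht, hy⟩
    refine ⟨s * t, M.mul_mem hs ht, ?_⟩
    rw [smul_add]
    refine add_mem ?_ ?_
    · rw [mul_comm, mul_smul]; exact X.smul_mem _ hx
    · rw [mul_smul]; exact X.smul_mem _ hy
  smul_mem' := by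
    rintro r x ⟨s, hs, hx⟩
    exact ⟨s, hs, by rw [smul_comm]; exact X.smul_mem _ hx⟩

variable {M : Submonoid R} {X Y : Submodule R E}

lemma le_saturate : X ≤ saturate M X := fun _ hx => ⟨1, M.one_mem, by rwa [one_smul]⟩

lemma saturate_mono (h : X ≤ Y) : saturate M X ≤ saturate M Y :=
  fun _ ⟨s, hs, hx⟩ => ⟨s, hs, h hx⟩

lemma mem_saturate_of_smul_mem {s : R} (hs : s ∈ M) {x : E} (hx : s • x ∈ saturate M X) :
    x ∈ saturate M X := by
  obtain ⟨t, ht, hx⟩ := hx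
  exact ⟨t * s, M.mul_mem ht hs, by rwa [mul_smul]⟩

lemma saturate_le_saturate (h : X ≤ saturate M Y) : saturate M X ≤ saturate M Y :=
  fun _ ⟨_, hs, hx⟩ => mem_saturate_of_smul_mem hs (h hx)

/-- A finitely generated submodule has a common denominator. -/
lemma exists_forall_smul_mem (hX : X.FG) (h : X ≤ saturate M Y) :
    ∃ s ∈ M, ∀ x ∈ X, s • x ∈ Y := by
  induction X, hX using Submodule.fg_induction with
  | singleton x =>
    obtain ⟨s, hs, hx⟩ := h (mem_span_singleton_self x)
    refine ⟨s, hs, fun y hy => ?_⟩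
    obtain ⟨r, rfl⟩ := mem_span_singleton.1 hy
    rw [smul_comm]
    exact Y.smul_mem _ hx
  | sup X X' hX hX' ih ih' =>
    obtain ⟨s, hs, h1⟩ := ih (le_sup_left.trans h)
    obtain ⟨t, ht, h2⟩ := ih' (le_sup_right.trans h)
    refine ⟨s * t, M.mul_mem hs ht, fun x hx => ?_⟩
    obtain ⟨y, hy, z, hz, rfl⟩ := mem_sup.1 hx
    rw [smul_add]
    refine add_mem ?_ ?_
    · rw [mul_comm, mul_smul]; exact Y.smul_mem _ (h1 y hy)
    · rw [mul_smul]; exact Y.smul_mem _ (h2 z hz)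

end Module

section Algebra

variable [Ring E] [Algebra R E] {M : Submonoid R} {X Y Z : Submodule R E}

lemma saturate_mul_saturate_le : saturate M X * saturate M Y ≤ saturate M (X * Y) := by
  rw [mul_le]
  rintro x ⟨s, hs, hx⟩ y ⟨t, ht, hy⟩
  refine ⟨s * t, M.mul_mem hs ht, ?_⟩
  rw [← smul_mul_smul_comm]
  exact mul_mem_mul hx hy

lemma mul_le_saturate (h : X ≤ saturate M Y) : X * Z ≤ saturate M (Y * Z) :=
  (mul_le_mul' h le_saturate).trans saturate_mul_saturate_le

lemma mul_le_saturate_left (h : X ≤ saturate M Y) : Z * X ≤ saturate M (Z * Y) :=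
  (mul_le_mul' le_saturate h).trans saturate_mul_saturate_le

end Algebra

end Submodule

/-! ### Lattices -/

section

open nonZeroDivisors Submodule

/-- A linking algebra over the total ring of fractions, seen from the ring `R`: complementary full
idempotents `e = i 1` and `f = j 1` in an `R`-algebra `Ω` in which regular elements of `R` are
invertible, such that the corners `e Ω e` and `f Ω f` are the rational envelopes of `A` and `B`. -/
structure RationalLinking (R : Type*) [CommRing R] (A B Ω : Type*) [Ring A] [Algebra R A]
    [Ring B] [Algebra R B] [Ring Ω] [Algebra R Ω] where
  /-- The embedding of `A` into the corner `e Ω e`. -/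
  i : A →ₗ[R] Ω
  /-- The embedding of `B` into the corner `f Ω f`. -/
  j : B →ₗ[R] Ω
  i_mul : ∀ a a', i (a * a') = i a * i a'
  j_mul : ∀ b b', j (b * b') = j b * j b'
  i_injective : Function.Injective i
  j_injective : Function.Injective j
  add_one : i 1 + j 1 = 1
  isUnit : ∀ c ∈ R⁰, IsUnit (algebraMap R Ω c)
  left_full : ∀ x, i 1 * x * i 1 ∈ saturate R⁰ (LinearMap.range i)
  right_full : ∀ x, j 1 * x * j 1 ∈ saturate R⁰ (LinearMap.range j)
  full_left : ∃ (n : ℕ) (x y : Fin n → Ω), i 1 = ∑ k, x k * j 1 * y k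
  full_right : ∃ (n : ℕ) (x y : Fin n → Ω), j 1 = ∑ k, x k * i 1 * y k

namespace RationalLinking

variable {R : Type*} [CommRing R] {A B Ω : Type*} [Ring A] [Algebra R A]
    [Ring B] [Algebra R B] [Ring Ω] [Algebra R Ω]

/-- The same data with the roles of `A` and `B` exchanged. -/
def symm (D : RationalLinking R A B Ω) : RationalLinking R B A Ω where
  i := D.j
  j := D.i
  i_mul := D.j_mul
  j_mul := D.i_mul
  i_injective := D.j_injective
  j_injective := D.i_injective
  add_one := by rw [add_comm, D.add_one]
  isUnit := D.isUnit
  left_full := D.right_full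
  right_full := D.left_full
  full_left := D.full_right
  full_right := D.full_left

variable (D : RationalLinking R A B Ω)

lemma e_mul_e : D.i 1 * D.i 1 = D.i 1 := by rw [← D.i_mul, one_mul]

lemma f_mul_f : D.j 1 * D.j 1 = D.j 1 := D.symm.e_mul_e

lemma e_mul_f : D.i 1 * D.j 1 = 0 := by
  rw [eq_sub_of_add_eq' D.add_one, mul_sub, mul_one, e_mul_e, sub_self]

lemma f_mul_e : D.j 1 * D.i 1 = 0 := D.symm.e_mul_f

include D in
lemma eq_zero_of_smul_eq_zero {c : R} (hc : c ∈ R⁰) {x : Ω} (h : c • x = 0) : x = 0 := by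
  rw [Algebra.smul_def] at h
  exact (D.isUnit c hc).mul_right_eq_zero.1 h

include D in
lemma smul_left_cancel {c : R} (hc : c ∈ R⁰) {x y : Ω} (h : c • x = c • y) : x = y := by
  rw [← sub_eq_zero]
  exact D.eq_zero_of_smul_eq_zero hc (by rw [smul_sub, h, sub_self])

include D in
lemma exists_smul_eq {c : R} (hc : c ∈ R⁰) (x : Ω) : ∃ y, c • y = x := by
  obtain ⟨u, hu⟩ := D.isUnit c hc
  exact ⟨↑u⁻¹ * x, by rw [Algebra.smul_def, ← hu, Units.mul_inv_cancel_left]⟩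

/-- The order `A` as a submodule of `Ω`. -/
def left : Submodule R Ω := LinearMap.range D.i

/-- The order `B` as a submodule of `Ω`. -/
def right : Submodule R Ω := LinearMap.range D.j

lemma i_mem_left (a : A) : D.i a ∈ D.left := LinearMap.mem_range_self _ a

lemma left_fg [Module.Finite R A] : D.left.FG := by
  rw [left, LinearMap.range_eq_map]
  exact Module.Finite.fg_top.map _

lemma left_mul_left : D.left * D.left ≤ D.left := by
  rw [mul_le]
  rintro _ ⟨a, rfl⟩ _ ⟨a', rfl⟩
  exact ⟨a * a', D.i_mul a a'⟩

lemma e_mul_of_mem_left {x : Ω} (hx : x ∈ D.left) : D.i 1 * x = x := by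
  obtain ⟨a, rfl⟩ := hx
  rw [← D.i_mul, one_mul]

lemma mul_e_of_mem_left {x : Ω} (hx : x ∈ D.left) : x * D.i 1 = x := by
  obtain ⟨a, rfl⟩ := hx
  rw [← D.i_mul, mul_one]

/-- The submodules of the corner `e Ω f`. -/
structure InCorner (X : Submodule R Ω) : Prop where
  e_mul : ∀ x ∈ X, D.i 1 * x = x
  mul_f : ∀ x ∈ X, x * D.j 1 = x

/-- The submodules of the corner `e Ω e`. -/
structure InLeftCorner (X : Submodule R Ω) : Prop where
  e_mul : ∀ x ∈ X, D.i 1 * x = x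
  mul_e : ∀ x ∈ X, x * D.i 1 = x

variable {D}

lemma _root_.Submodule.forall_mul_eq_of_mul {x : Ω} {X Y : Submodule R Ω}
    (h : ∀ y ∈ X, x * y = y) : ∀ z ∈ X * Y, x * z = z := by
  intro z hz
  induction hz using Submodule.mul_induction_on' with
  | mem_mul_mem y hy y' _ => rw [← mul_assoc, h y hy]
  | add y _ y' _ h h' => rw [mul_add, h, h']

lemma _root_.Submodule.forall_eq_mul_of_mul {x : Ω} {X Y : Submodule R Ω}
    (h : ∀ y ∈ Y, y * x = y) : ∀ z ∈ X * Y, z * x = z := by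
  intro z hz
  induction hz using Submodule.mul_induction_on' with
  | mem_mul_mem y _ y' hy' => rw [mul_assoc, h y' hy']
  | add y _ y' _ h h' => rw [add_mul, h, h']

lemma inCorner_span {s : Set Ω} (h : ∀ x ∈ s, D.i 1 * x = x ∧ x * D.j 1 = x) :
    D.InCorner (span R s) := by
  constructor
  · intro z hz
    induction hz using span_induction with
    | mem z hz => exact (h z hz).1
    | zero => rw [mul_zero]
    | add y z _ _ h h' => rw [mul_add, h, h']
    | smul r y _ h => rw [mul_smul_comm, h]
  · intro z hz
    induction hz using span_induction with
    | mem z hz => exact (h z hz).2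
    | zero => rw [zero_mul]
    | add y z _ _ h h' => rw [add_mul, h, h']
    | smul r y _ h => rw [smul_mul_assoc, h]

variable (D)

include D in
/-- A submodule is finitely generated as soon as a multiple of it is contained in a finitely
generated one. -/
lemma fg_of_forall_smul_mem [IsNoetherianRing R] {N W : Submodule R Ω} (hW : W.FG) {c : R}
    (hc : c ∈ R⁰) (h : ∀ x ∈ N, c • x ∈ W) : N.FG := by
  have : IsNoetherian R W := isNoetherian_of_fg_of_noetherian W hW
  let φ : N →ₗ[R] W := (LinearMap.lsmul R Ω c).restrict h
  have hφ : Function.Injective φ := fun x y hxy =>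
    Subtype.ext (D.smul_left_cancel hc (congrArg Subtype.val hxy))
  have : IsNoetherian R N := isNoetherian_of_injective φ hφ
  exact (Submodule.fg_top N).1 (IsNoetherian.noetherian ⊤)

include D in
lemma fg_of_le [IsNoetherianRing R] {N W : Submodule R Ω} (hW : W.FG) (h : N ≤ W) : N.FG :=
  D.fg_of_forall_smul_mem hW R⁰.one_mem fun x hx => by rw [one_smul]; exact h hx

/-- A full finitely generated `A`-`B`-submodule of the corner `e Ω f`. -/
structure IsLattice (L : Submodule R Ω) : Prop extends D.InCorner L where
  fg : L.FG
  left_mul : D.left * L ≤ L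
  mul_right : L * D.right ≤ L
  full : ∀ x, D.i 1 * x * D.j 1 ∈ saturate R⁰ L

/-- The dual of a lattice `L`, in the corner `f Ω e`. -/
def dual (L : Submodule R Ω) : Submodule R Ω where
  carrier := {x | (D.j 1 * x = x ∧ x * D.i 1 = x) ∧ ∀ y ∈ L, y * x ∈ D.left ∧ x * y ∈ D.right}
  zero_mem' := ⟨by simp, fun y _ => by simp⟩
  add_mem' := by
    rintro x x' ⟨⟨h1, h2⟩, h3⟩ ⟨⟨h1', h2'⟩, h3'⟩
    exact ⟨⟨by rw [mul_add, h1, h1'], by rw [add_mul, h2, h2']⟩, fun y hy =>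
      ⟨by rw [mul_add]; exact add_mem (h3 y hy).1 (h3' y hy).1,
        by rw [add_mul]; exact add_mem (h3 y hy).2 (h3' y hy).2⟩⟩
  smul_mem' := by
    rintro r x ⟨⟨h1, h2⟩, h3⟩
    exact ⟨⟨by rw [mul_smul_comm, h1], by rw [smul_mul_assoc, h2]⟩, fun y hy =>
      ⟨by rw [mul_smul_comm]; exact smul_mem _ _ (h3 y hy).1,
        by rw [smul_mul_assoc]; exact smul_mem _ _ (h3 y hy).2⟩⟩

variable {D} {L : Submodule R Ω}

lemma inCorner_dual : D.symm.InCorner (D.dual L) :=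
  ⟨fun _ hx => hx.1.1, fun _ hx => hx.1.2⟩

lemma mul_dual_le : L * D.dual L ≤ D.left := by
  rw [mul_le]
  exact fun y hy x hx => (hx.2 y hy).1

lemma dual_mul_le : D.dual L * L ≤ D.right := by
  rw [mul_le]
  exact fun x hx y hy => (hx.2 y hy).2

/-- The dual is compatible with localization. -/
lemma mem_saturate_dual {M : Submonoid R} (hL : L.FG) {x : Ω} (hx : D.j 1 * x = x)
    (hx' : x * D.i 1 = x) (h : ∀ y ∈ L, y * x ∈ saturate M D.left)
    (h' : ∀ y ∈ L, x * y ∈ saturate M D.right) : x ∈ saturate M (D.dual L) := by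
  obtain ⟨s, hs, h1⟩ := exists_forall_smul_mem (hL.map (LinearMap.mulRight R x))
    (Submodule.map_le_iff_le_comap.2 fun y hy => h y hy)
  obtain ⟨t, ht, h2⟩ := exists_forall_smul_mem (hL.map (LinearMap.mulLeft R x))
    (Submodule.map_le_iff_le_comap.2 fun y hy => h' y hy)
  refine ⟨s * t, M.mul_mem hs ht, ⟨by rw [mul_smul_comm, hx], by rw [smul_mul_assoc, hx']⟩,
    fun y hy => ⟨?_, ?_⟩⟩
  · rw [mul_smul_comm, mul_comm, mul_smul]
    exact smul_mem _ _ (h1 _ (mem_map_of_mem hy))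
  · rw [smul_mul_assoc, mul_smul]
    exact smul_mem _ _ (h2 _ (mem_map_of_mem hy))

namespace IsLattice

lemma exists_f_mem (hL : D.IsLattice L) : ∃ W : Submodule R Ω, W.FG ∧ D.symm.InCorner W ∧
    D.j 1 ∈ saturate R⁰ (W * L) := by
  obtain ⟨n, x, y, hxy⟩ := D.full_right
  refine ⟨span R (Set.range fun k => D.j 1 * x k * D.i 1), fg_span (Set.finite_range _), ?_, ?_⟩
  · refine inCorner_span ?_
    rintro _ ⟨k, rfl⟩
    exact ⟨by rw [← mul_assoc, ← mul_assoc]; exact congrArg (· * _ * _) D.f_mul_f,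
      by rw [mul_assoc]; exact congrArg (_ * ·) D.e_mul_e⟩
  · have h1 : D.j 1 = ∑ k, (D.j 1 * x k * D.i 1) * (D.i 1 * y k * D.j 1) := by
      conv_lhs => rw [← D.f_mul_f, ← D.f_mul_f, mul_assoc]
      conv_lhs => enter [2, 1]; rw [hxy]
      rw [Finset.sum_mul, Finset.mul_sum]
      refine Finset.sum_congr rfl fun k _ => ?_
      rw [mul_assoc _ (D.i 1) (D.i 1 * _ * _), ← mul_assoc (D.i 1), ← mul_assoc (D.i 1) (D.i 1),
        e_mul_e]
      simp only [mul_assoc, f_mul_f]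
    have h2 : ∑ k, (D.j 1 * x k * D.i 1) * (D.i 1 * y k * D.j 1) ∈ saturate R⁰
        (span R (Set.range fun k => D.j 1 * x k * D.i 1) * L) :=
      sum_mem fun k _ => mul_le_saturate_left le_rfl
        (mul_mem_mul (subset_span ⟨k, rfl⟩) (hL.full (y k)))
    rwa [← h1] at h2

lemma exists_e_mem (hL : D.IsLattice L) : ∃ W : Submodule R Ω, W.FG ∧ D.symm.InCorner W ∧
    D.i 1 ∈ saturate R⁰ (L * W) := by
  obtain ⟨n, x, y, hxy⟩ := D.full_left
  refine ⟨span R (Set.range fun k => D.j 1 * y k * D.i 1), fg_span (Set.finite_range _), ?_, ?_⟩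
  · refine inCorner_span ?_
    rintro _ ⟨k, rfl⟩
    exact ⟨by rw [← mul_assoc, ← mul_assoc]; exact congrArg (· * _ * _) D.f_mul_f,
      by rw [mul_assoc]; exact congrArg (_ * ·) D.e_mul_e⟩
  · have h1 : D.i 1 = ∑ k, (D.i 1 * x k * D.j 1) * (D.j 1 * y k * D.i 1) := by
      conv_lhs => rw [← D.e_mul_e, ← D.e_mul_e, mul_assoc]
      conv_lhs => enter [2, 1]; rw [hxy]
      rw [Finset.sum_mul, Finset.mul_sum]
      refine Finset.sum_congr rfl fun k _ => ?_
      rw [mul_assoc _ (D.j 1) (D.j 1 * _ * _), ← mul_assoc (D.j 1), ← mul_assoc (D.j 1) (D.j 1),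
        f_mul_f]
      simp only [mul_assoc, e_mul_e]
    have h2 : ∑ k, (D.i 1 * x k * D.j 1) * (D.j 1 * y k * D.i 1) ∈ saturate R⁰
        (L * span R (Set.range fun k => D.j 1 * y k * D.i 1)) :=
      sum_mem fun k _ => mul_le_saturate le_rfl
        (mul_mem_mul (hL.full (x k)) (subset_span ⟨k, rfl⟩))
    rwa [← h1] at h2

lemma right_mul_dual (hL : D.IsLattice L) : D.right * D.dual L ≤ D.dual L := by
  rw [mul_le]
  intro b hb x hx
  refine ⟨⟨?_, ?_⟩, fun y hy => ⟨?_, ?_⟩⟩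
  · rw [← mul_assoc]
    exact congrArg (· * x) (D.symm.e_mul_of_mem_left hb)
  · rw [mul_assoc, hx.1.2]
  · rw [← mul_assoc]
    exact (hx.2 _ (hL.mul_right (mul_mem_mul hy hb))).1
  · rw [mul_assoc]
    exact D.symm.left_mul_left (mul_mem_mul hb (hx.2 y hy).2)

lemma dual_mul_left (hL : D.IsLattice L) : D.dual L * D.left ≤ D.dual L := by
  rw [mul_le]
  intro x hx a ha
  refine ⟨⟨?_, ?_⟩, fun y hy => ⟨?_, ?_⟩⟩
  · rw [← mul_assoc, hx.1.1]
  · rw [mul_assoc, D.mul_e_of_mem_left ha]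
  · rw [← mul_assoc]
    exact D.left_mul_left (mul_mem_mul (hx.2 y hy).1 ha)
  · rw [mul_assoc]
    exact (hx.2 _ (hL.left_mul (mul_mem_mul ha hy))).2

lemma dual [IsNoetherianRing R] [Module.Finite R B] (hL : D.IsLattice L) :
    D.symm.IsLattice (D.dual L) where
  toInCorner := inCorner_dual
  fg := by
    obtain ⟨W, hW, -, c, hc, hcW⟩ := hL.exists_e_mem
    refine D.fg_of_forall_smul_mem (W := D.right * W) (D.symm.left_fg.mul hW) hc fun x hx => ?_
    rw [← hx.1.2, ← mul_smul_comm]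
    have h1 : D.dual L * (L * W) ≤ D.right * W := by
      rw [← mul_assoc]
      exact mul_le_mul_left dual_mul_le _
    exact h1 (mul_mem_mul hx hcW)
  left_mul := hL.right_mul_dual
  mul_right := hL.dual_mul_left
  full x := by
    refine mem_saturate_dual hL.fg ?_ ?_ (fun y hy => ?_) fun y hy => ?_
    · change D.j 1 * (D.j 1 * x * D.i 1) = D.j 1 * x * D.i 1
      rw [← mul_assoc, ← mul_assoc, f_mul_f]
    · change (D.j 1 * x * D.i 1) * D.i 1 = D.j 1 * x * D.i 1
      rw [mul_assoc, e_mul_e]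
    · change y * (D.j 1 * x * D.i 1) ∈ _
      rw [← hL.e_mul y hy, mul_assoc, ← mul_assoc y, ← mul_assoc (D.i 1)]
      exact D.left_full _
    · change D.j 1 * x * D.i 1 * y ∈ _
      rw [← hL.mul_f y hy, mul_assoc _ _ (y * _), ← mul_assoc _ y, mul_assoc (D.j 1), ← mul_assoc x,
        ← mul_assoc (D.j 1)]
      exact D.right_full _

end IsLattice

end RationalLinking

end

/-! ### Idempotents modulo a maximal ideal -/

section

open nonZeroDivisors Submodule

lemma exists_mem_forall_mul_one_sub_eq_zero {A Q : Type*} [Ring A] [Ring Q] [IsSemisimpleRing Q]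
    (φ : A →+* Q) (hφ : Function.Surjective φ) (J : AddSubgroup A)
    (hJ : ∀ a, ∀ x ∈ J, a * x ∈ J) : ∃ ε ∈ J, ∀ y ∈ J, φ (y * (1 - ε)) = 0 := by
  let J' : Ideal Q :=
    { carrier := φ '' J
      zero_mem' := ⟨0, J.zero_mem, map_zero φ⟩
      add_mem' := by
        rintro _ _ ⟨x, hx, rfl⟩ ⟨y, hy, rfl⟩
        exact ⟨x + y, J.add_mem hx hy, map_add φ x y⟩
      smul_mem' := by
        rintro q _ ⟨x, hx, rfl⟩
        obtain ⟨a, rfl⟩ := hφ q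
        exact ⟨a * x, hJ a x hx, map_mul φ a x⟩ }
  obtain ⟨ε', hε, hJ'⟩ := IsSemisimpleRing.ideal_eq_span_idempotent J'
  obtain ⟨ε, hεJ, rfl⟩ : ε' ∈ J' := hJ' ▸ Ideal.mem_span_singleton_self ε'
  refine ⟨ε, hεJ, fun y hy => ?_⟩
  have h1 : φ y ∈ J' := ⟨y, hy, rfl⟩
  rw [hJ'] at h1
  obtain ⟨q, hq⟩ := Ideal.mem_span_singleton'.1 h1
  rw [map_mul, map_sub, map_one, ← hq, mul_assoc, mul_sub, mul_one, hε.eq, sub_self, mul_zero]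

lemma map_pow_mem {R A Q : Type*} [CommRing R] [Ring A] [Algebra R A] [Ring Q] (π : A →+* Q)
    {I : Ideal Q} {N : Submodule R A} (h : ∀ x ∈ N, π x ∈ I) (k : ℕ) :
    ∀ x ∈ N ^ k, π x ∈ I ^ k := by
  induction k with
  | zero =>
    intro x hx
    have h1 : I ^ 0 = ⊤ := (Submodule.pow_zero I).trans Ideal.one_eq_top
    rw [h1]
    trivial
  | succ k ih =>
    intro x hx
    rw [pow_succ] at hx
    induction hx using Submodule.mul_induction_on' with
    | mem_mul_mem y hy z hz =>
      rw [map_mul, Submodule.pow_succ]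
      exact Ideal.mul_mem_mul (ih y hy) (h z hz)
    | add y _ z _ hy hz => rw [map_add]; exact add_mem hy hz

lemma exists_nilpotent_of_surjective {R A Q : Type*} [CommRing R] [Ring A] [Algebra R A] [Ring Q]
    [IsArtinianRing Q] (π : A →+* Q) (hπ : Function.Surjective π) : ∃ N : Submodule R A,
      (∀ a, ∀ x ∈ N, a * x ∈ N ∧ x * a ∈ N) ∧ (∃ k, ∀ x ∈ N ^ k, π x = 0) ∧
      ∀ J : Submodule R A, (∀ a, ∀ x ∈ J, a * x ∈ J) → ∃ ε ∈ J, ∀ y ∈ J, y * (1 - ε) ∈ N := by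
  let φ : A →+* Q ⧸ Ring.jacobson Q := (Ideal.Quotient.mk (Ring.jacobson Q)).comp π
  have hφ : Function.Surjective φ := Ideal.Quotient.mk_surjective.comp hπ
  have hφ0 : ∀ a, φ a = 0 ↔ π a ∈ Ring.jacobson Q := fun a => Ideal.Quotient.eq_zero_iff_mem
  have hss : IsSemisimpleRing (Q ⧸ Ring.jacobson Q) := IsSemiprimaryRing.isSemisimpleRing
  let N : Submodule R A :=
    { carrier := {a | φ a = 0}
      zero_mem' := map_zero φ
      add_mem' := fun {a b} (ha : φ a = 0) (hb : φ b = 0) =>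
        (map_add φ a b).trans (by rw [ha, hb, add_zero])
      smul_mem' := fun r a (ha : φ a = 0) => by
        change φ (r • a) = 0
        rw [Algebra.smul_def, map_mul, ha, mul_zero] }
  have hN : ∀ {a}, a ∈ N ↔ φ a = 0 := Iff.rfl
  refine ⟨N, fun a x hx => ⟨?_, ?_⟩, ?_, fun J hJ => ?_⟩
  · rw [hN, map_mul, hN.1 hx, mul_zero]
  · rw [hN, map_mul, hN.1 hx, zero_mul]
  · obtain ⟨k, hk⟩ : IsNilpotent (Ring.jacobson Q) := IsSemiprimaryRing.isNilpotent
    refine ⟨k, fun x hx => ?_⟩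
    have h2 := map_pow_mem π (fun x hx => (hφ0 x).1 hx) k x hx
    rwa [hk] at h2
  · exact exists_mem_forall_mul_one_sub_eq_zero φ hφ J.toAddSubgroup hJ

/-- A finite algebra is semisimple modulo `m` and a two-sided ideal `N` that is nilpotent modulo
`m`. So modulo `N` every two-sided ideal `J` is generated by an idempotent `ε`. -/
lemma exists_nilpotent_ideal {R A : Type*} [CommRing R] [Ring A] [Algebra R A] [Module.Finite R A]
    (m : Ideal R) [m.IsMaximal] : ∃ N : Submodule R A,
      (∀ a, ∀ x ∈ N, a * x ∈ N ∧ x * a ∈ N) ∧ (∃ k, N ^ k ≤ m • ⊤) ∧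
      ∀ J : Submodule R A, (∀ a, ∀ x ∈ J, a * x ∈ J) → ∃ ε ∈ J, ∀ y ∈ J, y * (1 - ε) ∈ N := by
  let _ : Field (R ⧸ m) := Ideal.Quotient.field m
  have hart : IsArtinianRing ((R ⧸ m) ⊗[R] A) := IsArtinianRing.of_finite (R ⧸ m) _
  let π : A →ₐ[R] (R ⧸ m) ⊗[R] A := Algebra.TensorProduct.includeRight
  have hπ : Function.Surjective π := by
    intro x
    induction x using TensorProduct.induction_on with
    | zero => exact ⟨0, map_zero π⟩
    | add x y hx hy =>
      obtain ⟨a, rfl⟩ := hx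
      obtain ⟨b, rfl⟩ := hy
      exact ⟨a + b, map_add π a b⟩
    | tmul r a =>
      obtain ⟨r, rfl⟩ := Ideal.Quotient.mk_surjective r
      refine ⟨r • a, ?_⟩
      change (1 : R ⧸ m) ⊗ₜ[R] (r • a) = _
      rw [← TensorProduct.smul_tmul, Algebra.smul_def, mul_one]
      rfl
  have hker : ∀ a, π a = 0 → a ∈ m • (⊤ : Submodule R A) := by
    intro a ha
    have h1 := TensorProduct.quotTensorEquivQuotSMul_mk_tmul (M := A) (I := m) 1 a
    rw [map_one, one_smul] at h1
    rw [← Submodule.Quotient.mk_eq_zero, ← h1]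
    exact (congrArg _ ha).trans (map_zero _)
  obtain ⟨N, hN, ⟨k, hk⟩, hJ⟩ := exists_nilpotent_of_surjective (R := R) π.toRingHom hπ
  exact ⟨N, hN, ⟨k, fun x hx => hker x (hk x hx)⟩, hJ⟩

/-! ### Maximality and invertibility at a place -/

namespace RationalLinking

variable {R : Type*} [CommRing R] {A B Ω : Type*} [Ring A] [Algebra R A]
    [Ring B] [Algebra R B] [Ring Ω] [Algebra R Ω]

variable (D : RationalLinking R A B Ω)

/-- The order `A` is maximal after localization at `M`. -/
def IsMaximalAt (M : Submonoid R) : Prop :=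
  ∀ O : Submodule R Ω, O.FG → D.left ≤ O → O * O ≤ O → D.InLeftCorner O → O ≤ saturate M D.left

/-- The localization of the lattice `L` at `M` is an invertible bimodule, with inverse `dual L`. -/
def IsInvertibleAt (M : Submonoid R) (L : Submodule R Ω) : Prop :=
  D.i 1 ∈ saturate M (L * D.dual L) ∧ D.j 1 ∈ saturate M (D.dual L * L)

variable {D}

lemma isLattice_sandwich {G : Submodule R Ω} [Module.Finite R A] [Module.Finite R B]
    (hfg : G.FG)
    (hfull : ∀ x, D.i 1 * x * D.j 1 ∈ saturate R⁰ (D.left * G * D.right)) :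
    D.IsLattice (D.left * G * D.right) where
  e_mul := forall_mul_eq_of_mul (forall_mul_eq_of_mul fun _ => D.e_mul_of_mem_left)
  mul_f := forall_eq_mul_of_mul fun _ => D.symm.mul_e_of_mem_left
  fg := (D.left_fg.mul hfg).mul D.symm.left_fg
  left_mul := by
    rw [← mul_assoc, ← mul_assoc]
    exact mul_le_mul_left (mul_le_mul_left D.left_mul_left _) _
  mul_right := by
    rw [mul_assoc]
    exact mul_le_mul_right D.symm.left_mul_left _
  full := hfull

lemma InCorner.le_sandwich {G : Submodule R Ω} (hG : D.InCorner G) :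
    G ≤ D.left * G * D.right := by
  intro x hx
  rw [← hG.mul_f x hx, ← hG.e_mul x hx]
  exact mul_mem_mul (mul_mem_mul (D.i_mem_left 1) hx) (D.symm.i_mem_left 1)

variable (D) in
/-- Lattices exist. -/
lemma exists_isLattice [Module.Finite R A] [Module.Finite R B] : ∃ L, D.IsLattice L := by
  obtain ⟨n, x, y, hxy⟩ := D.full_left
  refine ⟨D.left * span R (Set.range fun k => D.i 1 * x k * D.j 1) * D.right,
    isLattice_sandwich (fg_span (Set.finite_range _)) fun z => ?_⟩
  have h1 : D.i 1 * z * D.j 1 =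
      ∑ k, D.i 1 * (D.i 1 * x k * D.j 1) * (D.j 1 * (y k * D.i 1 * z) * D.j 1) := by
    have h2 : ∀ k, D.i 1 * (D.i 1 * x k * D.j 1) * (D.j 1 * (y k * D.i 1 * z) * D.j 1) =
        D.i 1 * (x k * D.j 1 * y k) * (D.i 1 * z * D.j 1) := fun k => by
      have h3 : ∀ t, t * D.j 1 * D.j 1 = t * D.j 1 := fun t => by rw [mul_assoc, f_mul_f]
      simp only [← mul_assoc, h3, e_mul_e]
    simp only [h2]
    rw [← Finset.sum_mul, ← Finset.mul_sum, ← hxy, e_mul_e, ← mul_assoc, ← mul_assoc, e_mul_e]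
  rw [h1]
  refine sum_mem fun k _ => ?_
  exact mul_le_saturate_left le_rfl (mul_mem_mul (mul_mem_mul (D.i_mem_left 1)
    (subset_span ⟨k, rfl⟩)) (D.right_full _))

/-- The right multiplier ring of a lattice is an order, so it is contained in `B` wherever `B` is
maximal. -/
lemma IsLattice.mem_saturate_right [IsNoetherianRing R] [Module.Finite R B] {M : Submonoid R}
    {L : Submodule R Ω} (hL : D.IsLattice L) (hmax : D.symm.IsMaximalAt M) {x : Ω}
    (hx : D.j 1 * x = x) (hx' : x * D.j 1 = x) (h : ∀ y ∈ L, y * x ∈ saturate M L) :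
    x ∈ saturate M D.right := by
  obtain ⟨s, hs, h1⟩ := exists_forall_smul_mem (hL.fg.map (LinearMap.mulRight R x))
    (Submodule.map_le_iff_le_comap.2 fun y hy => h y hy)
  let O : Submodule R Ω :=
    { carrier := {z | (D.j 1 * z = z ∧ z * D.j 1 = z) ∧ ∀ y ∈ L, y * z ∈ L}
      zero_mem' := ⟨by simp, fun y _ => by simp⟩
      add_mem' := by
        rintro z w ⟨⟨h1, h2⟩, h3⟩ ⟨⟨h1', h2'⟩, h3'⟩
        exact ⟨⟨by rw [mul_add, h1, h1'], by rw [add_mul, h2, h2']⟩, fun y hy =>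
          by rw [mul_add]; exact add_mem (h3 y hy) (h3' y hy)⟩
      smul_mem' := by
        rintro r z ⟨⟨h1, h2⟩, h3⟩
        exact ⟨⟨by rw [mul_smul_comm, h1], by rw [smul_mul_assoc, h2]⟩, fun y hy =>
          by rw [mul_smul_comm]; exact smul_mem _ _ (h3 y hy)⟩ }
  have hO : O ≤ saturate M D.symm.left := by
    refine hmax O ?_ (fun b hb => ?_) ?_ ⟨fun z hz => hz.1.1, fun z hz => hz.1.2⟩
    · obtain ⟨W, hW, -, c, hc, hcW⟩ := hL.exists_f_mem
      refine D.fg_of_forall_smul_mem (N := O) (hW.mul hL.fg) hc fun z hz => ?_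
      rw [← hz.1.1, ← smul_mul_assoc]
      have h2 : W * L * O ≤ W * L := by
        rw [mul_assoc]
        refine mul_le_mul_right (mul_le.2 fun y hy z hz => hz.2 y hy : L * O ≤ L) _
      exact h2 (mul_mem_mul hcW hz)
    · exact ⟨⟨D.symm.e_mul_of_mem_left hb, D.symm.mul_e_of_mem_left hb⟩,
        fun y hy => hL.mul_right (mul_mem_mul hy hb)⟩
    · rw [mul_le]
      intro z hz w hw
      exact ⟨⟨by rw [← mul_assoc, hz.1.1], by rw [mul_assoc, hw.1.2]⟩, fun y hy => by
        rw [← mul_assoc]; exact hw.2 _ (hz.2 y hy)⟩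
  refine mem_saturate_of_smul_mem hs (hO ⟨⟨?_, ?_⟩, fun y hy => ?_⟩)
  · rw [mul_smul_comm, hx]
  · rw [smul_mul_assoc, hx']
  · rw [mul_smul_comm]
    exact h1 _ (mem_map_of_mem hy)

end RationalLinking

end

/-! ### Lattices over maximal orders -/

section

open nonZeroDivisors Submodule

namespace RationalLinking

variable {R : Type*} [CommRing R] {A B Ω : Type*} [Ring A] [Algebra R A]
    [Ring B] [Algebra R B] [Ring Ω] [Algebra R Ω]

variable {D : RationalLinking R A B Ω}

/-- The submodule `c A` of `Ω`. -/
def smulLeft (D : RationalLinking R A B Ω) (c : R) : Submodule R Ω :=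
  D.left.map (LinearMap.lsmul R Ω c)

/-- If `c` divides `U J V`, it also divides `V U`: here `c⁻¹ J V U` is multiplicatively closed, so
it is contained in the maximal order. -/
lemma IsMaximalAt.mul_le_of_mul_mul_le [IsNoetherianRing R] [Module.Finite R A] {M : Submonoid R}
    (hmax : D.IsMaximalAt M) {J U V : Submodule R Ω} (hJ : D.left * J ≤ J) (hJA : J ≤ D.left)
    (hJsat : ∀ X, D.InLeftCorner X → J * X ≤ saturate M D.left → X ≤ saturate M D.left)
    (hUA : U ≤ D.left) (hU : D.left * U ≤ U) (hU' : U * D.left ≤ U) (hVA : V ≤ D.left)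
    {c : R} (hc : c ∈ R⁰) (h : U * J * V ≤ saturate M (D.smulLeft c)) :
    V * U ≤ saturate M (D.smulLeft c) := by
  let Y : Submodule R Ω := (J * V * U).comap (LinearMap.lsmul R Ω c)
  have hY : ∀ {y}, y ∈ Y ↔ c • y ∈ J * V * U := Iff.rfl
  have hAA := D.left_mul_left
  have hJVU : J * V * U ≤ D.left :=
    (mul_le_mul' ((mul_le_mul' hJA hVA).trans hAA) hUA).trans hAA
  have hcorner : ∀ X : Submodule R Ω, X ≤ D.left →
      D.InLeftCorner (X.comap (LinearMap.lsmul R Ω c)) := by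
    intro X hX
    refine ⟨fun x hx => D.smul_left_cancel hc ?_, fun x hx => D.smul_left_cancel hc ?_⟩
    · rw [← mul_smul_comm]
      exact D.e_mul_of_mem_left (hX hx)
    · rw [← smul_mul_assoc]
      exact D.mul_e_of_mem_left (hX hx)
  have hYc : D.InLeftCorner Y := hcorner _ hJVU
  have hYfg : Y.FG := D.fg_of_forall_smul_mem D.left_fg hc fun y hy => hJVU hy
  have hAY : D.left * Y ≤ Y := by
    rw [mul_le]
    intro a ha y hy
    rw [hY, ← mul_smul_comm]
    have h1 : D.left * (J * V * U) ≤ J * V * U := by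
      rw [← mul_assoc, ← mul_assoc]
      exact mul_le_mul_left (mul_le_mul_left hJ _) _
    exact h1 (mul_mem_mul ha hy)
  have hYA : Y * D.left ≤ Y := by
    rw [mul_le]
    intro y hy a ha
    rw [hY, ← smul_mul_assoc]
    have h1 : J * V * U * D.left ≤ J * V * U := by
      rw [mul_assoc (J * V)]
      exact mul_le_mul_right hU' _
    exact h1 (mul_mem_mul hy ha)
  have hYY : Y * Y ≤ saturate M Y := by
    rw [mul_le]
    intro y hy y' hy'
    have h1 : J * V * U * (J * V * U) ≤
        saturate M ((J * V * U).map (LinearMap.lsmul R Ω c)) := by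
      have h2 : J * V * U * (J * V * U) = J * V * (U * J * V) * U := by simp only [mul_assoc]
      have h3 : J * V * D.smulLeft c * U ≤ (J * V * U).map (LinearMap.lsmul R Ω c) := by
        have h4 : J * V * D.smulLeft c ≤ (J * V * D.left).map (LinearMap.lsmul R Ω c) := by
          rw [mul_le]
          rintro x hx _ ⟨a, ha, rfl⟩
          exact ⟨x * a, mul_mem_mul hx ha, (mul_smul_comm c x a).symm⟩
        refine (mul_le_mul_left h4 U).trans ?_
        rw [mul_le]
        rintro _ ⟨x, hx, rfl⟩ u hu
        refine ⟨x * u, ?_, (smul_mul_assoc c x u).symm⟩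
        have h5 : J * V * D.left * U ≤ J * V * U := by
          rw [mul_assoc (J * V)]
          exact mul_le_mul_right hU _
        exact h5 (mul_mem_mul hx hu)
      rw [h2]
      refine ((mul_le_mul_left (mul_le_saturate_left (Z := J * V) h) U).trans
        (mul_le_saturate le_rfl)).trans (saturate_mono h3)
    obtain ⟨s, hs, w, hw, hws⟩ := h1 (mul_mem_mul hy hy')
    refine ⟨s, hs, hY.2 ?_⟩
    have h2 : c • (s • y * y') = w := by
      refine D.smul_left_cancel hc ?_
      refine Eq.trans ?_ hws.symm
      change c • c • (s • y * y') = s • ((c • y) * (c • y'))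
      simp only [smul_mul_assoc, mul_smul_comm]
      rw [smul_comm s c, smul_comm s c]
    rw [← smul_mul_assoc, h2]
    exact hw
  have hYsat : Y ≤ saturate M D.left := by
    obtain ⟨s, hs, hsY⟩ := exists_forall_smul_mem (hYfg.mul hYfg) hYY
    let Y' := Y.map (LinearMap.lsmul R Ω s)
    have hY'Y : Y' ≤ Y := by
      rintro _ ⟨y, hy, rfl⟩
      exact Y.smul_mem s hy
    have hO := hmax (D.left ⊔ Y') (D.left_fg.sup (hYfg.map _)) le_sup_left ?_ ⟨?_, ?_⟩
    · intro y hy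
      exact mem_saturate_of_smul_mem hs (hO (mem_sup_right ⟨y, hy, rfl⟩))
    · rw [Submodule.mul_sup, Submodule.sup_mul, Submodule.sup_mul]
      refine sup_le (sup_le (hAA.trans le_sup_left) (le_trans ?_ le_sup_right))
        (sup_le (le_trans ?_ le_sup_right) (le_trans ?_ le_sup_right))
      · rw [mul_le]
        rintro _ ⟨y, hy, rfl⟩ a ha
        exact ⟨y * a, hYA (mul_mem_mul hy ha), (smul_mul_assoc s y a).symm⟩
      · rw [mul_le]
        rintro a ha _ ⟨y, hy, rfl⟩
        exact ⟨a * y, hAY (mul_mem_mul ha hy), (mul_smul_comm s a y).symm⟩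
      · rw [mul_le]
        rintro _ ⟨y, hy, rfl⟩ _ ⟨y', hy', rfl⟩
        refine ⟨s • (y * y'), hsY _ (mul_mem_mul hy hy'), ?_⟩
        simp only [LinearMap.lsmul_apply, smul_mul_assoc, mul_smul_comm]
    · intro x hx
      obtain ⟨a, ha, y, hy, rfl⟩ := mem_sup.1 hx
      rw [mul_add, D.e_mul_of_mem_left ha, hYc.e_mul y (hY'Y hy)]
    · intro x hx
      obtain ⟨a, ha, y, hy, rfl⟩ := mem_sup.1 hx
      rw [add_mul, D.mul_e_of_mem_left ha, hYc.mul_e y (hY'Y hy)]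
  have hX := hJsat ((V * U).comap (LinearMap.lsmul R Ω c))
    (hcorner _ ((mul_le_mul' hVA hUA).trans hAA)) (by
      refine le_trans ?_ hYsat
      rw [mul_le]
      intro j hj x hx
      rw [hY, ← mul_smul_comm, mul_assoc]
      exact mul_mem_mul hj hx)
  intro w hw
  obtain ⟨x, rfl⟩ := D.exists_smul_eq hc w
  obtain ⟨s, hs, hsx⟩ := hX hw
  exact ⟨s, hs, s • x, hsx, smul_comm c s x⟩

/-- Nakayama's lemma for right ideals of `A`. -/
lemma mem_saturate_of_sup [Module.Finite R A] (m : Ideal R) [hm : m.IsMaximal]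
    {J : Submodule R Ω} (hJ : J * D.left ≤ J) (h : D.i 1 ∈ saturate m.primeCompl (J ⊔ m • D.left)) :
    D.i 1 ∈ saturate m.primeCompl J := by
  have h1 : (J ⊔ m • D.left) * D.left ≤ J ⊔ m • D.left := by
    rw [Submodule.sup_mul]
    refine sup_le_sup hJ ?_
    rw [mul_le]
    intro x hx a ha
    induction hx using Submodule.smul_induction_on' with
    | smul r hr y hy =>
      rw [smul_mul_assoc]
      exact smul_mem_smul hr (D.left_mul_left (mul_mem_mul hy ha))
    | add x _ y _ hx hy => rw [add_mul]; exact add_mem hx hy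
  have h2 : D.left ≤ saturate m.primeCompl (J ⊔ m • D.left) := by
    intro a ha
    rw [← D.e_mul_of_mem_left ha]
    exact saturate_mono h1 (saturate_mul_saturate_le (mul_mem_mul h (le_saturate ha)))
  obtain ⟨s, hs, h3⟩ := exists_forall_smul_mem D.left_fg h2
  obtain ⟨u, z, hz, huz⟩ := hm.exists_inv hs
  have h4 : D.left ≤ J ⊔ m • D.left := by
    intro a ha
    have : a = u • (s • a) + z • a := by rw [smul_smul, ← add_smul, huz, one_smul]
    rw [this]
    exact add_mem (smul_mem _ _ (h3 a ha)) (mem_sup_right (smul_mem_smul hz ha))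
  obtain ⟨r, hr, hrJ⟩ := exists_sub_one_mem_and_smul_le_of_fg_of_le_sup D.left_fg le_rfl h4
  refine ⟨r, fun hrm => hm.ne_top ((Ideal.eq_top_iff_one _).2 ?_), hrJ ?_⟩
  · simpa using sub_mem hrm hr
  · exact smul_mem_pointwise_smul _ r _ (D.i_mem_left 1)

/-- An ideal `J` of an order that is maximal at `m` is trivial at `m` if it has no nontrivial right
multipliers into the order. -/
lemma IsMaximalAt.mem_saturate_of_forall_le [IsNoetherianRing R] [Module.Finite R A]
    (hdim : ringKrullDim R ≤ 1) (m : Ideal R) [hm : m.IsMaximal]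
    (hmax : D.IsMaximalAt m.primeCompl) {J : Submodule R Ω} (hJ : D.left * J ≤ J)
    (hJ' : J * D.left ≤ J) (hJA : J ≤ D.left) {c : R} (hc : c ∈ R⁰) (hcm : c ∈ m)
    (hJsat : ∀ X, D.InLeftCorner X → J * X ≤ saturate m.primeCompl D.left →
      X ≤ saturate m.primeCompl D.left) : D.i 1 ∈ saturate m.primeCompl J := by
  obtain ⟨N, hN, ⟨k, hk⟩, hNJ⟩ := exists_nilpotent_ideal (A := A) m
  obtain ⟨ε, hε, hεN⟩ := hNJ (J.comap D.i) fun a x hx => by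
    rw [mem_comap, D.i_mul]
    exact hJ (mul_mem_mul (D.i_mem_left a) hx)
  -- the complement `X` of `J` modulo the nilpotent ideal
  let X : Submodule R Ω :=
    { carrier := {x | x ∈ D.left ∧ ∀ y ∈ J, y * x ∈ N.map D.i}
      zero_mem' := ⟨zero_mem _, fun y _ => by rw [mul_zero]; exact zero_mem _⟩
      add_mem' := fun hx hy => ⟨add_mem hx.1 hy.1, fun z hz => by
        rw [mul_add]; exact add_mem (hx.2 z hz) (hy.2 z hz)⟩
      smul_mem' := fun r x hx => ⟨smul_mem _ r hx.1, fun z hz => by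
        rw [mul_smul_comm]; exact smul_mem _ r (hx.2 z hz)⟩ }
  have hXA : X ≤ D.left := fun x hx => hx.1
  have hAA := D.left_mul_left
  have hAX : D.left * X ≤ X := by
    rw [mul_le]
    intro a ha x hx
    refine ⟨hAA (mul_mem_mul ha hx.1), fun y hy => ?_⟩
    rw [← mul_assoc]
    exact hx.2 _ (hJ' (mul_mem_mul hy ha))
  have hXA' : X * D.left ≤ X := by
    rw [mul_le]
    rintro x hx _ ⟨a, rfl⟩
    refine ⟨hAA (mul_mem_mul hx.1 (D.i_mem_left a)), fun y hy => ?_⟩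
    obtain ⟨n, hn, hny⟩ := hx.2 y hy
    rw [← mul_assoc, ← hny, ← D.i_mul]
    exact mem_map_of_mem (hN a n hn).2
  have heX : D.i 1 ∈ J ⊔ X := by
    have h1 : D.i (1 - ε) ∈ X := by
      refine ⟨D.i_mem_left _, fun y hy => ?_⟩
      obtain ⟨b, rfl⟩ := hJA hy
      rw [← D.i_mul]
      exact mem_map_of_mem (hεN b hy)
    have h2 : D.i 1 = D.i ε + D.i (1 - ε) := by rw [← map_add, add_sub_cancel]
    rw [h2]
    exact add_mem (mem_sup_left hε) (mem_sup_right h1)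
  -- a power of `J X` is divisible by `c`
  have hpow : ∀ k, (J * X) ^ (k + 1) ≤ (N ^ (k + 1)).map D.i := by
    intro k
    induction k with
    | zero =>
      rw [zero_add, pow_one, pow_one, mul_le]
      exact fun y hy x hx => hx.2 y hy
    | succ k ih =>
      rw [pow_succ, pow_succ N]
      refine (mul_le_mul' ih (mul_le.2 fun y hy x hx => hx.2 y hy :
        J * X ≤ N.map D.i)).trans ?_
      rw [mul_le]
      rintro _ ⟨a, ha, rfl⟩ _ ⟨b, hb, rfl⟩
      exact ⟨a * b, mul_mem_mul ha hb, D.i_mul a b⟩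
  have hpow' : (J * X) ^ (k + 1) ≤ m • D.left := by
    refine (hpow k).trans ?_
    rw [map_le_iff_le_comap]
    have h1 : N ^ (k + 1) ≤ m • ⊤ := by
      rw [pow_succ, mul_le]
      intro x hx n _
      have h2 := hk hx
      clear hx
      induction h2 using Submodule.smul_induction_on' with
      | smul r hr y _ => rw [smul_mul_assoc]; exact smul_mem_smul hr trivial
      | add x _ y _ hx hy => rw [add_mul]; exact add_mem hx hy
    refine h1.trans ?_
    rw [← map_le_iff_le_comap, map_smul'', left, LinearMap.range_eq_map]
  obtain ⟨t, ht, K, hK⟩ := exists_notMem_forall_pow_mul_mem hdim m hc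
  have hpow'' : ∀ n, ((J * X) ^ (k + 1)) ^ (n + 1) ≤ m ^ (n + 1) • D.left := by
    intro n
    induction n with
    | zero => rwa [zero_add, pow_one, pow_one]
    | succ n ih =>
      rw [pow_succ]
      refine (mul_le_mul' ih hpow').trans ?_
      rw [mul_le]
      intro x hx y hy
      induction hx using Submodule.smul_induction_on' with
      | add x _ x' _ hx hx' => rw [add_mul]; exact add_mem hx hx'
      | smul r hr a ha =>
        induction hy using Submodule.smul_induction_on' with
        | add y _ y' _ hy hy' => rw [mul_add]; exact add_mem hy hy'
        | smul r' hr' a' ha' =>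
          rw [smul_mul_smul_comm, pow_succ m]
          exact smul_mem_smul (Ideal.mul_mem_mul hr hr') (hAA (mul_mem_mul ha ha'))
  obtain ⟨n, hn⟩ : ∃ n, (J * X) ^ (n + 1) ≤ saturate m.primeCompl (D.smulLeft c) := by
    refine ⟨k * K + k + K, ?_⟩
    have h1 : k * K + k + K + 1 = (k + 1) * (K + 1) := by ring
    rw [h1, pow_mul]
    intro x hx
    refine ⟨t, ht, ?_⟩
    have h2 := hpow'' K hx
    clear hx
    induction h2 using Submodule.smul_induction_on' with
    | add x _ y _ hx hy => rw [smul_add]; exact add_mem hx hy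
    | smul r hr a ha =>
      obtain ⟨q, hq⟩ := Ideal.mem_span_singleton'.1 (hK r (Ideal.pow_le_pow_right K.le_succ hr))
      exact ⟨q • a, smul_mem _ _ ha, by
        rw [LinearMap.lsmul_apply, smul_smul, smul_smul, ← hq, mul_comm]⟩
  -- by the cyclic shift `J` can be removed from the product
  have hXpow : ∀ b, X * (J * X) ^ b ≤ D.left := by
    intro b
    induction b with
    | zero => rwa [pow_zero, mul_one]
    | succ b ih =>
      rw [pow_succ, ← mul_assoc]
      exact (mul_le_mul' ih ((mul_le_mul' hJA hXA).trans hAA)).trans hAA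
  have hstart : X * (J * X) ^ n * D.left ≤ saturate m.primeCompl (D.smulLeft c) := by
    refine hmax.mul_le_of_mul_mul_le hJ hJA hJsat le_rfl hAA hAA (hXpow n) hc ?_
    refine (mul_le_mul_left hJ _).trans ?_
    rw [← mul_assoc, ← pow_succ']
    exact hn
  have hshift : ∀ b V, V ≤ D.left → X * (J * X) ^ b * V ≤ saturate m.primeCompl (D.smulLeft c) →
      X * (V * X ^ b) ≤ saturate m.primeCompl (D.smulLeft c) := by
    intro b
    induction b with
    | zero =>
      intro V _ h
      rwa [pow_zero, mul_one] at h ⊢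
    | succ b ih =>
      intro V hV h
      have h1 := hmax.mul_le_of_mul_mul_le hJ hJA hJsat hXA hAX hXA'
        (V := X * (J * X) ^ b * V) ((mul_le_mul' (hXpow b) hV).trans hAA) hc (by
          refine le_trans (le_of_eq ?_) h
          rw [pow_succ']
          simp only [mul_assoc])
      rw [mul_assoc] at h1
      have h2 := ih (V * X) ((mul_le_mul' hV hXA).trans hAA) h1
      rwa [mul_assoc, ← pow_succ'] at h2
  have hXn : X ^ (n + 1) ≤ saturate m.primeCompl (D.smulLeft c) := by
    refine le_trans ?_ (hshift n D.left le_rfl hstart)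
    rw [pow_succ', ← mul_assoc]
    refine mul_le_mul_left (fun x hx => ?_) _
    rw [← D.mul_e_of_mem_left hx.1]
    exact mul_mem_mul hx (D.i_mem_left 1)
  have hfin : ∀ n, D.i 1 ∈ J ⊔ X ^ (n + 1) ∧ X ^ (n + 1) ≤ D.left := by
    intro n
    induction n with
    | zero => exact ⟨by rwa [zero_add, pow_one], by rwa [zero_add, pow_one]⟩
    | succ n ih =>
      refine ⟨?_, ?_⟩
      · have h1 : (J ⊔ X ^ (n + 1)) * (J ⊔ X) ≤ J ⊔ X ^ (n + 1 + 1) := by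
          rw [Submodule.mul_sup, Submodule.sup_mul, Submodule.sup_mul, pow_succ X (n + 1)]
          refine sup_le (sup_le ?_ ?_) (sup_le ?_ ?_)
          · exact ((mul_le_mul_left hJA _).trans hJ).trans le_sup_left
          · exact ((mul_le_mul_left ih.2 _).trans hJ).trans le_sup_left
          · exact ((mul_le_mul_right hXA _).trans hJ').trans le_sup_left
          · exact le_sup_right
        rw [← D.e_mul_e]
        exact h1 (mul_mem_mul ih.1 heX)
      · rw [pow_succ]
        exact (mul_le_mul' ih.2 hXA).trans hAA
  refine mem_saturate_of_sup m hJ' ?_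
  have h1 : J ⊔ X ^ (n + 1) ≤ saturate m.primeCompl (J ⊔ m • D.left) := by
    refine sup_le (le_sup_left.trans le_saturate) (hXn.trans (saturate_mono ?_))
    rintro _ ⟨a, ha, rfl⟩
    exact mem_sup_right (smul_mem_smul hcm ha)
  exact h1 (hfin n).1

variable {L : Submodule R Ω}

lemma IsLattice.mul_left (hL : D.IsLattice L) : L * D.dual L * D.left ≤ L * D.dual L := by
  rw [mul_assoc]
  exact mul_le_mul_right hL.dual_mul_left _

/-- Over orders that are maximal at `m`, all lattices are invertible at `m`. -/
theorem IsLattice.isInvertibleAt_of_isMaximalAt [IsNoetherianRing R] [Module.Finite R A]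
    [Module.Finite R B] (hdim : ringKrullDim R ≤ 1) (m : Ideal R) [hm : m.IsMaximal]
    (hA : D.IsMaximalAt m.primeCompl) (hB : D.symm.IsMaximalAt m.primeCompl) {c : R}
    (hc : c ∈ R⁰) (hcm : c ∈ m) (hL : D.IsLattice L) : D.IsInvertibleAt m.primeCompl L := by
  have hdual := hL.dual
  have he : D.i 1 ∈ saturate m.primeCompl (L * D.dual L) := by
    refine hA.mem_saturate_of_forall_le hdim m ?_ hL.mul_left mul_dual_le hc hcm ?_
    · rw [← mul_assoc]
      exact mul_le_mul_left hL.left_mul _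
    · intro X hX hLX
      -- `dual L * X` is contained in `dual L` at `m`
      have h1 : D.dual L * X ≤ saturate m.primeCompl (D.dual L) := by
        have h2 : L * (D.dual L * X) ≤ saturate m.primeCompl D.left := by rwa [← mul_assoc]
        intro z hz
        have hz1 : D.j 1 * z = z := forall_mul_eq_of_mul inCorner_dual.e_mul z hz
        have hz2 : z * D.i 1 = z := forall_eq_mul_of_mul hX.mul_e z hz
        refine mem_saturate_dual hL.fg hz1 hz2 (fun y hy => h2 (mul_mem_mul hy hz)) fun y hy => ?_
        refine hL.mem_saturate_right hB ?_ ?_ fun y' hy' => ?_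
        · rw [← mul_assoc, hz1]
        · rw [mul_assoc, hL.mul_f y hy]
        · rw [← mul_assoc]
          exact saturate_mono hL.left_mul
            (mul_le_saturate h2 (mul_mem_mul (mul_mem_mul hy' hz) hy))
      intro x hx
      exact hdual.mem_saturate_right hA (hX.e_mul x hx) (hX.mul_e x hx) fun y hy =>
        h1 (mul_mem_mul hy hx)
  refine ⟨he, hB.mem_saturate_of_forall_le (J := D.dual L * L) hdim m ?_ ?_ dual_mul_le hc hcm ?_⟩
  · rw [← mul_assoc]
    exact mul_le_mul_left hdual.left_mul _
  · rw [mul_assoc]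
    exact mul_le_mul_right hL.mul_right _
  · intro X hX hLX x hx
    refine hL.mem_saturate_right hB (hX.e_mul x hx) (hX.mul_e x hx) fun y hy => ?_
    have h1 : L * D.dual L * (L * X) ≤ saturate m.primeCompl L := by
      have h2 : L * D.dual L * (L * X) = L * (D.dual L * L * X) := by simp only [mul_assoc]
      rw [h2]
      exact (mul_le_saturate_left hLX).trans (saturate_mono hL.mul_right)
    have h2 : D.i 1 * (y * x) ∈ saturate m.primeCompl (L * D.dual L * (L * X)) :=
      mul_le_saturate le_rfl (mul_mem_mul he (mul_mem_mul hy hx))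
    rw [← mul_assoc (D.i 1), hL.e_mul y hy] at h2
    exact saturate_le_saturate h1 h2

end RationalLinking

end

/-! ### Gluing of lattices -/

section

open nonZeroDivisors Submodule

namespace RationalLinking

variable {R : Type*} [CommRing R] {A B Ω : Type*} [Ring A] [Algebra R A]
    [Ring B] [Algebra R B] [Ring Ω] [Algebra R Ω]

variable {D : RationalLinking R A B Ω} {L L' : Submodule R Ω}

lemma IsLattice.le_saturate (hL : D.IsLattice L) (hL' : D.InCorner L') : L' ≤ saturate R⁰ L := by
  intro x hx
  rw [← hL'.mul_f x hx, ← hL'.e_mul x hx]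
  exact hL.full x

/-- Whether a lattice is invertible at a place depends only on its localization. -/
lemma IsInvertibleAt.of_le {M : Submonoid R} (h : D.IsInvertibleAt M L) (hL' : D.IsLattice L')
    (h1 : L ≤ saturate M L') (h2 : L' ≤ saturate M L) : D.IsInvertibleAt M L' := by
  have h3 : D.dual L ≤ saturate M (D.dual L') := by
    intro x hx
    obtain ⟨s, hs, h2⟩ := exists_forall_smul_mem hL'.fg h2
    refine mem_saturate_of_smul_mem hs (Submodule.le_saturate ⟨⟨?_, ?_⟩, fun y hy => ⟨?_, ?_⟩⟩)
    · rw [mul_smul_comm, hx.1.1]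
    · rw [smul_mul_assoc, hx.1.2]
    · rw [mul_smul_comm, ← smul_mul_assoc]
      exact (hx.2 _ (h2 y hy)).1
    · rw [smul_mul_assoc, ← mul_smul_comm]
      exact (hx.2 _ (h2 y hy)).2
  exact ⟨saturate_le_saturate ((mul_le_mul' h1 h3).trans saturate_mul_saturate_le) h.1,
    saturate_le_saturate ((mul_le_mul' h3 h1).trans saturate_mul_saturate_le) h.2⟩

variable [IsNoetherianRing R]

/-- A lattice is invertible at all but finitely many places. -/
lemma IsLattice.exists_forall_isInvertibleAt [Module.Finite R B] (hL : D.IsLattice L) :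
    ∃ c ∈ R⁰, ∀ (m : Ideal R) [m.IsPrime], c ∉ m → D.IsInvertibleAt m.primeCompl L := by
  obtain ⟨W, -, hW, he⟩ := hL.exists_e_mem
  obtain ⟨W', -, hW', hf⟩ := hL.exists_f_mem
  obtain ⟨c, hc, hce⟩ := saturate_le_saturate (mul_le_saturate_left
    (hL.dual.le_saturate hW) : L * W ≤ saturate R⁰ (L * D.dual L)) he
  obtain ⟨c', hc', hcf⟩ := saturate_le_saturate (mul_le_saturate
    (hL.dual.le_saturate hW') : W' * L ≤ saturate R⁰ (D.dual L * L)) hf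
  refine ⟨c * c', R⁰.mul_mem hc hc', fun m _ hm =>
    ⟨⟨c, fun h => hm ?_, hce⟩, c', fun h => hm ?_, hcf⟩⟩
  · exact Ideal.mul_mem_right _ _ h
  · exact Ideal.mul_mem_left _ _ h

/-- There is a lattice which agrees with `L'` at `m` and with `L` at all other places. -/
lemma IsLattice.exists_glue (hdim : ringKrullDim R ≤ 1) (hL : D.IsLattice L)
    (hL' : D.IsLattice L') (m : Ideal R) [hm : m.IsMaximal] :
    ∃ N, D.IsLattice N ∧ (L' ≤ saturate m.primeCompl N ∧ N ≤ saturate m.primeCompl L') ∧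
      ∀ (n : Ideal R) [n.IsMaximal], n ≠ m →
        L ≤ saturate n.primeCompl N ∧ N ≤ saturate n.primeCompl L := by
  obtain ⟨c, hc, hcL⟩ := exists_forall_smul_mem hL'.fg (hL.le_saturate hL'.toInCorner)
  obtain ⟨c', hc', hcL'⟩ := exists_forall_smul_mem hL.fg (hL'.le_saturate hL.toInCorner)
  obtain ⟨t, ht, k, hk⟩ := exists_notMem_forall_pow_mul_mem hdim m hc
  obtain ⟨t', ht', k', hk'⟩ := exists_notMem_forall_pow_mul_mem hdim m hc'
  -- the elements of `Ω` which lie in `L` away from `m`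
  let P : Submodule R Ω :=
    { carrier := {x | ∃ k, ∀ r ∈ m ^ k, r • x ∈ L}
      zero_mem' := ⟨0, fun r _ => by rw [smul_zero]; exact L.zero_mem⟩
      add_mem' := by
        rintro x y ⟨k, hk⟩ ⟨l, hl⟩
        refine ⟨k + l, fun r hr => ?_⟩
        rw [smul_add]
        exact L.add_mem (hk r (Ideal.pow_le_pow_right (Nat.le_add_right k l) hr))
          (hl r (Ideal.pow_le_pow_right (Nat.le_add_left l k) hr))
      smul_mem' := by
        rintro s x ⟨k, hk⟩
        exact ⟨k, fun r hr => by rw [smul_comm]; exact L.smul_mem s (hk r hr)⟩ }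
  let N := (L ⊔ L') ⊓ (saturate m.primeCompl L' ⊓ P)
  have hmul : ∀ {X Y : Submodule R Ω}, X * L ≤ L → X * P ≤ P := by
    intro X _ hX
    rw [mul_le]
    rintro a ha x ⟨k, hk⟩
    exact ⟨k, fun r hr => by rw [← mul_smul_comm]; exact hX (mul_mem_mul ha (hk r hr))⟩
  have hmul' : ∀ {X Y : Submodule R Ω}, L * X ≤ L → P * X ≤ P := by
    intro X _ hX
    rw [mul_le]
    rintro x ⟨k, hk⟩ a ha
    exact ⟨k, fun r hr => by rw [← smul_mul_assoc]; exact hX (mul_mem_mul (hk r hr) ha)⟩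
  have hNP : ∀ x ∈ L', t • x ∈ P := fun x hx => ⟨k, fun r hr => by
    obtain ⟨q, hq⟩ := Ideal.mem_span_singleton'.1 (hk r hr)
    rw [smul_smul, mul_comm, ← hq, mul_smul]
    exact L.smul_mem q (hcL x hx)⟩
  have hLP : L ≤ P := fun x hx => ⟨0, fun r _ => L.smul_mem r hx⟩
  refine ⟨N, ?_, ⟨?_, ?_⟩, fun n hn hne => ?_⟩
  · constructor
    · constructor
      · intro x hx
        obtain ⟨y, hy, z, hz, rfl⟩ := mem_sup.1 hx.1
        rw [mul_add, hL.e_mul y hy, hL'.e_mul z hz]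
      · intro x hx
        obtain ⟨y, hy, z, hz, rfl⟩ := mem_sup.1 hx.1
        rw [add_mul, hL.mul_f y hy, hL'.mul_f z hz]
    · exact D.fg_of_le (hL.fg.sup hL'.fg) inf_le_left
    · refine le_inf ?_ (le_inf ?_ ?_)
      · refine (mul_le_mul_right inf_le_left _).trans ?_
        rw [Submodule.mul_sup]
        exact sup_le_sup hL.left_mul hL'.left_mul
      · refine (mul_le_mul_right (inf_le_right.trans inf_le_left) _).trans ?_
        exact (mul_le_saturate_left le_rfl).trans (saturate_mono hL'.left_mul)
      · exact (mul_le_mul_right (inf_le_right.trans inf_le_right) _).trans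
          (hmul (Y := ⊥) hL.left_mul)
    · refine le_inf ?_ (le_inf ?_ ?_)
      · refine (mul_le_mul_left inf_le_left _).trans ?_
        rw [Submodule.sup_mul]
        exact sup_le_sup hL.mul_right hL'.mul_right
      · refine (mul_le_mul_left (inf_le_right.trans inf_le_left) _).trans ?_
        exact (mul_le_saturate le_rfl).trans (saturate_mono hL'.mul_right)
      · exact (mul_le_mul_left (inf_le_right.trans inf_le_right) _).trans
          (hmul' (Y := ⊥) hL.mul_right)
    · intro x
      obtain ⟨d, hd, hx⟩ := hL.full x
      refine ⟨c' * d, R⁰.mul_mem hc' hd, ?_⟩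
      rw [mul_smul]
      exact ⟨mem_sup_left (L.smul_mem _ hx), Submodule.le_saturate (hcL' _ hx),
        hLP (L.smul_mem _ hx)⟩
  · exact fun x hx => ⟨t, ht, L'.smul_mem t hx |> mem_sup_right,
      Submodule.le_saturate (L'.smul_mem t hx), hNP x hx⟩
  · exact inf_le_right.trans inf_le_left
  · have hnot : ∀ l, ∃ s ∈ m ^ l, s ∉ n := by
      intro l
      by_contra! h
      exact hne (hm.eq_of_le hn.ne_top (hn.isPrime.le_of_pow_le h)).symm
    constructor
    · intro x hx
      obtain ⟨s, hs, hsn⟩ := hnot k'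
      refine ⟨s, hsn, mem_sup_left (L.smul_mem s hx), ⟨t', ht', ?_⟩, hLP (L.smul_mem s hx)⟩
      obtain ⟨q, hq⟩ := Ideal.mem_span_singleton'.1 (hk' s hs)
      rw [smul_smul, ← hq, mul_smul]
      exact L'.smul_mem q (hcL' x hx)
    · rintro x ⟨-, -, l, hl⟩
      obtain ⟨s, hs, hsn⟩ := hnot l
      exact ⟨s, hsn, hl s hs⟩

/-- If there is an invertible lattice at every maximal ideal, there is a lattice which is invertible
everywhere. -/
theorem exists_isLattice_forall_isInvertibleAt [Module.Finite R A] [Module.Finite R B]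
    (hdim : ringKrullDim R ≤ 1)
    (h : ∀ m : MaximalSpectrum R, (∃ c ∈ R⁰, c ∈ m.asIdeal) →
      ∃ L, D.IsLattice L ∧ D.IsInvertibleAt m.asIdeal.primeCompl L) :
    ∃ L, D.IsLattice L ∧ ∀ m : MaximalSpectrum R, D.IsInvertibleAt m.asIdeal.primeCompl L := by
  classical
  obtain ⟨L, hL⟩ := D.exists_isLattice
  obtain ⟨c, hc, hcL⟩ := hL.exists_forall_isInvertibleAt
  let s := (finite_setOf_mem_maximalSpectrum hdim hc).toFinset
  have key : ∀ t ⊆ s, ∃ N, D.IsLattice N ∧ ∀ m : MaximalSpectrum R, m ∉ s \ t →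
      D.IsInvertibleAt m.asIdeal.primeCompl N := by
    intro t
    induction t using Finset.induction_on with
    | empty =>
      refine fun _ => ⟨L, hL, fun m hm => hcL m.asIdeal fun h => hm ?_⟩
      rw [Finset.sdiff_empty, Set.Finite.mem_toFinset]
      exact h
    | insert m t hmt ih =>
      intro hts
      obtain ⟨N, hN, hNinv⟩ := ih ((Finset.subset_insert m t).trans hts)
      have hms : m ∈ s := hts (Finset.mem_insert_self m t)
      obtain ⟨L', hL', hL'inv⟩ := h m
        ⟨c, hc, (finite_setOf_mem_maximalSpectrum hdim hc).mem_toFinset.1 hms⟩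
      obtain ⟨P, hP, ⟨h1, h2⟩, h3⟩ := hN.exists_glue hdim hL' m.asIdeal
      refine ⟨P, hP, fun n hn => ?_⟩
      by_cases hnm : n = m
      · subst hnm
        exact hL'inv.of_le hP h1 h2
      · obtain ⟨h4, h5⟩ := h3 n.asIdeal fun h => hnm (MaximalSpectrum.ext h)
        refine (hNinv n fun hn' => hn ?_).of_le hP h4 h5
        rw [Finset.mem_sdiff] at hn' ⊢
        exact ⟨hn'.1, fun h => (Finset.mem_insert.1 h).elim hnm hn'.2⟩
  obtain ⟨N, hN, hNinv⟩ := key s le_rfl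
  exact ⟨N, hN, fun m => hNinv m (by simp)⟩

end RationalLinking

end

/-! ### From lattices to linking algebras -/

section

open nonZeroDivisors Submodule

lemma Submodule.exists_sum_of_mem_mul {R E : Type*} [CommRing R] [Ring E] [Algebra R E]
    {X Y : Submodule R E} {z : E} (hz : z ∈ X * Y) :
    ∃ (n : ℕ) (x y : Fin n → E), (∀ k, x k ∈ X) ∧ (∀ k, y k ∈ Y) ∧ z = ∑ k, x k * y k := by
  induction hz using Submodule.mul_induction_on' with
  | mem_mul_mem x hx y hy => exact ⟨1, fun _ => x, fun _ => y, fun _ => hx, fun _ => hy, by simp⟩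
  | add z _ z' _ h h' =>
    obtain ⟨n, x, y, hx, hy, rfl⟩ := h
    obtain ⟨n', x', y', hx', hy', rfl⟩ := h'
    refine ⟨n + n', Fin.append x x', Fin.append y y', fun k => ?_, fun k => ?_, ?_⟩
    · induction k using Fin.addCases <;> simp [hx, hx']
    · induction k using Fin.addCases <;> simp [hy, hy']
    · simp [Fin.sum_univ_add]

lemma Submodule.mem_of_forall_mem_saturate {R E : Type*} [CommRing R] [AddCommGroup E]
    [Module R E] {X : Submodule R E} {x : E}
    (h : ∀ m : MaximalSpectrum R, x ∈ saturate m.asIdeal.primeCompl X) : x ∈ X := by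
  let I : Ideal R := X.comap (LinearMap.toSpanSingleton R E x)
  have hI : I = ⊤ := by
    by_contra hI
    obtain ⟨m, hm, hle⟩ := I.exists_le_maximal hI
    obtain ⟨s, hs, hsx⟩ := h ⟨m, hm⟩
    exact hs (hle hsx)
  have h1 : (1 : R) ∈ I := hI ▸ trivial
  simpa [I] using h1

namespace RationalLinking

variable {R : Type u} [CommRing R] {A B Ω : Type u} [Ring A] [Algebra R A]
    [Ring B] [Algebra R B] [Ring Ω] [Algebra R Ω]

variable {D : RationalLinking R A B Ω} {L : Submodule R Ω}

/-- The order in `Ω` with the entries `A`, `L`, `dual L` and `B`. -/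
def IsLattice.matrixOrder (hL : D.IsLattice L) : Subalgebra R Ω where
  carrier := {x | (D.i 1 * x * D.i 1 ∈ D.left ∧ D.i 1 * x * D.j 1 ∈ L) ∧
    D.j 1 * x * D.i 1 ∈ D.dual L ∧ D.j 1 * x * D.j 1 ∈ D.right}
  algebraMap_mem' r := by
    have h : ∀ x y : Ω, x * algebraMap R Ω r * y = r • (x * y) := fun x y => by
      rw [Algebra.algebraMap_eq_smul_one, mul_smul_comm, mul_one, smul_mul_assoc]
    refine ⟨⟨?_, ?_⟩, ?_, ?_⟩
    · rw [h, e_mul_e]; exact smul_mem _ r (D.i_mem_left 1)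
    · rw [h, e_mul_f, smul_zero]; exact zero_mem _
    · rw [h, f_mul_e, smul_zero]; exact zero_mem _
    · rw [h, f_mul_f]; exact smul_mem _ r (D.symm.i_mem_left 1)
  add_mem' := by
    rintro x y ⟨⟨h1, h2⟩, h3, h4⟩ ⟨⟨h1', h2'⟩, h3', h4'⟩
    refine ⟨⟨?_, ?_⟩, ?_, ?_⟩ <;> rw [mul_add, add_mul]
    · exact add_mem h1 h1'
    · exact add_mem h2 h2'
    · exact add_mem h3 h3'
    · exact add_mem h4 h4'
  mul_mem' := by
    rintro x y ⟨⟨h1, h2⟩, h3, h4⟩ ⟨⟨h1', h2'⟩, h3', h4'⟩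
    have h : ∀ u v : Ω, u * (x * y) * v = u * x * D.i 1 * (D.i 1 * y * v) +
        u * x * D.j 1 * (D.j 1 * y * v) := fun u v => by
      have h5 : u * (x * y) * v = u * x * (D.i 1 + D.j 1) * (y * v) := by
        rw [D.add_one, mul_one]; simp only [mul_assoc]
      have h6 : ∀ t, t * D.i 1 * D.i 1 = t * D.i 1 := fun t => by rw [mul_assoc, e_mul_e]
      have h7 : ∀ t, t * D.j 1 * D.j 1 = t * D.j 1 := fun t => by rw [mul_assoc, f_mul_f]
      rw [h5, mul_add, add_mul]
      simp only [← mul_assoc, h6, h7]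
    refine ⟨⟨?_, ?_⟩, ?_, ?_⟩ <;> rw [h]
    · exact add_mem (D.left_mul_left (mul_mem_mul h1 h1')) (mul_dual_le (mul_mem_mul h2 h3'))
    · exact add_mem (hL.left_mul (mul_mem_mul h1 h2')) (hL.mul_right (mul_mem_mul h2 h4'))
    · exact add_mem (hL.dual_mul_left (mul_mem_mul h3 h1')) (hL.right_mul_dual (mul_mem_mul h4 h3'))
    · exact add_mem (dual_mul_le (mul_mem_mul h3 h2')) (D.symm.left_mul_left (mul_mem_mul h4 h4'))

variable (D) in
/-- The compression of an element to the corner `A`. -/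
lemma exists_compression {O : Submodule R Ω} (hO : ∀ x ∈ O, D.i 1 * x * D.i 1 ∈ D.left) :
    ∃ p : O →ₗ[R] A, ∀ x : O, D.i (p x) = D.i 1 * x * D.i 1 := by
  let c : O →ₗ[R] D.left := LinearMap.codRestrict D.left
    (LinearMap.mulRight R (D.i 1) ∘ₗ LinearMap.mulLeft R (D.i 1) ∘ₗ O.subtype)
    fun x => hO x x.2
  let ε := LinearEquiv.ofInjective D.i D.i_injective
  refine ⟨ε.symm.toLinearMap ∘ₗ c, fun x => ?_⟩
  exact congrArg Subtype.val (ε.apply_symm_apply (c x))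

lemma IsLattice.mem_matrixOrder_of_mem_left (hL : D.IsLattice L) {x : Ω} (hx : x ∈ D.left) :
    x ∈ hL.matrixOrder := by
  have h1 := D.e_mul_of_mem_left hx
  have h2 := D.mul_e_of_mem_left hx
  have h3 : x * D.j 1 = 0 := by rw [← h2, mul_assoc, e_mul_f, mul_zero]
  have h4 : D.j 1 * x = 0 := by rw [← h1, ← mul_assoc, f_mul_e, zero_mul]
  refine ⟨⟨?_, ?_⟩, ?_, ?_⟩
  · rwa [h1, h2]
  · rw [h1, h3]; exact zero_mem _
  · rw [h4, zero_mul]; exact zero_mem _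
  · rw [h4, zero_mul]; exact zero_mem _

lemma IsLattice.mem_matrixOrder_of_mem_right (hL : D.IsLattice L) {x : Ω} (hx : x ∈ D.right) :
    x ∈ hL.matrixOrder := by
  have h1 : D.j 1 * x = x := D.symm.e_mul_of_mem_left hx
  have h2 : x * D.j 1 = x := D.symm.mul_e_of_mem_left hx
  have h3 : x * D.i 1 = 0 := by rw [← h2, mul_assoc, f_mul_e, mul_zero]
  have h4 : D.i 1 * x = 0 := by rw [← h1, ← mul_assoc, e_mul_f, zero_mul]
  refine ⟨⟨?_, ?_⟩, ?_, ?_⟩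
  · rw [h4, zero_mul]; exact zero_mem _
  · rw [h4, zero_mul]; exact zero_mem _
  · rw [mul_assoc, h3, mul_zero]; exact zero_mem _
  · rwa [h1, h2]

lemma IsLattice.mem_matrixOrder (hL : D.IsLattice L) {x : Ω} (hx : x ∈ L) :
    x ∈ hL.matrixOrder := by
  have h1 := hL.e_mul x hx
  have h2 := hL.mul_f x hx
  have h3 : x * D.i 1 = 0 := by rw [← h2, mul_assoc, f_mul_e, mul_zero]
  have h4 : D.j 1 * x = 0 := by rw [← h1, ← mul_assoc, f_mul_e, zero_mul]
  refine ⟨⟨?_, ?_⟩, ?_, ?_⟩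
  · rw [mul_assoc, h3, mul_zero]; exact zero_mem _
  · rwa [h1, h2]
  · rw [h4, zero_mul]; exact zero_mem _
  · rw [h4, zero_mul]; exact zero_mem _

lemma IsLattice.mem_matrixOrder_of_mem_dual (hL : D.IsLattice L) {x : Ω} (hx : x ∈ D.dual L) :
    x ∈ hL.matrixOrder := by
  have h1 := hx.1.1
  have h2 := hx.1.2
  have h3 : x * D.j 1 = 0 := by rw [← h2, mul_assoc, e_mul_f, mul_zero]
  have h4 : D.i 1 * x = 0 := by rw [← h1, ← mul_assoc, e_mul_f, zero_mul]
  refine ⟨⟨?_, ?_⟩, ?_, ?_⟩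
  · rw [h4, zero_mul]; exact zero_mem _
  · rw [h4, zero_mul]; exact zero_mem _
  · rwa [h1, h2]
  · rw [mul_assoc, h3, mul_zero]; exact zero_mem _

/-- A lattice that is invertible everywhere is an invertible bimodule. -/
theorem IsLattice.isMoritaEquivalent (hL : D.IsLattice L)
    (hinv : ∀ m : MaximalSpectrum R, D.IsInvertibleAt m.asIdeal.primeCompl L) :
    IsMoritaEquivalent R A B := by
  let O := hL.matrixOrder
  obtain ⟨p, hp⟩ := D.exists_compression (O := O.toSubmodule) fun x hx => hx.1.1
  obtain ⟨q, hq⟩ := D.symm.exists_compression (O := O.toSubmodule) fun x hx => hx.2.2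
  obtain ⟨n, x, y, hx, hy, hxy⟩ := exists_sum_of_mem_mul
    (mem_of_forall_mem_saturate fun m => (hinv m).1)
  obtain ⟨n', x', y', hx', hy', hxy'⟩ := exists_sum_of_mem_mul
    (mem_of_forall_mem_saturate fun m => (hinv m).2)
  let i : A →ₗ[R] O := LinearMap.codRestrict O.toSubmodule D.i
    fun a => hL.mem_matrixOrder_of_mem_left (D.i_mem_left a)
  let j : B →ₗ[R] O := LinearMap.codRestrict O.toSubmodule D.j
    fun b => hL.mem_matrixOrder_of_mem_right (D.symm.i_mem_left b)
  let l : Linking R A B O :=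
    { i := i
      p := p
      j := j
      q := q
      i_mul := fun a a' => Subtype.ext (D.i_mul a a')
      j_mul := fun b b' => Subtype.ext (D.j_mul b b')
      p_i := fun a => D.i_injective (by
        rw [hp]
        change D.i 1 * D.i a * D.i 1 = D.i a
        rw [← D.i_mul, ← D.i_mul, one_mul, mul_one])
      q_j := fun b => D.j_injective (by
        refine (hq _).trans ?_
        change D.j 1 * D.j b * D.j 1 = D.j b
        rw [← D.j_mul, ← D.j_mul, one_mul, mul_one])
      i_p := fun x => Subtype.ext (hp x)
      j_q := fun x => Subtype.ext (hq x)
      add_one := Subtype.ext D.add_one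
      full_left := by
        refine ⟨n, fun k => ⟨x k, hL.mem_matrixOrder (hx k)⟩,
          fun k => ⟨y k, hL.mem_matrixOrder_of_mem_dual (hy k)⟩, Subtype.ext ?_⟩
        rw [AddSubmonoidClass.coe_finsetSum]
        refine hxy.trans (Finset.sum_congr rfl fun k _ => ?_)
        exact congrArg (· * y k) (hL.mul_f _ (hx k)).symm
      full_right := by
        refine ⟨n', fun k => ⟨x' k, hL.mem_matrixOrder_of_mem_dual (hx' k)⟩,
          fun k => ⟨y' k, hL.mem_matrixOrder (hy' k)⟩, Subtype.ext ?_⟩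
        rw [AddSubmonoidClass.coe_finsetSum]
        refine hxy'.trans (Finset.sum_congr rfl fun k _ => ?_)
        exact congrArg (· * y' k) (hx' k).1.2.symm }
  exact l.isMoritaEquivalent

end RationalLinking

end

/-! ### Orders in the rational envelope -/

section

open nonZeroDivisors Submodule

lemma IsSemisimpleRing.exists_mul_mul_eq (K : Type*) [CommRing K] [IsSemisimpleRing K] (x : K) :
    ∃ k, x * x * k = x := by
  obtain ⟨ε, hε, h⟩ := IsSemisimpleRing.ideal_eq_span_idempotent (Ideal.span {x})
  obtain ⟨k, hk⟩ := Ideal.mem_span_singleton'.1 (h ▸ Ideal.mem_span_singleton_self ε)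
  obtain ⟨q, hq⟩ := Ideal.mem_span_singleton'.1 (h ▸ Ideal.mem_span_singleton_self x)
  refine ⟨k, ?_⟩
  calc x * x * k = x * (k * x) := by ring
    _ = q * (ε * ε) := by rw [hk, ← hq]; ring
    _ = x := by rw [hε.eq, hq]

instance isLocalizedModule_tensorProduct {R : Type*} [CommRing R] (M : Submonoid R) (S : Type*)
    [CommRing S] [Algebra R S] [IsLocalization M S] (N : Type*) [AddCommGroup N] [Module R N] :
    IsLocalizedModule M (TensorProduct.mk R S N 1) :=
  (isLocalizedModule_iff_isBaseChange M S _).2 (TensorProduct.isBaseChange R N S)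

variable {R : Type u} [CommRing R] {A B Ω : Type u} [Ring A] [Algebra R A]
    [Ring B] [Algebra R B] [Ring Ω] [Algebra R Ω] [Algebra (FractionRing R) Ω]
    [IsScalarTower R (FractionRing R) Ω]

lemma one_tmul_injective [Module.IsTorsionFree R A] (S : Type*) [CommRing S] [Algebra R S]
    [IsLocalization R⁰ S] : Function.Injective (fun a : A => (1 : S) ⊗ₜ[R] a) := by
  intro a b h
  obtain ⟨c, hc⟩ := (IsLocalizedModule.eq_iff_exists R⁰ (TensorProduct.mk R S A 1)).1 h
  exact Module.IsTorsionFree.isSMulRegular (isRegular_iff_mem_nonZeroDivisors.2 c.2) hc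

/-- A linking algebra of the rational envelopes contains the original orders. -/
def Linking.toRationalLinking [Module.IsTorsionFree R A] [Module.IsTorsionFree R B]
    (l : Linking (FractionRing R) (RationalEnvelope R A) (RationalEnvelope R B) Ω) :
    RationalLinking R A B Ω where
  i := l.i.restrictScalars R ∘ₗ TensorProduct.mk R (FractionRing R) A 1
  j := l.j.restrictScalars R ∘ₗ TensorProduct.mk R (FractionRing R) B 1
  i_mul a a' := by
    change l.i (1 ⊗ₜ (a * a')) = l.i (1 ⊗ₜ a) * l.i (1 ⊗ₜ a')
    rw [← l.i_mul, Algebra.TensorProduct.tmul_mul_tmul, one_mul]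
  j_mul b b' := by
    change l.j (1 ⊗ₜ (b * b')) = l.j (1 ⊗ₜ b) * l.j (1 ⊗ₜ b')
    rw [← l.j_mul, Algebra.TensorProduct.tmul_mul_tmul, one_mul]
  i_injective := l.i_injective.comp (one_tmul_injective (FractionRing R))
  j_injective := l.j_injective.comp (one_tmul_injective (FractionRing R))
  add_one := l.add_one
  isUnit c hc := by
    rw [IsScalarTower.algebraMap_apply R (FractionRing R) Ω]
    exact (IsLocalization.map_units (FractionRing R) (⟨c, hc⟩ : R⁰)).map _
  left_full x := by
    obtain ⟨⟨a, c⟩, h⟩ :=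
      IsLocalizedModule.surj R⁰ (TensorProduct.mk R (FractionRing R) A 1) (l.p x)
    refine ⟨c, c.2, a, ?_⟩
    change l.i (1 ⊗ₜ a) = (c : R) • (l.i 1 * x * l.i 1)
    rw [← l.i_p]
    refine (congrArg l.i h).symm.trans ?_
    exact (l.i.restrictScalars R).map_smul c (l.p x)
  right_full x := by
    obtain ⟨⟨b, c⟩, h⟩ :=
      IsLocalizedModule.surj R⁰ (TensorProduct.mk R (FractionRing R) B 1) (l.q x)
    refine ⟨c, c.2, b, ?_⟩
    change l.j (1 ⊗ₜ b) = (c : R) • (l.j 1 * x * l.j 1)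
    rw [← l.j_q]
    refine (congrArg l.j h).symm.trans ?_
    exact (l.j.restrictScalars R).map_smul c (l.q x)
  full_left := l.full_left
  full_right := l.full_right

section Localization

variable (m : Ideal R) [m.IsPrime] (S : Type u) [CommRing S] [Algebra R S]
    [IsLocalization.AtPrime S m]

include m in
lemma isUnit_algebraMap_fractionRing_localization {c : R} (hc : c ∈ R⁰) :
    IsUnit (algebraMap R (FractionRing S) c) := by
  rw [IsScalarTower.algebraMap_apply R S (FractionRing S)]
  exact IsLocalization.map_units (FractionRing S) (⟨_, IsLocalization.map_nonZeroDivisors_le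
    m.primeCompl S (Submonoid.mem_map_of_mem _ hc)⟩ : S⁰)

variable (A) in
/-- The map from the rational envelope of `A` to the rational envelope of its localization. -/
noncomputable def toRationalEnvelopeLocalization :
    RationalEnvelope R A →ₐ[R] RationalEnvelope S (S ⊗[R] A) :=
  Algebra.TensorProduct.lift
    ((Algebra.TensorProduct.includeLeft : FractionRing S →ₐ[R] RationalEnvelope S (S ⊗[R] A)).comp
      (IsLocalization.liftAlgHom (M := R⁰) (f := Algebra.ofId R (FractionRing S))
        fun c => isUnit_algebraMap_fractionRing_localization m S c.2))
    (((Algebra.TensorProduct.includeRight :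
        S ⊗[R] A →ₐ[S] RationalEnvelope S (S ⊗[R] A)).restrictScalars R).comp
      Algebra.TensorProduct.includeRight)
    fun x y => by
      simp [Commute, SemiconjBy]

lemma toRationalEnvelopeLocalization_one_tmul (a : A) :
    toRationalEnvelopeLocalization A m S (1 ⊗ₜ a) = 1 ⊗ₜ (1 ⊗ₜ a) := by
  refine (Algebra.TensorProduct.lift_tmul _ _ _ _ _).trans ?_
  rw [map_one, one_mul]
  rfl

/-- Since the total ring of fractions is von Neumann regular, regular elements of `R_m` come from
regular elements of `R`; so the kernel consists of the elements that vanish at `m`. -/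
lemma exists_smul_eq_zero_of_toRationalEnvelopeLocalization_eq_zero [IsNoetherianRing R]
    [IsReduced R] [Module.IsTorsionFree R A] {y : RationalEnvelope R A}
    (hy : toRationalEnvelopeLocalization A m S y = 0) : ∃ s ∉ m, s • y = 0 := by
  obtain ⟨⟨a, c⟩, h⟩ := IsLocalizedModule.surj R⁰ (TensorProduct.mk R (FractionRing R) A 1) y
  change (c : R) • y = 1 ⊗ₜ a at h
  have h1 : (1 : FractionRing S) ⊗ₜ[S] ((1 : S) ⊗ₜ[R] a) = 0 := by
    rw [← toRationalEnvelopeLocalization_one_tmul m S, ← h, map_smul, hy, smul_zero]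
  obtain ⟨r, hr⟩ := (IsLocalizedModule.eq_zero_iff S⁰
    (TensorProduct.mk S (FractionRing S) (S ⊗[R] A) 1)).1 h1
  obtain ⟨r₀, t, hrt⟩ := IsLocalization.exists_mk'_eq m.primeCompl (r : S)
  have hr₀ : (algebraMap R S r₀) ∈ S⁰ := by
    rw [← IsLocalization.mk'_spec S r₀ t, hrt]
    exact mul_mem r.2 (IsUnit.mem_nonZeroDivisors (IsLocalization.map_units S t))
  have h2 : (1 : S) ⊗ₜ[R] (r₀ • a) = 0 := by
    have h3 : (r : S) • ((1 : S) ⊗ₜ[R] a) = 0 := hr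
    have h4 : algebraMap R S r₀ • ((1 : S) ⊗ₜ[R] a) = 0 := by
      rw [← IsLocalization.mk'_spec S r₀ t, hrt, mul_comm, mul_smul, h3, smul_zero]
    rwa [algebraMap_smul, ← TensorProduct.tmul_smul] at h4
  obtain ⟨s, hs⟩ := (IsLocalizedModule.eq_zero_iff m.primeCompl (TensorProduct.mk R S A 1)).1 h2
  change (s : R) • r₀ • a = 0 at hs
  obtain ⟨k, hk⟩ := IsSemisimpleRing.exists_mul_mul_eq (FractionRing R)
    (algebraMap R (FractionRing R) r₀)
  obtain ⟨b, d, rfl⟩ := IsLocalization.exists_mk'_eq R⁰ k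
  have h5 : r₀ * r₀ * b = r₀ * d := by
    apply IsFractionRing.injective R (FractionRing R)
    rw [map_mul, map_mul, map_mul, ← IsLocalization.mk'_spec (FractionRing R) b d, ← mul_assoc, hk]
  have h6 : algebraMap R S (r₀ * b) = algebraMap R S d := by
    refine (mul_cancel_left_mem_nonZeroDivisors hr₀).1 ?_
    rw [← map_mul, ← map_mul, ← mul_assoc, h5]
  obtain ⟨s', hs'⟩ := (IsLocalization.eq_iff_exists m.primeCompl S).1 h6
  have h7 : ((s : R) * s') • a = 0 := by
    refine (Module.IsTorsionFree.isSMulRegular (isRegular_iff_mem_nonZeroDivisors.2 d.2) :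
      IsSMulRegular A (d : R)) ?_
    change (d : R) • ((s : R) * s') • a = (d : R) • (0 : A)
    have h8 : (d : R) * ((s : R) * s') = b * s' * (s * r₀) := by
      calc (d : R) * ((s : R) * s') = s * (s' * d) := by ring
        _ = b * s' * (s * r₀) := by rw [← hs']; ring
    rw [smul_smul, h8, mul_smul (b * s' : R), mul_smul (s : R), hs, smul_zero, smul_zero]
  refine ⟨s * s', m.primeCompl.mul_mem s.2 s'.2, ?_⟩
  have h8 : (c : R) • (((s : R) * s') • y) = 0 := by
    rw [smul_comm, h, ← TensorProduct.tmul_smul, h7, TensorProduct.tmul_zero]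
  rw [← algebraMap_smul (FractionRing R)] at h8
  exact (IsLocalization.map_units (FractionRing R) c).smul_eq_zero.1 h8

/-- Maximality of the localization `A_m`, expressed without localization. -/
theorem Linking.isMaximalAt [IsNoetherianRing R] [IsReduced R] [Module.Finite R A]
    [Module.IsTorsionFree R A] [Module.IsTorsionFree R B]
    (l : Linking (FractionRing R) (RationalEnvelope R A) (RationalEnvelope R B) Ω)
    (h : IsMaximalOrder S (S ⊗[R] A)) : l.toRationalLinking.IsMaximalAt m.primeCompl := by
  rw [isMaximalOrder_iff] at h
  intro O hfg hle hmul hcorner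
  let φ := toRationalEnvelopeLocalization A m S
  let P : Submodule R (RationalEnvelope R A) := O.comap (l.i.restrictScalars R)
  have hPmap : ∀ x ∈ O, l.p x ∈ P := fun x hx => by
    change l.i (l.p x) ∈ O
    have h1 := hcorner.mul_e x hx
    have h2 := hcorner.e_mul x hx
    change x * l.i 1 = x at h1
    change l.i 1 * x = x at h2
    rwa [l.i_p, h2, h1]
  have hPfg : P.FG := by
    have h1 : P = O.map (l.p.restrictScalars R) := by
      ext z
      constructor
      · exact fun hz => ⟨l.i z, hz, l.p_i z⟩
      · rintro ⟨x, hx, rfl⟩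
        exact hPmap x hx
    rw [h1]
    exact hfg.map _
  have hPle : ∀ a : A, 1 ⊗ₜ a ∈ P := fun a => hle ⟨a, rfl⟩
  have hPmul : ∀ x ∈ P, ∀ y ∈ P, x * y ∈ P := fun x hx y hy => by
    change l.i (x * y) ∈ O
    rw [l.i_mul]
    exact hmul (mul_mem_mul hx hy)
  let Q : Submodule S (RationalEnvelope S (S ⊗[R] A)) := span S (φ '' P)
  have hQ1 : ∀ a : A, (1 : FractionRing S) ⊗ₜ[S] ((1 : S) ⊗ₜ[R] a) ∈ Q := fun a => by
    rw [← toRationalEnvelopeLocalization_one_tmul m S]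
    exact subset_span ⟨_, hPle a, rfl⟩
  have hQ : ∀ w : S ⊗[R] A, (1 : FractionRing S) ⊗ₜ[S] w ∈ Q := by
    intro w
    induction w using TensorProduct.induction_on with
    | zero => rw [TensorProduct.tmul_zero]; exact zero_mem _
    | add w w' hw hw' => rw [TensorProduct.tmul_add]; exact add_mem hw hw'
    | tmul r a =>
      have h1 : r ⊗ₜ[R] a = r • ((1 : S) ⊗ₜ[R] a) := by simp [TensorProduct.smul_tmul']
      rw [h1, TensorProduct.tmul_smul]
      exact smul_mem _ r (hQ1 a)
  have hQmul : ∀ x y, x ∈ Q → y ∈ Q → x * y ∈ Q := by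
    intro x y hx hy
    have h1 := mul_mem_mul hx hy
    rw [span_mul_span] at h1
    refine span_mono ?_ h1
    rintro _ ⟨_, ⟨z, hz, rfl⟩, _, ⟨w, hw, rfl⟩, rfl⟩
    exact ⟨z * w, hPmul z hz w hw, map_mul φ z w⟩
  have hQfg : Q.FG := by
    obtain ⟨s, hs⟩ := hPfg
    classical
    refine ⟨s.image φ, le_antisymm (span_mono ?_) (span_le.2 ?_)⟩
    · rw [Finset.coe_image]
      exact Set.image_mono (hs ▸ subset_span)
    · rintro _ ⟨z, hz, rfl⟩
      have hz' : z ∈ span R (s : Set (RationalEnvelope R A)) := hs ▸ hz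
      clear hz
      rw [Finset.coe_image]
      induction hz' using span_induction with
      | mem z hz => exact subset_span ⟨z, hz, rfl⟩
      | zero => rw [map_zero]; exact zero_mem _
      | add z w _ _ hz hw => rw [map_add]; exact add_mem hz hw
      | smul r z _ hz =>
        rw [map_smul, ← algebraMap_smul S]
        exact smul_mem _ _ hz
  have hmax := h (Q.toSubalgebra (hQ 1) hQmul) (Module.Finite.iff_fg.2 hQfg) (by
    rintro _ ⟨w, rfl⟩
    exact hQ w)
  intro x hx
  obtain ⟨w, hw⟩ := hmax (subset_span ⟨l.p x, hPmap x hx, rfl⟩ : φ (l.p x) ∈ Q)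
  change (1 : FractionRing S) ⊗ₜ[S] w = φ (l.p x) at hw
  obtain ⟨⟨a, s⟩, hs⟩ := IsLocalizedModule.surj m.primeCompl (TensorProduct.mk R S A 1) w
  change (s : R) • w = (1 : S) ⊗ₜ[R] a at hs
  have h1 : φ ((s : R) • l.p x - 1 ⊗ₜ a) = 0 := by
    rw [map_sub, map_smul, ← hw, toRationalEnvelopeLocalization_one_tmul, ← hs, sub_eq_zero,
      ← algebraMap_smul S (s : R) w, TensorProduct.tmul_smul, algebraMap_smul]
  obtain ⟨s', hs', h2⟩ := exists_smul_eq_zero_of_toRationalEnvelopeLocalization_eq_zero m S h1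
  refine ⟨s' * s, m.primeCompl.mul_mem hs' s.2, s' • a, ?_⟩
  rw [smul_sub, sub_eq_zero, smul_smul] at h2
  change l.i (1 ⊗ₜ (s' • a)) = (s' * (s : R)) • x
  rw [TensorProduct.tmul_smul, ← h2]
  refine ((l.i.restrictScalars R).map_smul _ _).trans ?_
  change (s' * (s : R)) • l.i (l.p x) = _
  rw [l.i_p]
  have h3 := hcorner.mul_e x hx
  have h4 := hcorner.e_mul x hx
  change x * l.i 1 = x at h3
  change l.i 1 * x = x at h4
  rw [h4, h3]

end Localization

end

/-! ### Descent of lattices along a comparison -/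

section

open nonZeroDivisors Submodule

namespace RationalLinking

variable {R : Type*} [CommRing R] {A B Ω : Type*} [Ring A] [Algebra R A]
    [Ring B] [Algebra R B] [Ring Ω] [Algebra R Ω]

/-- A comparison of a rational linking algebra `Ω` with a linking algebra `O` of the completions of
`A` and `B` at `m`: both map to a common algebra `E`, in a way that is compatible with the maps from
`A` and `B`. The remaining fields record the properties of the completion which are needed to
descend lattices from `O` to `Ω`. -/
structure Comparison (D : RationalLinking R A B Ω) (m : Ideal R) (O E : Type*) [Ring O]
    [Algebra R O] [Ring E] [Algebra R E] where
  /-- The map from the rational linking algebra. -/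
  θ : Ω →ₐ[R] E
  /-- The map from the completed linking algebra. -/
  ψ : O →ₐ[R] E
  /-- The map from `A` to the completed linking algebra. -/
  i : A → O
  /-- The map from `B` to the completed linking algebra. -/
  j : B → O
  θ_i : ∀ a, θ (D.i a) = ψ (i a)
  θ_j : ∀ b, θ (D.j b) = ψ (j b)
  exists_smul_eq_zero : ∀ x, ψ x = 0 → ∃ d ∈ R⁰, d • x = 0
  dense : ∀ p, ∃ x, ∃ z ∈ m • (⊤ : Submodule R O), θ x = ψ (p + z)
  exists_smul_mem : ∀ x, ∃ c ∈ R⁰, θ (c • x) ∈ ψ.range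
  left_mem : ∀ I ≥ m, ∀ a, ∀ c ∈ R⁰, ∀ d ∈ R⁰, ∀ z ∈ I • (⊤ : Submodule R O),
    d • i a = (d * c) • z → ∃ s ∉ m, ∃ b ∈ I • (⊤ : Submodule R A), s • a = c • b
  right_mem : ∀ I ≥ m, ∀ a, ∀ c ∈ R⁰, ∀ d ∈ R⁰, ∀ z ∈ I • (⊤ : Submodule R O),
    d • j a = (d * c) • z → ∃ s ∉ m, ∃ b ∈ I • (⊤ : Submodule R B), s • a = c • b
  full_left : ∃ (n : ℕ) (x y : Fin n → O), i 1 = ∑ k, x k * j 1 * y k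
  full_right : ∃ (n : ℕ) (x y : Fin n → O), j 1 = ∑ k, x k * i 1 * y k

namespace Comparison

variable {D : RationalLinking R A B Ω} {m : Ideal R} {O E : Type*} [Ring O]
    [Algebra R O] [Ring E] [Algebra R E]

/-- The same comparison with the roles of `A` and `B` exchanged. -/
def symm (Θ : D.Comparison m O E) : D.symm.Comparison m O E where
  θ := Θ.θ
  ψ := Θ.ψ
  i := Θ.j
  j := Θ.i
  θ_i := Θ.θ_j
  θ_j := Θ.θ_i
  exists_smul_eq_zero := Θ.exists_smul_eq_zero
  dense := Θ.dense
  exists_smul_mem := Θ.exists_smul_mem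
  left_mem := Θ.right_mem
  right_mem := Θ.left_mem
  full_left := Θ.full_right
  full_right := Θ.full_left

/-- The elements of `Ω` which are integral at `m`, in the sense that they come from `O`. -/
def integral (Θ : D.Comparison m O E) : Subalgebra R Ω := Θ.ψ.range.comap Θ.θ

variable (Θ : D.Comparison m O E)

lemma i_mem_integral (a : A) : D.i a ∈ Θ.integral := ⟨Θ.i a, (Θ.θ_i a).symm⟩

lemma left_le_integral : D.left ≤ Θ.integral.toSubmodule := by
  rintro _ ⟨a, rfl⟩
  exact Θ.i_mem_integral a

/-- In the corner `e Ω e` integrality at `m` means membership in `A`, up to localization. -/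
lemma mem_saturate_left [m.IsPrime] {I : Ideal R} (hI : m ≤ I) {x : Ω}
    (hx : D.i 1 * x * D.i 1 = x) {z : O} (hz : z ∈ I • (⊤ : Submodule R O))
    (h : Θ.θ x = Θ.ψ z) : x ∈ saturate m.primeCompl (I • D.left) := by
  obtain ⟨c, hc, a, ha⟩ := D.left_full x
  rw [hx] at ha
  have h1 : Θ.ψ (Θ.i a - c • z) = 0 := by
    rw [map_sub, ← Θ.θ_i, ha, map_smul, map_smul, h, sub_self]
  obtain ⟨d, hd, h2⟩ := Θ.exists_smul_eq_zero _ h1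
  rw [smul_sub, sub_eq_zero, smul_smul] at h2
  obtain ⟨s, hs, b, hb, hab⟩ := Θ.left_mem I hI a c hc d hd z hz h2
  refine ⟨s, hs, ?_⟩
  have h3 : s • x = D.i b := by
    refine D.smul_left_cancel hc ?_
    rw [smul_comm, ← ha, ← map_smul, ← map_smul, hab]
  rw [h3, left, LinearMap.range_eq_map, ← Submodule.map_smul'']
  exact mem_map_of_mem hb

lemma mem_saturate_left_of_mem_integral [m.IsPrime] {x : Ω} (hx : D.i 1 * x * D.i 1 = x)
    (h : x ∈ Θ.integral) : x ∈ saturate m.primeCompl D.left := by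
  obtain ⟨z, hz⟩ := h
  have h1 := Θ.mem_saturate_left (I := ⊤) le_top hx (z := z) (by rw [Submodule.top_smul]; trivial)
    hz.symm
  rwa [Submodule.top_smul] at h1

/-- The dual of an integral lattice contains all integral elements. -/
lemma mem_saturate_dual [m.IsPrime] {L : Submodule R Ω} (hL : D.IsLattice L)
    (hL' : L ≤ Θ.integral.toSubmodule) {x : Ω} (hx : D.j 1 * x = x) (hx' : x * D.i 1 = x)
    (h : x ∈ Θ.integral) : x ∈ saturate m.primeCompl (D.dual L) := by
  refine RationalLinking.mem_saturate_dual hL.fg hx hx' (fun y hy => ?_) fun y hy => ?_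
  · refine Θ.mem_saturate_left_of_mem_integral ?_ (mul_mem (hL' hy) h)
    rw [← mul_assoc, hL.e_mul y hy, mul_assoc, hx']
  · refine Θ.symm.mem_saturate_left_of_mem_integral ?_ (mul_mem h (hL' hy))
    change D.j 1 * (x * y) * D.j 1 = x * y
    rw [← mul_assoc, hx, mul_assoc, hL.mul_f y hy]

/-- The idempotent `e` is congruent modulo `m A` to a sum of products of integral elements, obtained
by approximation of such a representation in `O`. -/
lemma exists_approximation [m.IsPrime] : ∃ X Y : Submodule R Ω, X.FG ∧ Y.FG ∧ D.InCorner X ∧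
    D.symm.InCorner Y ∧ X ≤ Θ.integral.toSubmodule ∧ Y ≤ Θ.integral.toSubmodule ∧
    D.i 1 ∈ X * Y ⊔ saturate m.primeCompl (m • D.left) := by
  obtain ⟨n, x, y, hxy⟩ := Θ.full_left
  choose x' z hz hx' using fun k => Θ.dense (x k)
  choose y' w hw hy' using fun k => Θ.dense (y k)
  have he : D.i 1 ∈ Θ.integral := Θ.i_mem_integral 1
  have hf : D.j 1 ∈ Θ.integral := Θ.symm.i_mem_integral 1
  refine ⟨span R (Set.range fun k => D.i 1 * x' k * D.j 1),
    span R (Set.range fun k => D.j 1 * y' k * D.i 1), fg_span (Set.finite_range _),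
    fg_span (Set.finite_range _), inCorner_span ?_, inCorner_span ?_, span_le.2 ?_, span_le.2 ?_,
    ?_⟩
  · rintro _ ⟨k, rfl⟩
    exact ⟨by rw [← mul_assoc, ← mul_assoc, e_mul_e], by rw [mul_assoc, f_mul_f]⟩
  · rintro _ ⟨k, rfl⟩
    exact ⟨by rw [← mul_assoc, ← mul_assoc]; exact congrArg (· * _ * _) D.f_mul_f,
      by rw [mul_assoc]; exact congrArg (_ * ·) D.e_mul_e⟩
  · rintro _ ⟨k, rfl⟩
    exact Θ.integral.mul_mem (Θ.integral.mul_mem he ⟨_, (hx' k).symm⟩) hf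
  · rintro _ ⟨k, rfl⟩
    exact Θ.integral.mul_mem (Θ.integral.mul_mem hf ⟨_, (hy' k).symm⟩) he
  · let N : Submodule R O := m • ⊤
    have hl : ∀ a, ∀ u ∈ N, a * u ∈ N := fun a u hu => by
      refine smul_induction_on hu (fun r hr v _ => ?_) fun v v' hv hv' => ?_
      · rw [mul_smul_comm]
        exact smul_mem_smul hr trivial
      · rw [mul_add]
        exact add_mem hv hv'
    have hr : ∀ a, ∀ u ∈ N, u * a ∈ N := fun a u hu => by
      refine smul_induction_on hu (fun r hr v _ => ?_) fun v v' hv hv' => ?_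
      · rw [smul_mul_assoc]
        exact smul_mem_smul hr trivial
      · rw [add_mul]
        exact add_mem hv hv'
    let u := ∑ k, (x k * Θ.j 1 * w k + z k * Θ.j 1 * y k + z k * Θ.j 1 * w k)
    have hu : u ∈ N := sum_mem fun k _ =>
      add_mem (add_mem (hl _ _ (hw k)) (hr _ _ (hr _ _ (hz k)))) (hl _ _ (hw k))
    have h1 : Θ.θ (D.i 1 - ∑ k, x' k * D.j 1 * y' k) = Θ.ψ (-u) := by
      rw [map_sub, map_sum, Θ.θ_i, hxy, ← sub_eq_zero, map_neg, sub_neg_eq_add]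
      simp only [u, map_sum, map_mul, map_add, hx', hy', Θ.θ_j]
      rw [← Finset.sum_sub_distrib, ← Finset.sum_add_distrib]
      refine Finset.sum_eq_zero fun k _ => ?_
      noncomm_ring
    have h2 : D.i 1 - ∑ k, (D.i 1 * x' k * D.j 1) * (D.j 1 * y' k * D.i 1) =
        D.i 1 * (D.i 1 - ∑ k, x' k * D.j 1 * y' k) * D.i 1 := by
      rw [mul_sub, sub_mul, e_mul_e, e_mul_e, Finset.mul_sum, Finset.sum_mul]
      refine congrArg _ (Finset.sum_congr rfl fun k _ => ?_)
      rw [mul_assoc (D.i 1 * x' k), ← mul_assoc (D.j 1), ← mul_assoc (D.j 1), f_mul_f]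
      simp only [mul_assoc]
    have h3 : D.i 1 - ∑ k, (D.i 1 * x' k * D.j 1) * (D.j 1 * y' k * D.i 1) ∈
        saturate m.primeCompl (m • D.left) := by
      refine Θ.mem_saturate_left le_rfl (z := Θ.i 1 * (-u) * Θ.i 1) ?_
        (hr _ _ (hl _ _ (neg_mem hu))) ?_
      · rw [h2, ← mul_assoc, ← mul_assoc, e_mul_e, mul_assoc, e_mul_e]
      · rw [h2, map_mul, map_mul, h1, Θ.θ_i, map_mul, map_mul]
    have h4 := add_mem_sup (sum_mem (t := Finset.univ) fun k _ => mul_mem_mul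
      (subset_span (Set.mem_range_self (f := fun k => D.i 1 * x' k * D.j 1) k))
      (subset_span (Set.mem_range_self (f := fun k => D.j 1 * y' k * D.i 1) k))) h3
    rwa [add_sub_cancel] at h4

lemma i_one_mem_saturate_of_mul_le [m.IsMaximal] [Module.Finite R A] {J X Y : Submodule R Ω}
    (hJ : J * D.left ≤ J) (hXY : X * Y ≤ saturate m.primeCompl J)
    (h : D.i 1 ∈ X * Y ⊔ saturate m.primeCompl (m • D.left)) :
    D.i 1 ∈ saturate m.primeCompl J := by
  refine mem_saturate_of_sup m hJ ?_
  have h1 : X * Y ⊔ saturate m.primeCompl (m • D.left) ≤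
      saturate m.primeCompl (J ⊔ m • D.left) :=
    sup_le (hXY.trans (saturate_mono le_sup_left)) (saturate_mono le_sup_right)
  exact h1 h

include Θ in
/-- The existence of an invertible lattice at `m` can be checked after completion. -/
theorem exists_isLattice_isInvertibleAt [m.IsMaximal] [Module.Finite R A] [Module.Finite R B] :
    ∃ L, D.IsLattice L ∧ D.IsInvertibleAt m.primeCompl L := by
  obtain ⟨X, Y, hX, -, hXc, hYc, hXi, hYi, he⟩ := Θ.exists_approximation
  obtain ⟨X', Y', -, hY', hXc', hYc', hXi', hYi', hf⟩ := Θ.symm.exists_approximation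
  obtain ⟨L₀, hL₀⟩ := D.exists_isLattice
  obtain ⟨c, hc, hcL⟩ := exists_forall_smul_mem (M := R⁰) (Y := Θ.integral.toSubmodule) hL₀.fg
    fun x _ => Θ.exists_smul_mem x
  let Z := L₀.map (LinearMap.lsmul R Ω c)
  have hYc'' : D.InCorner Y' := hYc'
  have hZc : D.InCorner Z := by
    constructor
    · rintro _ ⟨x, hx, rfl⟩
      rw [LinearMap.lsmul_apply, mul_smul_comm, hL₀.e_mul x hx]
    · rintro _ ⟨x, hx, rfl⟩
      rw [LinearMap.lsmul_apply, smul_mul_assoc, hL₀.mul_f x hx]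
  let L := D.left * (X ⊔ Y' ⊔ Z) * D.right
  have hXL : X ≤ L := hXc.le_sandwich.trans
    (mul_le_mul_left (mul_le_mul_right (le_sup_left.trans le_sup_left) _) _)
  have hYL : Y' ≤ L := hYc''.le_sandwich.trans
    (mul_le_mul_left (mul_le_mul_right (le_sup_right.trans le_sup_left) _) _)
  have hZL : Z ≤ L := hZc.le_sandwich.trans
    (mul_le_mul_left (mul_le_mul_right le_sup_right _) _)
  have hL : D.IsLattice L := by
    refine isLattice_sandwich ((hX.sup hY').sup (hL₀.fg.map _)) fun x => ?_
    obtain ⟨d, hd, hx⟩ := hL₀.full x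
    exact ⟨c * d, R⁰.mul_mem hc hd, by rw [mul_smul]; exact hZL ⟨_, hx, rfl⟩⟩
  have hZi : Z ≤ Θ.integral.toSubmodule := by
    rintro _ ⟨x, hx, rfl⟩
    exact hcL x hx
  have hLi : L ≤ Θ.integral.toSubmodule := by
    have h1 : Θ.integral.toSubmodule * Θ.integral.toSubmodule ≤ Θ.integral.toSubmodule :=
      mul_le.2 fun _ hx _ hy => Θ.integral.mul_mem hx hy
    exact (mul_le_mul' ((mul_le_mul' Θ.left_le_integral (sup_le (sup_le hXi hYi') hZi)).trans h1)
      Θ.symm.left_le_integral).trans h1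
  have hdual : ∀ V : Submodule R Ω, D.symm.InCorner V → V ≤ Θ.integral.toSubmodule →
      V ≤ saturate m.primeCompl (D.dual L) := fun V hV hVi x hx =>
    Θ.mem_saturate_dual hL hLi (hV.e_mul x hx) (hV.mul_f x hx) (hVi hx)
  refine ⟨L, hL, i_one_mem_saturate_of_mul_le hL.mul_left ?_ he,
    i_one_mem_saturate_of_mul_le (D := D.symm) ?_ ?_ hf⟩
  · exact (mul_le_mul' hXL (hdual Y hYc hYi)).trans (mul_le_saturate_left le_rfl)
  · rw [mul_assoc]
    exact mul_le_mul_right hL.mul_right _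
  · exact (mul_le_mul' (hdual X' hXc' hXi') hYL).trans (mul_le_saturate le_rfl)

end Comparison

end RationalLinking

end

/-! ### Preparations for the completion -/

section

open nonZeroDivisors Submodule

/-- The isomorphism `S ⊗ (K ⊗ A) ≃ S ⊗ A` for a not necessarily commutative algebra `A`. -/
noncomputable def cancelBaseChangeAlgEquiv (R K S A : Type*) [CommRing R] [CommRing K]
    [CommRing S] [Ring A] [Algebra R K] [Algebra R S] [Algebra K S] [IsScalarTower R K S]
    [Algebra R A] : S ⊗[K] (K ⊗[R] A) ≃ₐ[S] S ⊗[R] A :=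
  AlgEquiv.symm <| AlgEquiv.ofLinearEquiv
    (TensorProduct.AlgebraTensorModule.cancelBaseChange R K S S A).symm
    (by simp [Algebra.TensorProduct.one_def])
    (LinearMap.map_mul_of_map_mul_tmul (fun _ _ _ _ => by simp))

section Descent

variable {R : Type*} [CommRing R] [IsNoetherianRing R] {A T : Type*} [Ring A] [Algebra R A]
    [CommRing T] [Algebra R T]

/-- Congruences modulo a power of `m` descend from the completion `T`, and divisibility by a regular
element of `R` can be read off from such a congruence. -/
lemma exists_smul_eq_smul_of_completion [Module.IsTorsionFree R A] (hdim : ringKrullDim R ≤ 1)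
    (m : Ideal R) [m.IsMaximal] (hT : ∀ k, Nonempty (T →ₐ[R] R ⧸ m ^ k)) {g : R} (hg : g ∈ R⁰)
    (hgm : g ∈ m) {I : Ideal R} (hI : m ≤ I) {a : A} {c d : R} (hc : c ∈ R⁰) (hd : d ∈ R⁰)
    {w : T ⊗[R] A} (hw : w ∈ I • (⊤ : Submodule R (T ⊗[R] A)))
    (h : d • ((1 : T) ⊗ₜ[R] a) = (d * c) • w) :
    ∃ s ∉ m, ∃ b ∈ I • (⊤ : Submodule R A), s • a = c • b := by
  obtain ⟨t, ht, k, hk⟩ := exists_notMem_forall_pow_mul_mem hdim m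
    (R⁰.mul_mem (R⁰.mul_mem hd hc) hg)
  obtain ⟨φ⟩ := hT k
  let π : T ⊗[R] A →ₗ[R] A ⧸ (m ^ k • (⊤ : Submodule R A)) :=
    (TensorProduct.quotTensorEquivQuotSMul A (m ^ k)).toLinearMap ∘ₗ
      LinearMap.rTensor A φ.toLinearMap
  have hπ : π (1 ⊗ₜ a) = Submodule.Quotient.mk a := by
    change TensorProduct.quotTensorEquivQuotSMul A (m ^ k) (φ 1 ⊗ₜ a) = _
    rw [map_one, TensorProduct.quotTensorEquivQuotSMul_mk_one_tmul]
  obtain ⟨b, hb, hbw⟩ : ∃ b ∈ I • (⊤ : Submodule R A), Submodule.Quotient.mk b = π w := by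
    have h1 : π w ∈ (I • (⊤ : Submodule R A)).map (mkQ (m ^ k • (⊤ : Submodule R A))) := by
      rw [Submodule.map_smul'', Submodule.map_top, Submodule.range_mkQ]
      have h2 := mem_map_of_mem (f := π) hw
      rw [Submodule.map_smul''] at h2
      exact (smul_mono_right I le_top : I • LinearMap.range π ≤ I • ⊤)
        (by rwa [Submodule.map_top] at h2)
    exact h1
  have h1 : d • a - (d * c) • b ∈ m ^ k • (⊤ : Submodule R A) := by
    rw [← Submodule.Quotient.mk_eq_zero, Submodule.Quotient.mk_sub, Submodule.Quotient.mk_smul,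
      Submodule.Quotient.mk_smul, hbw, ← hπ, ← map_smul, ← map_smul, h, sub_self]
  have h2 : ∀ x ∈ m ^ k • (⊤ : Submodule R A), ∃ y, t • x = (d * c * g) • y := by
    intro x hx
    refine smul_induction_on hx (fun r hr y _ => ?_) fun x x' hx hx' => ?_
    · obtain ⟨q, hq⟩ := Ideal.mem_span_singleton'.1 (hk r hr)
      exact ⟨q • y, by rw [smul_smul, ← hq, mul_comm, mul_smul]⟩
    · obtain ⟨y, hy⟩ := hx
      obtain ⟨y', hy'⟩ := hx'
      exact ⟨y + y', by rw [smul_add, smul_add, hy, hy']⟩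
  obtain ⟨y, hy⟩ := h2 _ h1
  refine ⟨t, ht, t • b + g • y, add_mem (smul_mem _ _ hb) (smul_mem_smul (hI hgm) trivial), ?_⟩
  refine (Module.IsTorsionFree.isSMulRegular (isRegular_iff_mem_nonZeroDivisors.2 hd) :
    IsSMulRegular A d) ?_
  change d • t • a = d • c • (t • b + g • y)
  have h3 : d • t • a = t • (d • a - (d * c) • b) + (d * c) • t • b := by
    rw [smul_sub, smul_comm t d a, smul_comm t (d * c) b, sub_add_cancel]
  rw [h3, hy, smul_add, smul_add, add_comm]
  simp only [smul_smul, mul_assoc]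

/-- Elements of a high power of `m` are divisible in the completion `T` by a given regular element
of `R`. -/
lemma exists_algebraMap_mul_eq_of_mem_map (hdim : ringKrullDim R ≤ 1)
    (m : Ideal R) [m.IsMaximal] (hT : ∀ s ∉ m, IsUnit (algebraMap R T s)) {c : R} (hc : c ∈ R⁰) :
    ∃ k, ∀ v ∈ (m ^ k).map (algebraMap R T), ∃ v', v = algebraMap R T c * v' := by
  obtain ⟨t, ht, k, hk⟩ := exists_notMem_forall_pow_mul_mem hdim m hc
  refine ⟨k, fun v hv => ?_⟩
  suffices h : (m ^ k).map (algebraMap R T) ≤ Ideal.span {algebraMap R T c} by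
    obtain ⟨v', hv'⟩ := Ideal.mem_span_singleton'.1 (h hv)
    exact ⟨v', by rw [← hv', mul_comm]⟩
  rw [Ideal.map_le_iff_le_comap]
  intro x hx
  rw [Ideal.mem_comap, ← Ideal.unit_mul_mem_iff_mem _ (hT t ht), ← map_mul,
    ← Set.image_singleton, ← Ideal.map_span]
  exact Ideal.mem_map_of_mem _ (hk x hx)

end Descent

section RationalEnvelope

variable {R : Type u} [CommRing R] {A : Type u} [Ring A] [Algebra R A]

lemma algebraMap_rationalEnvelope_injective [Module.IsTorsionFree R A]
    (h : Function.Injective (algebraMap R A)) :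
    Function.Injective (algebraMap (FractionRing R) (RationalEnvelope R A)) := by
  rw [injective_iff_map_eq_zero]
  intro k hk
  obtain ⟨r, c, rfl⟩ := IsLocalization.exists_mk'_eq R⁰ k
  have h1 : (1 : FractionRing R) ⊗ₜ[R] (algebraMap R A r) = 0 := by
    rw [Algebra.algebraMap_eq_smul_one, ← TensorProduct.smul_tmul, Algebra.smul_def, mul_one,
      ← IsLocalization.mk'_spec' (FractionRing R) r c, ← Algebra.smul_def,
      ← TensorProduct.smul_tmul']
    exact (congrArg _ hk).trans (smul_zero _)
  have h2 : algebraMap R A r = 0 := one_tmul_injective (FractionRing R)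
    (h1.trans (TensorProduct.tmul_zero _ _).symm)
  rw [← map_zero (algebraMap R A)] at h2
  rw [h h2, IsLocalization.mk'_zero]

lemma isCentral_rationalEnvelope [Module.IsTorsionFree R A] [Algebra.IsCentral R A] :
    Algebra.IsCentral (FractionRing R) (RationalEnvelope R A) := by
  refine ⟨fun z hz => ?_⟩
  rw [Subalgebra.mem_center_iff] at hz
  obtain ⟨⟨a, c⟩, h⟩ := IsLocalizedModule.surj R⁰ (TensorProduct.mk R (FractionRing R) A 1) z
  change (c : R) • z = 1 ⊗ₜ a at h
  have h1 : a ∈ Subalgebra.center R A := by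
    rw [Subalgebra.mem_center_iff]
    intro b
    apply one_tmul_injective (R := R) (FractionRing R)
    have h2 : ∀ x y : A, (1 : FractionRing R) ⊗ₜ[R] (x * y) = (1 ⊗ₜ x) * (1 ⊗ₜ y) := fun x y => by
      rw [Algebra.TensorProduct.tmul_mul_tmul, one_mul]
    change (1 : FractionRing R) ⊗ₜ[R] (b * a) = 1 ⊗ₜ[R] (a * b)
    rw [h2, h2, ← h, mul_smul_comm, smul_mul_assoc, hz]
  obtain ⟨r, rfl⟩ := Algebra.mem_bot.1 (Algebra.IsCentral.out h1)
  refine Algebra.mem_bot.2 ⟨IsLocalization.mk' _ r c, ?_⟩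
  obtain ⟨u, hu⟩ := IsLocalization.map_units (FractionRing R) c
  have h3 : ∀ x : RationalEnvelope R A, (c : R) • x = (u : FractionRing R) • x := fun x => by
    rw [hu, algebraMap_smul]
  have h4 : (u : FractionRing R) • algebraMap (FractionRing R) (RationalEnvelope R A)
      (IsLocalization.mk' _ r c) = (u : FractionRing R) • z := by
    rw [← h3 z, h, hu, Algebra.algebraMap_eq_smul_one (A := A), ← TensorProduct.smul_tmul,
      Algebra.smul_def r, mul_one, ← IsLocalization.mk'_spec' (FractionRing R) r c, ← smul_eq_mul,
      ← TensorProduct.smul_tmul']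
    rfl
  exact u.isUnit.smul_left_cancel.1 h4

end RationalEnvelope

end

/-! ### Invertible lattices from the completion -/

section

open nonZeroDivisors Submodule

section Comparison

variable {R : Type u} [CommRing R] [IsNoetherianRing R] [IsReduced R] {A B Ω T S O : Type u}
    [Ring A] [Algebra R A] [Ring B] [Algebra R B] [Ring Ω] [Algebra R Ω]
    [Algebra (FractionRing R) Ω] [IsScalarTower R (FractionRing R) Ω]
    [CommRing T] [Algebra R T] [CommRing S] [Algebra R S] [Algebra T S] [IsScalarTower R T S]
    [Algebra (FractionRing R) S] [IsScalarTower R (FractionRing R) S]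
    [Ring O] [Algebra R O] [Algebra T O] [IsScalarTower R T O]

omit [IsNoetherianRing R] [IsReduced R] [Algebra R Ω] [IsScalarTower R (FractionRing R) Ω]
  [Algebra R O] [IsScalarTower R T O] in
/-- Over an Artinian ring `S` above both the completion `T` and the total ring of fractions of `R` the
two linking algebras are isomorphic. -/
lemma Linking.exists_algHom_completion [IsSemisimpleRing (FractionRing R)] [IsArtinianRing S]
    [Module.Finite R A] [Module.Finite R B]
    [IsSemisimpleRing (RationalEnvelope R A)] [IsSemisimpleRing (RationalEnvelope R B)]
    [Algebra.IsCentral (FractionRing R) (RationalEnvelope R A)]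
    [Algebra.IsCentral (FractionRing R) (RationalEnvelope R B)]
    (hA : Function.Injective (algebraMap (FractionRing R) (RationalEnvelope R A)))
    (l : Linking (FractionRing R) (RationalEnvelope R A) (RationalEnvelope R B) Ω)
    (lT : Linking T (T ⊗[R] A) (T ⊗[R] B) O) :
    ∃ Θ : S ⊗[FractionRing R] Ω →ₐ[S] S ⊗[T] O,
      (∀ a, Θ (1 ⊗ₜ l.i (1 ⊗ₜ a)) = 1 ⊗ₜ lT.i (1 ⊗ₜ a)) ∧
      (∀ b, Θ (1 ⊗ₜ l.j (1 ⊗ₜ b)) = 1 ⊗ₜ lT.j (1 ⊗ₜ b)) ∧ Function.Surjective Θ := by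
  let α (C : Type u) [Ring C] [Algebra R C] : S ⊗[FractionRing R] (FractionRing R ⊗[R] C) ≃ₐ[S]
      S ⊗[T] (T ⊗[R] C) :=
    (cancelBaseChangeAlgEquiv R (FractionRing R) S C).trans (cancelBaseChangeAlgEquiv R T S C).symm
  have hα : ∀ (C : Type u) [Ring C] [Algebra R C] (c : C),
      α C (1 ⊗ₜ (1 ⊗ₜ c)) = 1 ⊗ₜ (1 ⊗ₜ c) := by
    intro C _ _ c
    have h1 : ∀ (Q : Type u) [CommRing Q] [Algebra R Q] [Algebra Q S] [IsScalarTower R Q S],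
        cancelBaseChangeAlgEquiv R Q S C (1 ⊗ₜ (1 ⊗ₜ c)) = 1 ⊗ₜ c := fun Q _ _ _ _ =>
      (TensorProduct.AlgebraTensorModule.cancelBaseChange_tmul R Q S 1 c 1).trans
        (by rw [one_smul])
    rw [AlgEquiv.trans_apply, h1, AlgEquiv.symm_apply_eq, h1]
  let l₁ := l.baseChange S
  let l₂ : Linking S (S ⊗[FractionRing R] RationalEnvelope R A)
      (S ⊗[FractionRing R] RationalEnvelope R B) (S ⊗[T] O) :=
    (lT.baseChange S).congr (α A) (α B)
  obtain ⟨h1, h2⟩ := exists_eq_algebraMap_of_central (FractionRing R) (RationalEnvelope R A) hA S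
  obtain ⟨Θ, hi, hj, hsurj⟩ := Linking.exists_algHom l₁ l₂ h1 h2
    (generatedByInvariants_baseChange (FractionRing R) (RationalEnvelope R B) S)
  refine ⟨Θ, fun a => ?_, fun b => ?_, hsurj⟩
  · refine Eq.trans ?_ ((hi (1 ⊗ₜ (1 ⊗ₜ a))).trans ?_)
    · exact congrArg Θ (LinearMap.baseChange_tmul _ _ _).symm
    · exact (congrArg (lT.baseChange S).i (hα A a)).trans (LinearMap.baseChange_tmul _ _ _)
  · refine Eq.trans ?_ ((hj (1 ⊗ₜ (1 ⊗ₜ b))).trans ?_)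
    · exact congrArg Θ (LinearMap.baseChange_tmul _ _ _).symm
    · exact (congrArg (lT.baseChange S).j (hα B b)).trans (LinearMap.baseChange_tmul _ _ _)

/-- A linking algebra of the completions at `m` gives rise to an invertible lattice at `m`. -/
theorem Linking.exists_isLattice_isInvertibleAt [Module.IsTorsionFree R A]
    [Module.IsTorsionFree R B]
    [IsArtinianRing S] [IsLocalization (Algebra.algebraMapSubmonoid T R⁰) S]
    [Module.Finite R A] [Module.Finite R B]
    [IsSemisimpleRing (RationalEnvelope R A)] [IsSemisimpleRing (RationalEnvelope R B)]
    [Algebra.IsCentral (FractionRing R) (RationalEnvelope R A)]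
    [Algebra.IsCentral (FractionRing R) (RationalEnvelope R B)]
    (hA : Function.Injective (algebraMap (FractionRing R) (RationalEnvelope R A)))
    (hdim : ringKrullDim R ≤ 1) (m : Ideal R) [m.IsMaximal] {g : R} (hg : g ∈ R⁰) (hgm : g ∈ m)
    (hunit : ∀ s ∉ m, IsUnit (algebraMap R T s))
    (hdense : ∀ k, ∀ x : T, ∃ r, x - algebraMap R T r ∈ (m ^ k).map (algebraMap R T))
    (hquot : ∀ k, Nonempty (T →ₐ[R] R ⧸ m ^ k))
    (l : Linking (FractionRing R) (RationalEnvelope R A) (RationalEnvelope R B) Ω)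
    (lT : Linking T (T ⊗[R] A) (T ⊗[R] B) O) :
    ∃ L, l.toRationalLinking.IsLattice L ∧ l.toRationalLinking.IsInvertibleAt m.primeCompl L := by
  obtain ⟨Θ, hi, hj, hsurj⟩ := l.exists_algHom_completion (S := S) hA lT
  let θ : Ω →ₐ[R] S ⊗[T] O := (Θ.restrictScalars R).comp
    ((Algebra.TensorProduct.includeRight :
      Ω →ₐ[FractionRing R] S ⊗[FractionRing R] Ω).restrictScalars R)
  let ψ : O →ₐ[R] S ⊗[T] O :=
    (Algebra.TensorProduct.includeRight : O →ₐ[T] S ⊗[T] O).restrictScalars R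
  have hθ : ∀ x, θ x = Θ (1 ⊗ₜ x) := fun _ => rfl
  have hψ : ∀ x, ψ x = 1 ⊗ₜ x := fun _ => rfl
  have hsmul : ∀ x, ∃ c ∈ R⁰, ∃ q, θ (c • x) = ψ q := fun x => by
    obtain ⟨⟨q, _, c, hc, rfl⟩, h⟩ := IsLocalizedModule.surj (Algebra.algebraMapSubmonoid T R⁰)
      (TensorProduct.mk T S O 1) (θ x)
    refine ⟨c, hc, q, ?_⟩
    rw [map_smul, ← algebraMap_smul T]
    exact h
  have hcancel : ∀ d ∈ R⁰, ∀ x y : S ⊗[T] O, d • x = d • y → x = y := fun d hd x y h => by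
    rw [← algebraMap_smul S d x, ← algebraMap_smul S d y, IsScalarTower.algebraMap_apply R T S] at h
    exact (IsLocalization.map_units S (⟨_, d, hd, rfl⟩ :
      Algebra.algebraMapSubmonoid T R⁰)).smul_left_cancel.1 h
  -- every element is the sum of a rational one and one that is small in the completion
  have happrox : ∀ u : S ⊗[FractionRing R] Ω, ∃ x, ∃ z ∈ m • (⊤ : Submodule R O),
      Θ u = θ x + ψ z := by
    intro u
    induction u using TensorProduct.induction_on with
    | zero => exact ⟨0, 0, zero_mem _, by rw [map_zero, map_zero, map_zero, add_zero]⟩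
    | add u u' hu hu' =>
      obtain ⟨x, z, hz, h⟩ := hu
      obtain ⟨x', z', hz', h'⟩ := hu'
      exact ⟨x + x', z + z', add_mem hz hz', by
        rw [map_add, h, h', map_add, map_add, add_add_add_comm]⟩
    | tmul s x =>
      obtain ⟨c, hc, q, hq⟩ := hsmul x
      obtain ⟨t, ⟨_, d, hd, rfl⟩, rfl⟩ :=
        IsLocalization.exists_mk'_eq (Algebra.algebraMapSubmonoid T R⁰) s
      obtain ⟨k, hk⟩ := exists_algebraMap_mul_eq_of_mem_map hdim m hunit
        (R⁰.mul_mem (R⁰.mul_mem hd hc) hg)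
      obtain ⟨r, hr⟩ := hdense k t
      obtain ⟨v, hv⟩ := hk _ hr
      obtain ⟨x', hx'⟩ := l.toRationalLinking.exists_smul_eq hd (r • x)
      refine ⟨x', g • v • q, smul_mem_smul hgm trivial, hcancel d hd _ _ ?_⟩
      set σ := IsLocalization.mk' S t
        (⟨algebraMap R T d, d, hd, rfl⟩ : Algebra.algebraMapSubmonoid T R⁰) with hσ
      have h1 : Θ (σ ⊗ₜ x) = σ • θ x := by
        rw [hθ, ← map_smul, TensorProduct.smul_tmul', smul_eq_mul, mul_one]
      have h2 : d • σ • θ x = t • θ x := by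
        rw [← algebraMap_smul T d, ← algebraMap_smul S (algebraMap R T d), smul_smul,
          ← algebraMap_smul S t]
        congr 1
        exact IsLocalization.mk'_spec' S t
          (⟨algebraMap R T d, d, hd, rfl⟩ : Algebra.algebraMapSubmonoid T R⁰)
      have h3 : t = algebraMap R T r + algebraMap R T (d * c * g) * v := by rw [← hv]; ring
      have h4 : ψ (v • q) = v • ψ q := TensorProduct.tmul_smul v 1 q
      rw [h1, smul_add, h2, h3, add_smul, algebraMap_smul, mul_smul, algebraMap_smul, map_smul ψ g,
        h4, ← hq, ← map_smul θ d, hx', map_smul θ r, map_smul θ c, smul_comm v c]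
      congr 1
      rw [smul_smul, smul_smul]
      congr 1
      ring
  let C : l.toRationalLinking.Comparison m O (S ⊗[T] O) :=
    { θ := θ
      ψ := ψ
      i := fun a => lT.i (1 ⊗ₜ a)
      j := fun b => lT.j (1 ⊗ₜ b)
      θ_i := hi
      θ_j := hj
      exists_smul_eq_zero := fun x hx => by
        obtain ⟨⟨_, d, hd, rfl⟩, h⟩ := (IsLocalizedModule.eq_zero_iff
          (Algebra.algebraMapSubmonoid T R⁰) (TensorProduct.mk T S O 1)).1 hx
        exact ⟨d, hd, by rwa [← algebraMap_smul T]⟩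
      dense := fun p => by
        obtain ⟨u, hu⟩ := hsurj (ψ p)
        obtain ⟨x, z, hz, h⟩ := happrox u
        refine ⟨x, -z, neg_mem hz, ?_⟩
        rw [map_add, map_neg, ← hu, h, add_neg_cancel_right]
      exists_smul_mem := fun x => by
        obtain ⟨c, hc, q, hq⟩ := hsmul x
        exact ⟨c, hc, q, hq.symm⟩
      left_mem := fun I hI a c hc d hd z hz h => by
        refine exists_smul_eq_smul_of_completion (T := T) hdim m hquot hg hgm hI hc hd
          (w := lT.p z) ?_ ?_
        · have h1 := mem_map_of_mem (f := lT.p.restrictScalars R) hz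
          rw [Submodule.map_smul''] at h1
          exact (smul_mono_right I le_top : I • (⊤ : Submodule R O).map _ ≤ I • ⊤) h1
        · have h1 := congrArg (lT.p.restrictScalars R) h
          rw [map_smul, map_smul] at h1
          change d • lT.p (lT.i _) = _ at h1
          rwa [lT.p_i] at h1
      right_mem := fun I hI b c hc d hd z hz h => by
        refine exists_smul_eq_smul_of_completion (T := T) hdim m hquot hg hgm hI hc hd
          (w := lT.q z) ?_ ?_
        · have h1 := mem_map_of_mem (f := lT.q.restrictScalars R) hz
          rw [Submodule.map_smul''] at h1
          exact (smul_mono_right I le_top : I • (⊤ : Submodule R O).map _ ≤ I • ⊤) h1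
        · have h1 := congrArg (lT.q.restrictScalars R) h
          rw [map_smul, map_smul] at h1
          change d • lT.q (lT.j _) = _ at h1
          rwa [lT.q_j] at h1
      full_left := lT.full_left
      full_right := lT.full_right }
  exact C.exists_isLattice_isInvertibleAt

end Comparison

end

/-! ### The local-global criterion -/

theorem propositionP (R : Type u) [CommRing R] [IsReduced R] (hR : IsExcellentRing R)
    (hdim : ringKrullDim R = 1)
    (A : Type u) [Ring A] [Algebra R A] (hA : IsCentralOrder R A)
    (B : Type u) [Ring B] [Algebra R B] (hB : IsCentralOrder R B) :
    CentrallyMoritaEquivalent R A B ↔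
      CentrallyMoritaEquivalent (FractionRing R) (RationalEnvelope R A) (RationalEnvelope R B) ∧
      nonRegularLocus R A = nonRegularLocus R B ∧
      ∀ m ∈ nonRegularLocus R A,
        CentrallyMoritaEquivalent (LocalCompletion m.asIdeal)
          (CompletionAt A m) (CompletionAt B m) := by
  have := hR.noetherian
  have := hA.finite
  have := hB.finite
  have := hA.torsionFree
  have := hB.torsionFree
  have := hA.semisimple
  have := hB.semisimple
  have := hA.central
  have := hB.central
  constructor
  · intro h
    obtain ⟨Ω, _, _, ⟨l⟩⟩ := h.exists_linking
    exact ⟨CentrallyMoritaEquivalent.baseChange h _, nonRegularLocus_eq_of_linking l,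
      fun m _ => CentrallyMoritaEquivalent.baseChange h _⟩
  rintro ⟨hK, hlocus, hcompl⟩
  obtain ⟨Ω, _, _, ⟨l⟩⟩ := hK.exists_linking
  let _ : Algebra R Ω := Algebra.compHom Ω (algebraMap R (FractionRing R))
  have : IsScalarTower R (FractionRing R) Ω := IsScalarTower.of_algebraMap_eq fun _ => rfl
  have := isCentral_rationalEnvelope (R := R) (A := A)
  have := isCentral_rationalEnvelope (R := R) (A := B)
  obtain ⟨L, hL, hinv⟩ := l.toRationalLinking.exists_isLattice_forall_isInvertibleAt hdim.le
    fun m ⟨c, hc, hcm⟩ => by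
      by_cases hm : m ∈ nonRegularLocus R A
      · obtain ⟨O, _, _, ⟨lT⟩⟩ := (hcompl m hm).exists_linking
        let _ : Algebra R O := Algebra.compHom O (algebraMap R (LocalCompletion m.asIdeal))
        have : IsScalarTower R (LocalCompletion m.asIdeal) O :=
          IsScalarTower.of_algebraMap_eq fun _ => rfl
        have := isArtinianRing_localization_localCompletion m.asIdeal hdim.le hc hcm
        exact l.exists_isLattice_isInvertibleAt
          (S := Localization (Algebra.algebraMapSubmonoid (LocalCompletion m.asIdeal) (nonZeroDivisors R)))
          (algebraMap_rationalEnvelope_injective hA.injective) hdim.le m.asIdeal hc hcm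
          (fun _ => isUnit_algebraMap_localCompletion m.asIdeal)
          (exists_sub_algebraMap_mem m.asIdeal)
          (fun k => ⟨(exists_ker_eq_map m.asIdeal k).choose⟩) lT
      · have hm' : m ∉ nonRegularLocus R B := hlocus ▸ hm
        obtain ⟨L, hL⟩ := l.toRationalLinking.exists_isLattice
        exact ⟨L, hL, hL.isInvertibleAt_of_isMaximalAt hdim.le m.asIdeal
          (l.isMaximalAt m.asIdeal _ (not_not.1 hm)) (l.symm.isMaximalAt m.asIdeal _ (not_not.1 hm'))
          hc hcm⟩
  exact hL.isMoritaEquivalent hinv
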